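/- **Setting.** Let $\nu\ge 1$, $\mathtt m\ge 0$, $\alpha\in(0,1)$, $\rho>0$, $\mathbb T=\mathbb R/2\pi\mathbb Z$, and let $V:\mathbb T^\nu\times[0,\pi]\to\mathbb R$ satisfy * (V1) the even $2\pi$-periodic extension of $V(\theta,x)$ in $x$ is smooth in $(\theta,x)$ and extends analytically in $\theta$ to $\{|\mathrm{Im}\,\theta|\le\rho\}$; the extension is smooth in $x$ and for every $\ell\in\mathbb N_0$ there is $C_{\ell}>0$ with $|\partial_x^\ell V(\theta,x)|\le C_{\ell}$ for all $x\in\mathbb T$, $|\mathrm{Im}\,\theta|\le\rho$; * (V2) $\int_{\mathbb T^\nu}V(\theta,x)\,d\theta=0$ for every $x\in[0,\pi]$. For $r\ge 0$ let $\mathcal H^r$ be the space of functions $\varphi=\sum_{m\ge1}\varphi_m\sin(mx)$ on $[0,\pi]$, $\varphi_m\in\mathbb C$, with $\|\varphi\|_{\mathcal H^r}^2=\sum_{m\ge1}(1+m^2)^r|\varphi_m|^2<\infty$, and give $\mathcal H^r\times\mathcal H^r$ the norm $\|(\varphi,\psi)\|^2=\|\varphi\|_{\mathcal H^r}^2+\|\psi\|_{\mathcal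 H^r}^2$. Let $B=\sqrt{-\Delta+\mathtt m^2}$ (Dirichlet), i.e. $B\sin(mx)=\sqrt{m^2+\mathtt m^2}\,\sin(mx)$. For $\omega\in\mathbb R^\nu$ consider $$ i\,\partial_t\varphi(t)=\mathbf H(t)\varphi(t),\qquad \mathbf H(t)=\begin{pmatrix}B&0\\0&-B\end{pmatrix}+\tfrac12\,B^{-1/2}V(\omega t,\cdot)B^{-1/2}\begin{pmatrix}1&1\\-1&-1\end{pmatrix}. $$ A propagator $U_\omega(t,\tau)$ of this system on $\mathcal H^r\times\mathcal H^r$ is a family of bounded operators with $U_\omega(\tau,\tau)=\mathbf 1$ such that $t\mapsto U_\omega(t,\tau)\varphi$ is continuous in $\mathcal H^r\times\mathcal H^r$ and solves the system in the weak sense (tested against every $\sin(mx)$) for all $\tau$ and $\varphi$. Let $R_M=\{\omega\in\mathbb R^\nu: M\le|\omega|\le 2M\}$. **Statement.** There are $\gamma_0>0$ and $C>0$ such that for every $\gamma_*\in(0,\gamma_0)$ there are $M_*>1$ and, for every $M\ge M_*$, a measurable set $\Omega_\infty^\alpha=\Omega_\infty^\alpha(M,\gamma_*)\subseteq R_M$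 with $$\frac{\operatorname{meas}(R_M\setminus\Omega_\infty^\alpha)}{\operatorname{meas}(R_M)}\le C\gamma_*$$ such that the following holds. For every $r\ge0$ there are constants $c_r,C_r,c_r'>0$ such that for all $M\ge M_*$ and $\omega\in\Omega_\infty^\alpha(M,\gamma_*)$ the system has a unique propagator $U_\omega$ on $\mathcal H^r\times\mathcal H^r$, and for all $t\in\mathbb R$ and $\varphi_0\in\mathcal H^r\times\mathcal H^r$ $$c_r\|\varphi_0\|\le\|U_\omega(t,0)\varphi_0\|\le C_r\|\varphi_0\|$$ and, more precisely, $$\Big(1-\frac{c_r'}{M^{(1-\alpha)/2}}\Big)\|\varphi_0\|\le\|U_\omega(t,0)\varphi_0\|\le\Big(1+\frac{c_r'}{M^{(1-\alpha)/2}}\Big)\|\varphi_0\|,$$ where $\|\cdot\|$ is the norm of $\mathcal H^r\times\mathcal H^r$. -/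

import Mathlib

noncomputable section

namespace KleinGordon

/-! ### Sine–Sobolev spaces

A function `∑ a_m sin (m x)` (`m ≥ 1`) on `[0, π]` is represented by the sequence `a : ℕ+ → ℂ` of
its sine coefficients. -/

/-- The Japanese bracket `⟨m⟩ = (1 + m²)^(1/2)`. -/
def jb (m : ℕ+) : ℝ := Real.sqrt (1 + (m : ℝ) ^ 2)

/-- The sequences of sine coefficients with `∑ ⟨m⟩^(2r) |a_m|² < ∞`. -/
def sineSobolevSubmodule (r : ℝ) : Submodule ℂ (ℕ+ → ℂ) where
  carrier := {a | Memℓp (fun m => ((jb m ^ r : ℝ) : ℂ) * a m) 2}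
  add_mem' {a b} ha hb := by
    have h := ha.add hb
    have e : (fun m => ((jb m ^ r : ℝ) : ℂ) * (a + b) m)
        = (fun m => ((jb m ^ r : ℝ) : ℂ) * a m) + fun m => ((jb m ^ r : ℝ) : ℂ) * b m := by
      funext m; simp [mul_add]
    simpa only [Set.mem_ofPred_eq, e] using h
  zero_mem' := by
    have e : (fun m : ℕ+ => ((jb m ^ r : ℝ) : ℂ) * (0 : ℕ+ → ℂ) m) = 0 := by
      funext m; simp
    simpa only [Set.mem_ofPred_eq, e] using (zero_memℓp : Memℓp (0 : ℕ+ → ℂ) 2)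
  smul_mem' c a ha := by
    have h := ha.const_smul c
    have e : (fun m => ((jb m ^ r : ℝ) : ℂ) * (c • a) m)
        = c • fun m => ((jb m ^ r : ℝ) : ℂ) * a m := by
      funext m; simp; ring
    simpa only [Set.mem_ofPred_eq, e] using h

/-- The space `ℋ^r`.  It is a type of its own, so that it carries the topology of the norm below
and not the topology of pointwise convergence of sequences. -/
def SineSobolev (r : ℝ) : Type := ↥(sineSobolevSubmodule r)

instance (r : ℝ) : AddCommGroup (SineSobolev r) :=
  inferInstanceAs (AddCommGroup ↥(sineSobolevSubmodule r))

instance (r : ℝ) : Module ℂ (SineSobolev r) :=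
  inferInstanceAs (Module ℂ ↥(sineSobolevSubmodule r))

/-- The sequence of sine coefficients of an element of `ℋ^r`. -/
def SineSobolev.coeff {r : ℝ} (a : SineSobolev r) : ℕ+ → ℂ := Subtype.val a

/-- The linear map `a ↦ (⟨m⟩^r a_m)_m` from `ℋ^r` to `ℓ²`. -/
def SineSobolev.toL2 (r : ℝ) : SineSobolev r →ₗ[ℂ] lp (fun _ : ℕ+ => ℂ) 2 where
  toFun a := ⟨fun m => ((jb m ^ r : ℝ) : ℂ) * a.coeff m, a.property⟩
  map_add' a b := by
    apply lp.ext; funext m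
    exact mul_add ((jb m ^ r : ℝ) : ℂ) (a.coeff m) (b.coeff m)
  map_smul' c a := by
    apply lp.ext; funext m
    exact mul_left_comm ((jb m ^ r : ℝ) : ℂ) c (a.coeff m)

theorem jb_pos (m : ℕ+) : 0 < jb m := by
  unfold jb; positivity

theorem SineSobolev.toL2_injective (r : ℝ) : Function.Injective (SineSobolev.toL2 r) := by
  intro a b h
  apply Subtype.ext
  funext m
  have h1 : ((jb m ^ r : ℝ) : ℂ) * a.coeff m = ((jb m ^ r : ℝ) : ℂ) * b.coeff m :=
    congrFun (congrArg Subtype.val h) m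
  have h2 : ((jb m ^ r : ℝ) : ℂ) ≠ 0 := by
    exact_mod_cast (Real.rpow_pos_of_pos (jb_pos m) r).ne'
  exact mul_left_cancel₀ h2 h1

/-- The norm of `ℋ^r`, that is `‖a‖² = ∑ ⟨m⟩^(2r) |a_m|²`. -/
instance (r : ℝ) : NormedAddCommGroup (SineSobolev r) :=
  NormedAddCommGroup.induced _ _ (SineSobolev.toL2 r) (SineSobolev.toL2_injective r)

instance (r : ℝ) : NormedSpace ℂ (SineSobolev r) :=
  NormedSpace.induced ℂ _ _ (SineSobolev.toL2 r)

theorem SineSobolev.norm_sq_eq {r : ℝ} (a : SineSobolev r) :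
    ‖a‖ ^ 2 = ∑' m : ℕ+, jb m ^ (2 * r) * ‖a.coeff m‖ ^ 2 := by
  have h := lp.norm_rpow_eq_tsum (p := 2) (by norm_num) (SineSobolev.toL2 r a)
  have e : ‖a‖ = ‖SineSobolev.toL2 r a‖ := rfl
  simp only [ENNReal.toReal_ofNat, Real.rpow_two] at h
  rw [e, h]
  refine tsum_congr fun m => ?_
  have h3 : (SineSobolev.toL2 r a : ℕ+ → ℂ) m = ((jb m ^ r : ℝ) : ℂ) * a.coeff m := rfl
  rw [h3, norm_mul, mul_pow, Complex.norm_real, Real.norm_eq_abs, sq_abs, mul_comm 2 r,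
    Real.rpow_mul (jb_pos m).le, Real.rpow_two]

/-- The phase space `ℋ^r × ℋ^r`, with the Hilbert product norm. -/
abbrev Phase (r : ℝ) : Type := WithLp 2 (SineSobolev r × SineSobolev r)

/-! ### The operators, acting on sequences of sine coefficients -/

/-- The eigenvalues `λ_m = √(m² + mass²)` of `B = √(-Δ + mass²)`. -/
def eigB (mass : ℝ) (m : ℕ+) : ℝ := Real.sqrt ((m : ℝ) ^ 2 + mass ^ 2)

/-- The power `B ^ s`, which multiplies the `m`-th sine coefficient by `λ_m ^ s`. -/
def powB (mass s : ℝ) (a : ℕ+ → ℂ) : ℕ+ → ℂ :=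
  fun m => ((eigB mass m ^ s : ℝ) : ℂ) * a m

/-- The `m`-th sine coefficient of a function on `[0, π]`. -/
def sineCoeff (f : ℝ → ℂ) (m : ℕ+) : ℂ :=
  (2 / (Real.pi : ℂ)) * ∫ x in (0 : ℝ)..Real.pi, f x * (Real.sin ((m : ℝ) * x) : ℂ)

/-- Multiplication by the function `q` on `[0, π]`, in the sine basis: the function
`∑ a_n sin (n x)` is sent to `∑ a_n q(x) sin (n x)`. -/
def mulOp (q : ℝ → ℝ) (a : ℕ+ → ℂ) : ℕ+ → ℂ :=
  fun m => ∑' n : ℕ+, sineCoeff (fun x => ((q x * Real.sin ((n : ℝ) * x) : ℝ) : ℂ)) m * a n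

/-- The operator `(1/2) B^(-1/2) q B^(-1/2)`. -/
def driving (mass : ℝ) (q : ℝ → ℝ) (a : ℕ+ → ℂ) : ℕ+ → ℂ :=
  (1 / 2 : ℂ) • powB mass (-(1 / 2)) (mulOp q (powB mass (-(1 / 2)) a))

/-- The Hamiltonian `diag(B, -B) + (1/2) B^(-1/2) q B^(-1/2) (1, 1; -1, -1)` applied to a pair. -/
def hamiltonian (mass : ℝ) (q : ℝ → ℝ) (a b : ℕ+ → ℂ) : (ℕ+ → ℂ) × (ℕ+ → ℂ) :=
  (powB mass 1 a + driving mass q (a + b), -powB mass 1 b - driving mass q (a + b))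

/-- `U` is the propagator on `ℋ^r × ℋ^r` of `i ∂_t φ = H(t) φ`, where the potential at time `t` is
`V (ω t, ·)`: a family of bounded operators with `U(τ, τ) = 1` such that `t ↦ U(t, τ) φ` is
continuous in `ℋ^r × ℋ^r` and solves the equation (tested against every `sin (m x)`, in both
components). -/
def IsPropagator {ν : ℕ} (V : EuclideanSpace ℝ (Fin ν) → ℝ → ℝ) (mass : ℝ)
    (ω : EuclideanSpace ℝ (Fin ν)) (r : ℝ) (U : ℝ → ℝ → (Phase r →L[ℂ] Phase r)) : Prop :=
  (∀ τ : ℝ, U τ τ = ContinuousLinearMap.id ℂ (Phase r)) ∧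
  ∀ (τ : ℝ) (φ : Phase r),
    Continuous (fun t : ℝ => U t τ φ) ∧
    ∀ (t : ℝ) (m : ℕ+),
      HasDerivAt (fun s : ℝ => (U s τ φ).fst.coeff m)
        (-Complex.I *
          (hamiltonian mass (V (t • ω)) (U t τ φ).fst.coeff (U t τ φ).snd.coeff).1 m) t ∧
      HasDerivAt (fun s : ℝ => (U s τ φ).snd.coeff m)
        (-Complex.I *
          (hamiltonian mass (V (t • ω)) (U t τ φ).fst.coeff (U t τ φ).snd.coeff).2 m) t

/-! ### The potential

A potential on `𝕋^ν × [0, π]` is a function `V θ x` that is `2π`-periodic in every coordinate of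
`θ`; only its values at `x ∈ [0, π]` matter. -/

/-- The even `2π`-periodic extension in `x` of a function on `[0, π]`: `arccos (cos x)` is the point
of `[0, π]` that `x` is sent to by evenness and `2π`-periodicity. -/
def evenExt {ν : ℕ} (V : EuclideanSpace ℝ (Fin ν) → ℝ → ℝ) (θ : EuclideanSpace ℝ (Fin ν))
    (x : ℝ) : ℝ :=
  V θ (Real.arccos (Real.cos x))

/-- The closed complex neighbourhood `|Im θ| ≤ ρ` of the torus (Euclidean norm). -/
def strip (ν : ℕ) (ρ : ℝ) : Set (EuclideanSpace ℂ (Fin ν)) :=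
  {θ | Real.sqrt (∑ i, (θ i).im ^ 2) ≤ ρ}

/-- Condition (V1) with width `ρ`: `V` is a function on `𝕋^ν × [0, π]` whose even extension in `x`
is smooth and extends analytically in `θ` to `|Im θ| ≤ ρ`, with all `x`-derivatives bounded there. -/
def CondV1 {ν : ℕ} (ρ : ℝ) (V : EuclideanSpace ℝ (Fin ν) → ℝ → ℝ) : Prop :=
  (∀ (i : Fin ν) (θ : EuclideanSpace ℝ (Fin ν)), ∀ x ∈ Set.Icc (0 : ℝ) Real.pi,
    V (θ + EuclideanSpace.single i (2 * Real.pi)) x = V θ x) ∧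
  ContDiff ℝ ((⊤ : ℕ∞) : WithTop ℕ∞) (fun p : EuclideanSpace ℝ (Fin ν) × ℝ => evenExt V p.1 p.2) ∧
  ∃ W : EuclideanSpace ℂ (Fin ν) → ℝ → ℂ,
    (∀ (θ : EuclideanSpace ℝ (Fin ν)) (x : ℝ),
      W (WithLp.toLp 2 fun i => (θ i : ℂ)) x = (evenExt V θ x : ℂ)) ∧
    (∀ x : ℝ, AnalyticOnNhd ℂ (fun θ => W θ x) (strip ν ρ)) ∧
    (∀ θ ∈ strip ν ρ, ContDiff ℝ ((⊤ : ℕ∞) : WithTop ℕ∞) (W θ)) ∧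
    ∀ ℓ : ℕ, ∃ C > 0, ∀ θ ∈ strip ν ρ, ∀ x : ℝ, ‖iteratedDeriv ℓ (W θ) x‖ ≤ C

/-- Condition (V2): `∫_{𝕋^ν} V(θ, x) dθ = 0` for every `x ∈ [0, π]`. -/
def CondV2 {ν : ℕ} (V : EuclideanSpace ℝ (Fin ν) → ℝ → ℝ) : Prop :=
  ∀ x ∈ Set.Icc (0 : ℝ) Real.pi,
    ∫ θ in {θ : EuclideanSpace ℝ (Fin ν) | ∀ i, θ i ∈ Set.Ico (0 : ℝ) (2 * Real.pi)}, V θ x = 0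

/-- The annulus `M ≤ |ω| ≤ 2M` in `ℝ^ν`. -/
def annulus (ν : ℕ) (M : ℝ) : Set (EuclideanSpace ℝ (Fin ν)) :=
  Metric.closedBall 0 (2 * M) \ Metric.ball 0 M

end KleinGordon

end

/-! Expanded in Fourier series in time, the system becomes a stationary operator diag(L) + P₀ on
ℓ¹(`Idx ν`). Here L = ω·k ± λ_m (`freq`), and P₀ is Toeplitz in k, with the Fourier coefficients of
the driving as blocks (`exists_floquet_operator`). Suppose a Toeplitz matrix 1 + Y satisfies (diag L
+ P₀)(1 + Y) = (1 + Y) diag(L + z) with z real and independent of k. Taking symbols at θ = ωt then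
gives the propagator U(t, τ) = (1 + Y(ωt)) e^{-i(t-τ)E} (1 + Y(ωτ))⁻¹ with E = ±λ_m + z. The middle
factor is diagonal and unitary on every ℋ^r, so the norm can change only through Y. The construction
gives Y = O(M^{-1/2}), which implies the stated M^{-(1-α)/2}.

The transformation is an infinite product of factors 1 + X_n, where X_n solves a homological
equation and leaves a quadratically small remainder (`Conj.step`). Fast driving matters only in the
first step. By (V2) the matrix P₀ couples only different Fourier indices, and for nonresonant ω the
number |ω·(k - l)| is of order M up to a power of |k - l|. Either the divisor is comparable to it,
or a difference of ±λ's compensates it. In the second case the modes are so high that the factors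
B^{-1/2} gain M^{-1/2} (`divMult_first_le`). After this step the perturbation has size M^{-1/2} and
a usual KAM scheme converges (`kam_estimates`, `reducibility`). Its small divisors cost width of
analyticity in time but no decay in space, since the divisor bounds are uniform in the modes.

Decay in |m - n| is measured by one submultiplicative weight w that grows faster than all powers and
is still summable against the coefficients of V (`exists_weight`). A single iteration therefore
serves all ℋ^r at once, and the set of frequencies does not depend on r. A further factor √m in the
weight, paid for by B^{-1/2}, yields z = O(m^{-1/2}).

For the measure estimate, fix k ≠ 0. Two high modes have frequencies close to integers, so their
divisor is close to some ω·k + l, and one integer nonresonance condition handles all such pairs.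
About M (1 + |k|)^{4τ₁} pairs remain. Each of them is resonant in a thin slab, whose volume is
estimated using only the Lipschitz dependence of z on ω (`volume_slab_le`,
`exists_volume_resonant_le`). Every quantity in the iteration is therefore tracked together with its
Lipschitz constant.

Two facts complete the argument. The exponents are real because JP₀ is self-adjoint for the
signature J = diag(1, -1), and each Floquet vector, being close to a unit vector, has nonzero J-norm
(`im_eq_zero_of_conj`). The propagator is unique because P₀ acts boundedly in the sup norm of the
coordinates and the diagonal part can be removed by phases (`eq_zero_of_isFlow`). -/

open scoped ENNReal NNReal
noncomputable section
namespace KleinGordon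

/-! ### Schur norms of nonnegative matrices -/

section Schur

variable {I : Type*}

/-- The larger of the suprema of the column sums and of the row sums. -/
def schur (F : I → I → ℝ≥0∞) : ℝ≥0∞ := max (⨆ y, ∑' x, F x y) (⨆ x, ∑' y, F x y)

theorem schur_le_iff {F : I → I → ℝ≥0∞} {C : ℝ≥0∞} :
    schur F ≤ C ↔ (∀ y, ∑' x, F x y ≤ C) ∧ ∀ x, ∑' y, F x y ≤ C := by
  simp [schur]

theorem col_le_schur (F : I → I → ℝ≥0∞) (y : I) : ∑' x, F x y ≤ schur F :=
  (schur_le_iff.1 le_rfl).1 y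

theorem row_le_schur (F : I → I → ℝ≥0∞) (x : I) : ∑' y, F x y ≤ schur F :=
  (schur_le_iff.1 le_rfl).2 x

theorem entry_le_schur (F : I → I → ℝ≥0∞) (x y : I) : F x y ≤ schur F :=
  (ENNReal.le_tsum x).trans (col_le_schur F y)

theorem schur_mono {F G : I → I → ℝ≥0∞} (h : ∀ x y, F x y ≤ G x y) : schur F ≤ schur G :=
  schur_le_iff.2 ⟨fun y => (ENNReal.tsum_le_tsum fun x => h x y).trans (col_le_schur G y),
    fun x => (ENNReal.tsum_le_tsum fun y => h x y).trans (row_le_schur G x)⟩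

theorem schur_add_le (F G : I → I → ℝ≥0∞) :
    schur (fun x y => F x y + G x y) ≤ schur F + schur G := by
  refine schur_le_iff.2 ⟨fun y => ?_, fun x => ?_⟩ <;> rw [ENNReal.tsum_add]
  · exact add_le_add (col_le_schur F y) (col_le_schur G y)
  · exact add_le_add (row_le_schur F x) (row_le_schur G x)

theorem schur_const_mul_le (c : ℝ≥0∞) (F : I → I → ℝ≥0∞) :
    schur (fun x y => c * F x y) ≤ c * schur F := by
  refine schur_le_iff.2 ⟨fun y => ?_, fun x => ?_⟩ <;> rw [ENNReal.tsum_mul_left]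
  · gcongr; exact col_le_schur F y
  · gcongr; exact row_le_schur F x

theorem schur_conv_le (F G : I → I → ℝ≥0∞) :
    schur (fun x y => ∑' z, F x z * G z y) ≤ schur F * schur G := by
  refine schur_le_iff.2 ⟨fun y => ?_, fun x => ?_⟩
  · rw [ENNReal.tsum_comm]
    calc ∑' z, ∑' x, F x z * G z y = ∑' z, (∑' x, F x z) * G z y := by
          simp only [ENNReal.tsum_mul_right]
      _ ≤ ∑' z, schur F * G z y := by gcongr; exact col_le_schur F _
      _ = schur F * ∑' z, G z y := ENNReal.tsum_mul_left
      _ ≤ _ := by gcongr; exact col_le_schur G y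
  · rw [ENNReal.tsum_comm]
    calc ∑' z, ∑' y, F x z * G z y = ∑' z, F x z * (∑' y, G z y) := by
          simp only [ENNReal.tsum_mul_left]
      _ ≤ ∑' z, F x z * schur G := by gcongr; exact row_le_schur G _
      _ = (∑' z, F x z) * schur G := ENNReal.tsum_mul_right
      _ ≤ _ := by gcongr; exact row_le_schur F x

theorem schur_tsum_le {ι : Type*} (F : ι → I → I → ℝ≥0∞) :
    schur (fun x y => ∑' n, F n x y) ≤ ∑' n, schur (F n) := by
  refine schur_le_iff.2 ⟨fun y => ?_, fun x => ?_⟩ <;> rw [ENNReal.tsum_comm]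
  · exact ENNReal.tsum_le_tsum fun n => col_le_schur (F n) y
  · exact ENNReal.tsum_le_tsum fun n => row_le_schur (F n) x

end Schur

/-! ### Operators on `ℓ¹` and their matrices -/

section Operators

variable {I : Type*}

/-- The Banach algebra of bounded operators on `ℓ¹(I)`. -/
abbrev Op (I : Type*) := lp (fun _ : I => ℂ) 1 →L[ℂ] lp (fun _ : I => ℂ) 1

theorem l1_enorm_eq (f : lp (fun _ : I => ℂ) 1) : ‖f‖ₑ = ∑' x, ‖f x‖ₑ := by
  have h := lp.hasSum_norm (p := 1) (by norm_num) f
  simp only [ENNReal.toReal_one, Real.rpow_one] at h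
  rw [← ofReal_norm, ← h.tsum_eq, ENNReal.ofReal_tsum_of_nonneg (fun _ => norm_nonneg _)
    h.summable]
  simp only [ofReal_norm]

/-- The sequences with `∑ |f x| < ∞` as elements of `ℓ¹`. -/
def mkL1 (f : I → ℂ) (h : ∑' x, ‖f x‖ₑ ≠ ∞) : lp (fun _ : I => ℂ) 1 :=
  ⟨f, memℓp_gen (by
    simp only [ENNReal.toReal_one, Real.rpow_one]
    exact (ENNReal.summable_toReal h).congr fun x => toReal_enorm _)⟩

/-- Evaluation of an element of `ℓ¹` at a point. -/
def evalL1 (x : I) : lp (fun _ : I => ℂ) 1 →L[ℂ] ℂ :=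
  LinearMap.mkContinuous { toFun := fun f => f x, map_add' := fun _ _ => rfl,
                           map_smul' := fun _ _ => rfl } 1 fun f => by
    rw [one_mul]; exact lp.norm_apply_le_norm one_ne_zero f x

variable [DecidableEq I]

/-- The matrix entries of an operator on `ℓ¹`. -/
def entry (a : Op I) (x y : I) : ℂ := (a (lp.single 1 y (1 : ℂ))) x

theorem entry_add (a b : Op I) (x y : I) : entry (a + b) x y = entry a x y + entry b x y := rfl

theorem entry_sub (a b : Op I) (x y : I) : entry (a - b) x y = entry a x y - entry b x y := rfl

theorem entry_neg (a : Op I) (x y : I) : entry (-a) x y = -entry a x y := rfl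

theorem entry_zero (x y : I) : entry (0 : Op I) x y = 0 := rfl

theorem entry_one (x y : I) : entry (1 : Op I) x y = if x = y then 1 else 0 := by
  simp [entry, Pi.single_apply]

/-- The linear functional `a ↦ entry a x y` is continuous. -/
def entryCLM (x y : I) : Op I →L[ℂ] ℂ :=
  (evalL1 x).comp (ContinuousLinearMap.apply ℂ _ (lp.single 1 y (1 : ℂ)))

theorem entryCLM_apply (a : Op I) (x y : I) : entryCLM x y a = entry a x y := rfl

theorem hasSum_apply (a : Op I) (f : lp (fun _ : I => ℂ) 1) :
    HasSum (fun y => f y • a (lp.single 1 y (1 : ℂ))) (a f) := by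
  have h := (lp.hasSum_single (p := 1) (by norm_num) f).mapL a
  refine h.congr_fun fun y => ?_
  rw [← map_smul, ← lp.single_smul, smul_eq_mul, mul_one]

theorem hasSum_entry_mul (a b : Op I) (x y : I) :
    HasSum (fun z => entry a x z * entry b z y) (entry (a * b) x y) := by
  have h := (hasSum_apply a (b (lp.single 1 y (1 : ℂ)))).mapL (evalL1 x)
  refine h.congr_fun fun z => ?_
  rw [map_smul, smul_eq_mul, mul_comm]; rfl

theorem op_ext {a b : Op I} (h : ∀ x y, entry a x y = entry b x y) : a = b := by
  ext1 f
  refine (hasSum_apply a f).unique ?_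
  have : ∀ y, a (lp.single 1 y (1 : ℂ)) = b (lp.single 1 y (1 : ℂ)) := fun y =>
    lp.ext (funext fun x => h x y)
  simpa only [this] using hasSum_apply b f

theorem tsum_entry_le (a : Op I) (y : I) : ∑' x, ‖entry a x y‖ₑ ≤ ‖a‖ₑ := by
  have h := a.le_opENorm (lp.single 1 y (1 : ℂ))
  rw [l1_enorm_eq (a _)] at h
  refine h.trans ?_
  have : ‖(lp.single 1 y (1 : ℂ) : lp (fun _ : I => ℂ) 1)‖ₑ = 1 := by
    rw [← ofReal_norm, lp.norm_single (by norm_num)]; simp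
  rw [this, mul_one]

/-- The norm of ℓ¹ is additive over coordinates, so bounded columns suffice. The row sums in `schur`
are needed only later, for ℓ² and for the sup norm. -/
theorem opNorm_le_of_col (a : Op I) {C : ℝ≥0} (h : ∀ y, ∑' x, ‖entry a x y‖ₑ ≤ C) : ‖a‖ ≤ C := by
  refine a.opNorm_le_bound C.2 fun f => ?_
  have h1 : ∀ y, ‖a (lp.single 1 y (1 : ℂ))‖ ≤ C := fun y => by
    have := h y
    rw [show (∑' x, ‖entry a x y‖ₑ) = ‖a (lp.single 1 y (1 : ℂ))‖ₑ from (l1_enorm_eq _).symm] at this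
    exact_mod_cast this
  have h2 := lp.hasSum_norm (p := 1) (by norm_num) f
  simp only [ENNReal.toReal_one, Real.rpow_one] at h2
  rw [← (hasSum_apply a f).tsum_eq]
  refine tsum_of_norm_bounded (h2.mul_left (C : ℝ)) fun y => ?_
  rw [norm_smul, mul_comm]
  gcongr
  exact h1 y

/-- The operator with columns `c y`. -/
def ofCol (c : I → lp (fun _ : I => ℂ) 1) (C : ℝ≥0) (h : ∀ y, ‖c y‖ ≤ C) : Op I :=
  have hs : ∀ f : lp (fun _ : I => ℂ) 1, HasSum (fun y => ‖f y‖) ‖f‖ := fun f => by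
    simpa only [ENNReal.toReal_one, Real.rpow_one] using lp.hasSum_norm (p := 1) (by norm_num) f
  have hb : ∀ (f : lp (fun _ : I => ℂ) 1) (y : I), ‖f y • c y‖ ≤ C * ‖f y‖ := fun f y => by
    rw [norm_smul, mul_comm]; gcongr; exact h y
  have hsum : ∀ f : lp (fun _ : I => ℂ) 1, Summable fun y => f y • c y := fun f =>
    Summable.of_norm_bounded ((hs f).summable.mul_left (C : ℝ)) (hb f)
  LinearMap.mkContinuous
    { toFun := fun f => ∑' y, f y • c y
      map_add' := fun f g => by
        rw [← (hsum f).tsum_add (hsum g)]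
        exact tsum_congr fun y => add_smul (f y) (g y) (c y)
      map_smul' := fun k f => by
        rw [RingHom.id_apply, ← (hsum f).tsum_const_smul]
        exact tsum_congr fun y => mul_smul k (f y) (c y) } C
    fun f => tsum_of_norm_bounded ((hs f).mul_left (C : ℝ)) (hb f)

theorem ofCol_single (c : I → lp (fun _ : I => ℂ) 1) (C : ℝ≥0) (h : ∀ y, ‖c y‖ ≤ C) (y : I) :
    ofCol c C h (lp.single 1 y (1 : ℂ)) = c y := by
  change ∑' z, (lp.single 1 y (1 : ℂ) : lp (fun _ : I => ℂ) 1) z • c z = c y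
  rw [tsum_eq_single y]
  · simp
  · intro z hz
    rw [lp.single_apply_ne _ _ _ hz, zero_smul]

open Classical in
/-- The operator with a given matrix, if its column sums are bounded, and `0` otherwise. -/
def ofMat (f : I → I → ℂ) : Op I :=
  if h : ∃ C : ℝ≥0, ∀ y, ∑' x, ‖f x y‖ₑ ≤ C then
    ofCol (fun y => mkL1 (fun x => f x y) (ne_top_of_le_ne_top ENNReal.coe_ne_top (h.choose_spec y)))
      h.choose fun y => by
        have := h.choose_spec y
        have h2 := l1_enorm_eq (mkL1 (fun x => f x y)
          (ne_top_of_le_ne_top ENNReal.coe_ne_top this))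
        exact NNReal.coe_le_coe.2 (enorm_le_coe.1 (h2.trans_le this))
  else 0

theorem entry_ofMat {f : I → I → ℂ} (h : ∃ C : ℝ≥0, ∀ y, ∑' x, ‖f x y‖ₑ ≤ C) (x y : I) :
    entry (ofMat f) x y = f x y := by
  rw [ofMat, dif_pos h]
  exact congrArg (evalL1 x) (ofCol_single _ _ _ y)

theorem entry_ofMat_of_schur {f : I → I → ℂ} (h : schur (fun x y => ‖f x y‖ₑ) ≠ ∞) (x y : I) :
    entry (ofMat f) x y = f x y :=
  entry_ofMat ⟨(schur fun x y => ‖f x y‖ₑ).toNNReal, fun y => by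
    rw [ENNReal.coe_toNNReal h]; exact col_le_schur (fun x y => ‖f x y‖ₑ) y⟩ x y

/-! ### Weighted norms -/

/-- The weighted Schur norm of the matrix of an operator. -/
def wnorm (W : I → I → ℝ≥0∞) (a : Op I) : ℝ≥0∞ := schur fun x y => W x y * ‖entry a x y‖ₑ

/-- A weight is admissible if it is at least `1` and submultiplicative. -/
structure IsWeight (W : I → I → ℝ≥0∞) : Prop where
  one_le : ∀ x y, 1 ≤ W x y
  le_mul : ∀ x z y, W x y ≤ W x z * W z y

variable {W : I → I → ℝ≥0∞}

theorem wnorm_add_le (a b : Op I) : wnorm W (a + b) ≤ wnorm W a + wnorm W b := by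
  refine (schur_mono fun x y => ?_).trans (schur_add_le _ _)
  rw [entry_add, ← mul_add]
  gcongr
  exact enorm_add_le _ _

theorem wnorm_neg (a : Op I) : wnorm W (-a) = wnorm W a := by
  simp [wnorm, entry_neg]

theorem wnorm_zero : wnorm W (0 : Op I) = 0 := by
  simp [wnorm, entry_zero, schur]

theorem wnorm_sub_le (a b : Op I) : wnorm W (a - b) ≤ wnorm W a + wnorm W b := by
  rw [sub_eq_add_neg, ← wnorm_neg b]; exact wnorm_add_le a (-b)

/-- Submultiplicativity distributes the weight over each path x → z → y in the product, so the
weighted norm inherits the algebra property of the unweighted one. -/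
theorem wnorm_mul_le (hW : IsWeight W) (a b : Op I) : wnorm W (a * b) ≤ wnorm W a * wnorm W b := by
  refine (schur_mono fun x y => ?_).trans (schur_conv_le _ _)
  rw [← (hasSum_entry_mul a b x y).tsum_eq]
  calc W x y * ‖∑' z, entry a x z * entry b z y‖ₑ
      ≤ W x y * ∑' z, ‖entry a x z * entry b z y‖ₑ := by gcongr; exact enorm_tsum_le_tsum_enorm
    _ = ∑' z, W x y * ‖entry a x z * entry b z y‖ₑ := ENNReal.tsum_mul_left.symm
    _ ≤ ∑' z, W x z * ‖entry a x z‖ₑ * (W z y * ‖entry b z y‖ₑ) := by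
        refine ENNReal.tsum_le_tsum fun z => ?_
        rw [enorm_mul, mul_mul_mul_comm]
        gcongr
        exact hW.le_mul x z y

theorem wnorm_tsum_le {ι : Type*} {a : ι → Op I} (ha : Summable a) :
    wnorm W (∑' n, a n) ≤ ∑' n, wnorm W (a n) := by
  refine (schur_mono fun x y => ?_).trans (schur_tsum_le _)
  rw [← entryCLM_apply, (entryCLM x y).map_tsum ha, ENNReal.tsum_mul_left]
  gcongr
  exact enorm_tsum_le_tsum_enorm

theorem enorm_le_wnorm (hW : ∀ x y, 1 ≤ W x y) (a : Op I) : ‖a‖ₑ ≤ wnorm W a := by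
  by_cases h : wnorm W a = ∞
  · rw [h]; exact le_top
  have h1 : ‖a‖ ≤ (wnorm W a).toNNReal := opNorm_le_of_col a fun y => by
    rw [ENNReal.coe_toNNReal h]
    refine le_trans ?_ (col_le_schur _ y)
    exact ENNReal.tsum_le_tsum fun x => le_mul_of_one_le_left' (hW x y)
  rw [← ENNReal.coe_toNNReal h]
  exact enorm_le_coe.2 (NNReal.coe_le_coe.1 h1)

theorem wnorm_mono {W' : I → I → ℝ≥0∞} (h : ∀ x y, W x y ≤ W' x y) (a : Op I) :
    wnorm W a ≤ wnorm W' a :=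
  schur_mono fun x y => by gcongr; exact h x y

/-- If `N(X) ≤ 1/2`, then `1 + X` is invertible. -/
theorem isUnit_one_add (hW : IsWeight W) {X : Op I} (hX : wnorm W X ≤ 1 / 2) : IsUnit (1 + X) := by
  have h : ‖X‖ < 1 := by
    have h1 : ‖X‖ₑ ≤ ((1 / 2 : ℝ≥0) : ℝ≥0∞) := by
      refine (enorm_le_wnorm hW.one_le X).trans (hX.trans_eq ?_)
      simp
    rw [enorm_le_coe] at h1
    linarith
  have := (Units.oneSub (-X) (by rwa [norm_neg])).isUnit
  simpa using this

theorem inverse_mul_eq_tsum (hW : IsWeight W) {X : Op I} (hX : wnorm W X ≤ 1 / 2) (Q : Op I) :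
    (Summable fun n : ℕ => (-X) ^ n * Q) ∧
      Ring.inverse (1 + X) * Q = ∑' n : ℕ, (-X) ^ n * Q := by
  have h : ‖-X‖ < 1 := by
    have h1 : ‖X‖ₑ ≤ ((1 / 2 : ℝ≥0) : ℝ≥0∞) := by
      refine (enorm_le_wnorm hW.one_le X).trans (hX.trans_eq ?_)
      simp
    rw [enorm_le_coe] at h1
    rw [norm_neg]; linarith
  have hs : Summable fun n : ℕ => (-X) ^ n := summable_geometric_of_norm_lt_one h
  refine ⟨hs.mul_right Q, ?_⟩
  rw [hs.tsum_mul_right, ← sub_neg_eq_add, NormedRing.inverse_one_sub _ h]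
  rfl

/-- The weights `wt` are unbounded on the diagonal, so the identity has infinite norm and so may the
inverse of 1 + X. Only products with a factor Q of finite norm are estimated: the n-th Neumann term
is at most 2^{-n} times the norm of Q. -/
theorem inverse_mul_bound (hW : IsWeight W) {X : Op I} (hX : wnorm W X ≤ 1 / 2) (Q : Op I) :
    wnorm W (Ring.inverse (1 + X) * Q) ≤ 2 * wnorm W Q := by
  obtain ⟨hs, e⟩ := inverse_mul_eq_tsum hW hX Q
  rw [e]
  refine (wnorm_tsum_le hs).trans ?_
  have hp : ∀ n : ℕ, wnorm W ((-X) ^ n * Q) ≤ (1 / 2) ^ n * wnorm W Q := by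
    intro n
    induction n with
    | zero => simp
    | succ n ih =>
      rw [pow_succ', mul_assoc, pow_succ', mul_assoc]
      refine (wnorm_mul_le hW _ _).trans ?_
      rw [wnorm_neg]
      gcongr
  refine (ENNReal.tsum_le_tsum hp).trans ?_
  rw [ENNReal.tsum_mul_right, ENNReal.tsum_geometric]
  simp

end Operators


/-! ### Conjugation to diagonal form: algebra -/

section Conjugation

variable {I : Type*} [DecidableEq I]

/-- The diagonal part of an operator. -/
def dg (P : Op I) : Op I := ofMat fun x y => if x = y then entry P x x else 0

theorem entry_dg (P : Op I) (x y : I) : entry (dg P) x y = if x = y then entry P x x else 0 := by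
  refine entry_ofMat ⟨‖P‖₊, fun y => ?_⟩ x y
  refine le_trans (ENNReal.tsum_le_tsum fun x => ?_) (tsum_entry_le P y)
  split_ifs with h
  · rw [h]
  · simp

theorem entry_mul_dg (T P : Op I) (x y : I) : entry (T * dg P) x y = entry T x y * entry P y y := by
  refine (hasSum_entry_mul T (dg P) x y).unique ?_
  have h : ∀ z, entry T x z * entry (dg P) z y = if z = y then entry T x y * entry P y y else 0 := by
    intro z
    rw [entry_dg]
    split_ifs with h
    · rw [h]
    · simp
  simp only [h]
  exact hasSum_ite_eq y _

/-- The solution of the homological equation. -/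
def homSol (L : I → ℝ) (z : I → ℂ) (P : Op I) : Op I :=
  ofMat fun x y => if x = y then 0 else -(L x + z x - (L y + z y))⁻¹ * entry P x y

/-- One step of the iteration: `(z, P)` stands for the operator `diag (L + z) + P`. -/
def kamStep (L : I → ℝ) (s : (I → ℂ) × Op I) : (I → ℂ) × Op I :=
  (fun x => s.1 x + entry s.2 x x,
    Ring.inverse (1 + homSol L s.1 s.2) * (s.2 * homSol L s.1 s.2 - homSol L s.1 s.2 * dg s.2))

/-- The iterates of `kamStep`. -/
def kamState (L : I → ℝ) (P₀ : Op I) : ℕ → (I → ℂ) × Op I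
  | 0 => (0, P₀)
  | n + 1 => kamStep L (kamState L P₀ n)

/-- The generator of the `n`-th step. -/
def kamGen (L : I → ℝ) (P₀ : Op I) (n : ℕ) : Op I :=
  homSol L (kamState L P₀ n).1 (kamState L P₀ n).2

/-- The product of the first `n` transformations. -/
def kamTrans (L : I → ℝ) (P₀ : Op I) : ℕ → Op I
  | 0 => 1
  | n + 1 => kamTrans L P₀ n * (1 + kamGen L P₀ n)

/-- `T` conjugates `diag L + P₀` to `diag (L + z) + P`. -/
def Conj (L : I → ℝ) (P₀ T : Op I) (z : I → ℂ) (P : Op I) : Prop :=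
  ∀ x y, ((L x : ℂ) - L y) * entry T x y + entry (P₀ * T) x y
    = entry T x y * z y + entry (T * P) x y

/-- With D = diag(L + z), expand (D + P)(1 + X) = (1 + X)(D + dg P + P') and insert [D, X] = -P + dg
P. What remains is (1 + X) P' = P X - X dg P, quadratic in P and X. The identity is written
entrywise because L is unbounded and diag L is not an element of the algebra. -/
theorem Conj.step {L : I → ℝ} {P₀ T P P' X : Op I} {z : I → ℂ} (h : Conj L P₀ T z P)
    (hX : ∀ x y, (L x + z x - (L y + z y)) * entry X x y
      = -entry P x y + entry (dg P) x y)
    (hP' : (1 + X) * P' = P * X - X * dg P) :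
    Conj L P₀ (T * (1 + X)) (fun x => z x + entry P x x) P' := by
  intro x y
  -- Along an intermediate index u the factor splits as (L_x - L_u) + (L_u - L_y). The first bracket
  -- is rewritten by `h`, the second by `hX`, and only sums already known to converge are formed.
  have key : ((L x : ℂ) - L y) * entry (T * X) x y
      = entry (T * P * X) x y - entry (P₀ * T * X) x y - entry (T * P) x y
        + entry (T * dg P) x y + z y * entry (T * X) x y := by
    refine ((hasSum_entry_mul T X x y).mul_left _).unique ?_
    have := ((((hasSum_entry_mul (T * P) X x y).sub (hasSum_entry_mul (P₀ * T) X x y)).sub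
      (hasSum_entry_mul T P x y)).add (hasSum_entry_mul T (dg P) x y)).add
      ((hasSum_entry_mul T X x y).mul_left (z y))
    refine this.congr_fun fun u => ?_
    have e1 := h x u
    have e2 := hX u y
    linear_combination (entry X u y) * e1 + (entry T x u) * e2
  have e1 := h x y
  have e3 : T * (1 + X) * P' = T * P * X - T * X * dg P := by
    rw [mul_assoc, hP', mul_sub, mul_assoc, mul_assoc]
  have e4 : P₀ * (T * (1 + X)) = P₀ * T + P₀ * T * X := by noncomm_ring
  have e5 := entry_mul_dg T P x y
  have e6 := entry_mul_dg (T * X) P x y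
  rw [e3, e4, mul_add, mul_one]
  simp only [entry_add, entry_sub]
  linear_combination e1 + key + e5 + e6

theorem Conj.zero (L : I → ℝ) (P₀ : Op I) : Conj L P₀ 1 0 P₀ := by
  intro x y
  by_cases h : x = y
  · subst h; simp
  · simp [entry_one, h]

/-- Invariance of a matrix under a permutation of the index set. -/
def Inv (σ : Equiv.Perm I) (a : Op I) : Prop := ∀ x y, entry a (σ x) (σ y) = entry a x y

variable {σ : Equiv.Perm I}

theorem Inv.one : Inv σ (1 : Op I) := fun x y => by simp [entry_one]

theorem Inv.add {a b : Op I} (ha : Inv σ a) (hb : Inv σ b) : Inv σ (a + b) := fun x y => by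
  rw [entry_add, entry_add, ha, hb]

theorem Inv.neg {a : Op I} (ha : Inv σ a) : Inv σ (-a) := fun x y => by
  rw [entry_neg, entry_neg, ha]

theorem Inv.sub {a b : Op I} (ha : Inv σ a) (hb : Inv σ b) : Inv σ (a - b) := fun x y => by
  rw [entry_sub, entry_sub, ha, hb]

theorem Inv.mul {a b : Op I} (ha : Inv σ a) (hb : Inv σ b) : Inv σ (a * b) := fun x y => by
  rw [← (hasSum_entry_mul a b (σ x) (σ y)).tsum_eq, ← (hasSum_entry_mul a b x y).tsum_eq,
    ← σ.tsum_eq]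
  exact tsum_congr fun z => by rw [ha, hb]

theorem Inv.dg {a : Op I} (ha : Inv σ a) : Inv σ (dg a) := fun x y => by
  simp [entry_dg, ha x x]

theorem Inv.pow {a : Op I} (ha : Inv σ a) (n : ℕ) : Inv σ (a ^ n) := by
  induction n with
  | zero => rw [pow_zero]; exact Inv.one
  | succ n ih => rw [pow_succ]; exact ih.mul ha

theorem Inv.tsum {ι : Type*} {a : ι → Op I} (hs : Summable a) (ha : ∀ n, Inv σ (a n)) :
    Inv σ (∑' n, a n) := fun x y => by
  rw [← entryCLM_apply, ← entryCLM_apply, ContinuousLinearMap.map_tsum _ hs,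
    ContinuousLinearMap.map_tsum _ hs]
  exact tsum_congr fun n => ha n x y

theorem Inv.inverse_mul {W : I → I → ℝ≥0∞} (hW : IsWeight W) {X Q : Op I} (hX : wnorm W X ≤ 1 / 2)
    (iX : Inv σ X) (iQ : Inv σ Q) : Inv σ (Ring.inverse (1 + X) * Q) := by
  obtain ⟨hs, e⟩ := inverse_mul_eq_tsum hW hX Q
  rw [e]
  exact Inv.tsum hs fun n => (iX.neg.pow n).mul iQ

/-- The divisors involve only differences of L, which σ preserves, so the generator, the corrections
and the remainder inherit the invariance. Applied to shifts of the Fourier index, this keeps every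
iterate Toeplitz and the corrections independent of k. The hypothesis `hE` is needed because
`homSol` is defined through `ofMat`, which has a default value. -/
theorem kamState_inv_step {W : I → I → ℝ≥0∞} (hW : IsWeight W) {L : I → ℝ} {P₀ : Op I}
    (hσ : ∀ x y, L (σ x) - L (σ y) = L x - L y) {n : ℕ}
    (hX : wnorm W (kamGen L P₀ n) ≤ 1 / 2)
    (hE : ∀ x y, entry (kamGen L P₀ n) x y = if x = y then 0 else
      -(L x + (kamState L P₀ n).1 x - (L y + (kamState L P₀ n).1 y))⁻¹
        * entry (kamState L P₀ n).2 x y)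
    (hz : ∀ x, (kamState L P₀ n).1 (σ x) = (kamState L P₀ n).1 x)
    (hP : Inv σ (kamState L P₀ n).2) :
    Inv σ (kamGen L P₀ n) ∧ (∀ x, (kamState L P₀ (n + 1)).1 (σ x) = (kamState L P₀ (n + 1)).1 x) ∧
      Inv σ (kamState L P₀ (n + 1)).2 := by
  have hg : Inv σ (kamGen L P₀ n) := by
    intro x y
    rw [hE, hE, hP, hz, hz]
    have e : ((L (σ x) : ℂ) - L (σ y)) = L x - L y := by exact_mod_cast hσ x y
    simp only [σ.injective.eq_iff]
    split_ifs with h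
    · rfl
    · congr 3; linear_combination e
  refine ⟨hg, fun x => ?_, Inv.inverse_mul hW hX hg ((hP.mul hg).sub (hg.mul hP.dg))⟩
  simp only [kamState, kamStep]
  rw [hz, hP]

/-- The limit of the transformations. -/
theorem exists_conj_of_summable {W : I → I → ℝ≥0∞} (hW : IsWeight W) {L : I → ℝ} {P₀ : Op I}
    {χ ε : ℕ → ℝ≥0∞} (hχ : ∑' n, χ n ≤ 1 / 4) (hε : ∑' n, ε n ≠ ∞)
    (hX : ∀ n, wnorm W (kamGen L P₀ n) ≤ χ n)
    (hP : ∀ n, wnorm W (kamState L P₀ n).2 ≤ ε n)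
    (hD : ∀ n x y, x ≠ y →
      (L x + (kamState L P₀ n).1 x - (L y + (kamState L P₀ n).1 y) : ℂ) ≠ 0)
    (hE : ∀ n x y, entry (kamGen L P₀ n) x y = if x = y then 0 else
      -(L x + (kamState L P₀ n).1 x - (L y + (kamState L P₀ n).1 y))⁻¹
        * entry (kamState L P₀ n).2 x y) :
    ∃ (Y : Op I) (z : I → ℂ), wnorm W Y ≤ 2 * ∑' n, χ n ∧ Conj L P₀ (1 + Y) z 0 ∧
      (∀ x, Filter.Tendsto (fun n => (kamState L P₀ n).1 x) Filter.atTop (nhds (z x))) ∧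
      ∀ σ : Equiv.Perm I, (∀ x y, L (σ x) - L (σ y) = L x - L y) → Inv σ P₀ →
        Inv σ Y ∧ ∀ x, z (σ x) = z x := by
  have hχ1 : ∀ n, χ n ≤ 1 / 2 := fun n => (ENNReal.le_tsum n).trans (hχ.trans (by
    gcongr; norm_num))
  have hunit : ∀ n, IsUnit (1 + kamGen L P₀ n) := fun n =>
    isUnit_one_add hW ((hX n).trans (hχ1 n))
  have hconj : ∀ n, Conj L P₀ (kamTrans L P₀ n) (kamState L P₀ n).1 (kamState L P₀ n).2 := by
    intro n
    induction n with
    | zero => exact Conj.zero L P₀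
    | succ n ih =>
      refine ih.step (fun x y => ?_) ?_
      · rw [hE, entry_dg]
        split_ifs with h
        · subst h; simp
        · have := hD n x y h
          field_simp
          simp
      · change _ * (Ring.inverse _ * _) = _
        rw [← mul_assoc]
        erw [Ring.mul_inverse_cancel _ (hunit n), one_mul]
        rfl
  -- With Y_n the n-th product minus 1, Y_{n+1} = Y_n + X_n + Y_n X_n. As long as the norm of Y_n is
  -- at most 1, which 2 ∑ χ ≤ 1/2 guarantees, each step adds at most 2 χ_n.
  have hY : ∀ n, wnorm W (kamTrans L P₀ n - 1) ≤ 2 * ∑ m ∈ Finset.range n, χ m := by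
    intro n
    induction n with
    | zero => simp [kamTrans, wnorm_zero]
    | succ n ih =>
      have e : kamTrans L P₀ (n + 1) - 1 = (kamTrans L P₀ n - 1) + kamGen L P₀ n
          + (kamTrans L P₀ n - 1) * kamGen L P₀ n := by
        rw [kamTrans]; noncomm_ring
      have h1 : wnorm W (kamTrans L P₀ n - 1) ≤ 1 := ih.trans (by
        calc 2 * ∑ m ∈ Finset.range n, χ m ≤ 2 * (1 / 4) := by
              gcongr; exact (ENNReal.sum_le_tsum _).trans hχ
          _ ≤ 2 * (1 / 2) := by gcongr; norm_num
          _ = 1 := by rw [one_div]; exact ENNReal.mul_inv_cancel (by norm_num) (by norm_num))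
      rw [e, Finset.sum_range_succ, mul_add]
      calc _ ≤ (2 * ∑ m ∈ Finset.range n, χ m) + χ n + 1 * χ n := by
            refine (wnorm_add_le _ _).trans (add_le_add ((wnorm_add_le _ _).trans
              (add_le_add ih (hX n))) ((wnorm_mul_le hW _ _).trans (mul_le_mul' h1 (hX n))))
        _ = _ := by ring
  have hT : ∀ n, wnorm W (kamTrans L P₀ n * kamGen L P₀ n) ≤ 2 * χ n := by
    intro n
    have e : kamTrans L P₀ n * kamGen L P₀ n
        = kamGen L P₀ n + (kamTrans L P₀ n - 1) * kamGen L P₀ n := by noncomm_ring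
    have h1 : wnorm W (kamTrans L P₀ n - 1) ≤ 1 := (hY n).trans (by
        calc 2 * ∑ m ∈ Finset.range n, χ m ≤ 2 * (1 / 4) := by
              gcongr; exact (ENNReal.sum_le_tsum _).trans hχ
          _ ≤ 2 * (1 / 2) := by gcongr; norm_num
          _ = 1 := by rw [one_div]; exact ENNReal.mul_inv_cancel (by norm_num) (by norm_num))
    rw [e, two_mul]
    refine (wnorm_add_le _ _).trans (add_le_add (hX n) ?_)
    calc _ ≤ 1 * χ n := (wnorm_mul_le hW _ _).trans (mul_le_mul' h1 (hX n))
      _ = _ := one_mul _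
  have hχtop : ∑' n, 2 * χ n ≠ ∞ := by
    rw [ENNReal.tsum_mul_left]
    exact ENNReal.mul_ne_top (by norm_num) (ne_top_of_le_ne_top (by norm_num) hχ)
  have hsum : Summable fun n => kamTrans L P₀ n * kamGen L P₀ n := by
    refine Summable.of_norm (Summable.of_nonneg_of_le (fun _ => norm_nonneg _) (fun n => ?_)
      (ENNReal.summable_toReal hχtop))
    rw [← toReal_enorm]
    exact ENNReal.toReal_mono (ENNReal.ne_top_of_tsum_ne_top hχtop n)
      ((enorm_le_wnorm hW.one_le _).trans (hT n))
  have hlim : Filter.Tendsto (kamTrans L P₀) Filter.atTop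
      (nhds (1 + ∑' n, kamTrans L P₀ n * kamGen L P₀ n)) := by
    have h1 := hsum.hasSum.tendsto_sum_nat.const_add 1
    refine h1.congr fun n => ?_
    have h2 : ∀ m, kamTrans L P₀ m * kamGen L P₀ m = kamTrans L P₀ (m + 1) - kamTrans L P₀ m :=
      fun m => by rw [kamTrans]; noncomm_ring
    simp only [h2, Finset.sum_range_sub]
    simp [kamTrans]
  have hPn : ∀ n, ‖(kamState L P₀ n).2‖ₑ ≤ ε n := fun n =>
    (enorm_le_wnorm hW.one_le _).trans (hP n)
  have hεs : Summable fun n => (ε n).toReal := ENNReal.summable_toReal hε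
  have hPn' : ∀ n, ‖(kamState L P₀ n).2‖ ≤ (ε n).toReal := fun n => by
    rw [← toReal_enorm]
    exact ENNReal.toReal_mono (ENNReal.ne_top_of_tsum_ne_top hε n) (hPn n)
  have hPlim : Filter.Tendsto (fun n => (kamState L P₀ n).2) Filter.atTop (nhds 0) :=
    squeeze_zero_norm hPn' hεs.tendsto_atTop_zero
  have hzs : ∀ x, Summable fun n => entry (kamState L P₀ n).2 x x := fun x => by
    refine Summable.of_norm_bounded hεs fun n => ?_
    rw [← toReal_enorm]
    refine ENNReal.toReal_mono (ENNReal.ne_top_of_tsum_ne_top hε n) ?_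
    exact ((ENNReal.le_tsum x).trans (tsum_entry_le _ x)).trans (hPn n)
  have hzlim : ∀ x, Filter.Tendsto (fun n => (kamState L P₀ n).1 x) Filter.atTop
      (nhds (∑' n, entry (kamState L P₀ n).2 x x)) := fun x => by
    refine (hzs x).hasSum.tendsto_sum_nat.congr fun n => ?_
    have h2 : ∀ m, entry (kamState L P₀ m).2 x x
        = (kamState L P₀ (m + 1)).1 x - (kamState L P₀ m).1 x := fun m => by
      simp [kamState, kamStep]
    simp only [h2, Finset.sum_range_sub (fun m => (kamState L P₀ m).1 x)]
    simp [kamState]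
  have hinv : ∀ σ : Equiv.Perm I, (∀ x y, L (σ x) - L (σ y) = L x - L y) → Inv σ P₀ →
      ∀ n, (∀ x, (kamState L P₀ n).1 (σ x) = (kamState L P₀ n).1 x) ∧
      Inv σ (kamState L P₀ n).2 ∧ Inv σ (kamGen L P₀ n) ∧ Inv σ (kamTrans L P₀ n) := by
    intro σ hσ hPσ
    have hstep := fun n => kamState_inv_step hW hσ ((hX n).trans (hχ1 n)) (hE n)
    intro n
    induction n with
    | zero => exact ⟨fun _ => rfl, hPσ, (hstep 0 (fun _ => rfl) hPσ).1, Inv.one⟩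
    | succ n ih =>
      obtain ⟨h1, h2, h3, h4⟩ := ih
      obtain ⟨-, h5, h6⟩ := hstep n h1 h2
      exact ⟨h5, h6, (hstep (n + 1) h5 h6).1, h4.mul (Inv.one.add h3)⟩
  refine ⟨∑' n, kamTrans L P₀ n * kamGen L P₀ n, fun x => ∑' n, entry (kamState L P₀ n).2 x x,
    ?_, ?_, hzlim, fun σ hσ hPσ => ⟨Inv.tsum hsum fun n =>
      (hinv σ hσ hPσ n).2.2.2.mul (hinv σ hσ hPσ n).2.2.1,
      fun x => tsum_congr fun n => (hinv σ hσ hPσ n).2.1 x x⟩⟩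
  · refine (wnorm_tsum_le hsum).trans ?_
    rw [← ENNReal.tsum_mul_left]
    exact ENNReal.tsum_le_tsum hT
  · intro x y
    have c : ∀ x y, Continuous fun a : Op I => entry a x y := fun x y => (entryCLM x y).continuous
    refine tendsto_nhds_unique
      (((((c x y).tendsto _).comp hlim).const_mul _).add
        (((c x y).tendsto _).comp (hlim.const_mul P₀))) ?_
    have h2 := (((((c x y).tendsto _).comp hlim).mul (hzlim y)).add
        (((c x y).tendsto _).comp (hlim.mul hPlim)))
    rw [mul_zero] at h2 ⊢
    exact h2.congr fun n => (hconj n x y).symm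

/-- If `J P₀` is self-adjoint for a signature `J`, the diagonal form has real entries. -/
theorem im_eq_zero_of_conj {L : I → ℝ} {P₀ Y : Op I} {z : I → ℂ} {J : I → ℝ}
    (hJ : ∀ x, |J x| = 1)
    (hPJ : ∀ x y, J x * entry P₀ x y = J y * (starRingEnd ℂ) (entry P₀ y x))
    (hP : Conj L P₀ (1 + Y) z 0) (hY : ‖Y‖ < 1 / 2) (y : I) : (z y).im = 0 := by
  set t : I → ℂ := fun x => entry (1 + Y) x y with ht
  have hnorm : ∀ a : Op I, (Summable fun x => ‖entry a x y‖) ∧ ∑' x, ‖entry a x y‖ ≤ ‖a‖ := by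
    intro a
    have h := tsum_entry_le a y
    have h1 : ∑' x, ‖entry a x y‖ₑ ≠ ∞ := ne_top_of_le_ne_top enorm_ne_top h
    refine ⟨(ENNReal.summable_toReal h1).congr fun x => toReal_enorm _, ?_⟩
    have h2 := ENNReal.toReal_mono enorm_ne_top h
    rw [ENNReal.tsum_toReal_eq fun x => enorm_ne_top] at h2
    simpa only [toReal_enorm] using h2
  have hts : Summable fun x => ‖t x‖ := (hnorm (1 + Y)).1
  have hPb : ∀ x u, ‖entry P₀ x u‖ ≤ ‖P₀‖ := fun x u => by
    obtain ⟨h1, h2⟩ : (Summable fun x => ‖entry P₀ x u‖) ∧ ∑' x, ‖entry P₀ x u‖ ≤ ‖P₀‖ := by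
      have h := tsum_entry_le P₀ u
      have h1 : ∑' x, ‖entry P₀ x u‖ₑ ≠ ∞ := ne_top_of_le_ne_top enorm_ne_top h
      refine ⟨(ENNReal.summable_toReal h1).congr fun x => toReal_enorm _, ?_⟩
      have h2 := ENNReal.toReal_mono enorm_ne_top h
      rw [ENNReal.tsum_toReal_eq fun x => enorm_ne_top] at h2
      simpa only [toReal_enorm] using h2
    exact (h1.le_tsum x fun _ _ => norm_nonneg _).trans h2
  -- the double sum `⟨t, J P₀ t⟩` is real
  set F : I → I → ℂ := fun x u => (starRingEnd ℂ) (t x) * J x * (entry P₀ x u * t u) with hF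
  have hFs : Summable (Function.uncurry F) := by
    refine Summable.of_norm_bounded ((hts.mul_of_nonneg hts (fun _ => norm_nonneg _)
      fun _ => norm_nonneg _).mul_left ‖P₀‖) fun p => ?_
    rw [Function.uncurry, hF]
    simp only [norm_mul, RCLike.norm_conj, Complex.norm_real, Real.norm_eq_abs, hJ, mul_one]
    calc ‖t p.1‖ * (‖entry P₀ p.1 p.2‖ * ‖t p.2‖) = ‖entry P₀ p.1 p.2‖ * (‖t p.1‖ * ‖t p.2‖) := by
          ring
      _ ≤ _ := by gcongr; exact hPb _ _
  set A : ℂ := ∑' x, ∑' u, F x u with hA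
  have hconjF : ∀ x u, (starRingEnd ℂ) (F x u) = F u x := fun x u => by
    have h := hPJ u x
    simp only [hF, map_mul, Complex.conj_conj, Complex.conj_ofReal]
    linear_combination (-t x * (starRingEnd ℂ) (t u)) * h
  have hAreal : (starRingEnd ℂ) A = A := by
    rw [hA, Complex.conj_tsum]
    simp only [Complex.conj_tsum, hconjF]
    exact hFs.tsum_comm
  -- By the eigenvector equation for the column t. The unbounded L enters only here, through a real
  -- factor, so absolute summability has to be checked only for the double sum with the bounded
  -- entries of P₀.
  have hrow : ∀ x, ∑' u, F x u
      = ((J x * ‖t x‖ ^ 2 : ℝ) : ℂ) * (z y - (L x - L y)) := by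
    intro x
    have h1 := hP x y
    rw [mul_zero, entry_zero, add_zero] at h1
    have h2 := (hasSum_entry_mul P₀ (1 + Y) x y).tsum_eq
    simp only [hF, tsum_mul_left]
    rw [show (∑' u, entry P₀ x u * t u) = entry (P₀ * (1 + Y)) x y from h2]
    have h3 : ((‖t x‖ ^ 2 : ℝ) : ℂ) = (starRingEnd ℂ) (t x) * t x := by
      rw [mul_comm, Complex.mul_conj, Complex.normSq_eq_norm_sq]
    rw [Complex.ofReal_mul, h3]
    linear_combination ((starRingEnd ℂ) (t x) * J x) * h1
  have hsq : Summable fun x => J x * ‖t x‖ ^ 2 := by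
    refine Summable.of_norm_bounded (hts.mul_left (∑' x, ‖t x‖)) fun x => ?_
    rw [norm_mul, Real.norm_eq_abs, hJ, one_mul, norm_pow, norm_norm, sq]
    gcongr
    exact hts.le_tsum x fun _ _ => norm_nonneg _
  have him : (z y).im * ∑' x, J x * ‖t x‖ ^ 2 = 0 := by
    have h1 : A.im = 0 := Complex.conj_eq_iff_im.1 hAreal
    rw [← tsum_mul_left, ← h1, hA]
    erw [Complex.im_tsum hFs.prod]
    refine tsum_congr fun x => ?_
    change _ = (∑' u, F x u).im
    rw [hrow, Complex.im_ofReal_mul]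
    simp [mul_comm]
  rcases mul_eq_zero.1 him with h | h
  · exact h
  -- The signed sum ∑ J|t|² cannot vanish: its term at y has modulus at least (1 - ‖Y‖)² > 1/4,
  -- while the other terms add up to at most ‖Y‖² < 1/4.
  exfalso
  obtain ⟨hYs, hYn⟩ := hnorm Y
  have hle : ∀ x, ‖entry Y x y‖ ≤ ‖Y‖ := fun x =>
    (hYs.le_tsum x fun _ _ => norm_nonneg _).trans hYn
  have hty : 1 - ‖Y‖ ≤ ‖t y‖ := by
    have : t y = 1 - -entry Y y y := by simp [ht, entry_add, entry_one]
    rw [this]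
    refine le_trans ?_ (norm_sub_norm_le _ _)
    rw [norm_neg, norm_one]
    linarith [hle y]
  have h3 : HasSum (fun x => J x * ‖t x‖ ^ 2 - if x = y then J y * ‖t y‖ ^ 2 else 0)
      (0 - J y * ‖t y‖ ^ 2) := (h ▸ hsq.hasSum).sub (hasSum_ite_eq y _)
  have h4 : ‖0 - J y * ‖t y‖ ^ 2‖ ≤ ‖Y‖ * ‖Y‖ := by
    rw [← h3.tsum_eq]
    refine (tsum_of_norm_bounded (hYs.hasSum.mul_left ‖Y‖) fun x => ?_).trans
      (mul_le_mul_of_nonneg_left hYn (norm_nonneg _))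
    by_cases hx : x = y
    · subst hx; simp; positivity
    · have : t x = entry Y x y := by simp [ht, entry_add, entry_one, hx]
      rw [if_neg hx, sub_zero, norm_mul, Real.norm_eq_abs, hJ, one_mul, norm_pow, norm_norm, this, sq]
      gcongr
      exact hle x
  rw [zero_sub, norm_neg, norm_mul, Real.norm_eq_abs, hJ, one_mul, norm_pow, norm_norm] at h4
  nlinarith [norm_nonneg Y]

end Conjugation


/-! ### Lipschitz families of operators and the estimates of the iteration -/

section Lipschitz

variable {I : Type*} [DecidableEq I] {Λ : Type*} [PseudoEMetricSpace Λ]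

/-- The family `a` is bounded by `ε` and `ε`-Lipschitz on `S`, in the norm with weight `W`. -/
structure LipBound (S : Set Λ) (W : I → I → ℝ≥0∞) (ε : ℝ≥0∞) (a : Λ → Op I) : Prop where
  bound : ∀ ω ∈ S, wnorm W (a ω) ≤ ε
  lip : ∀ ω ∈ S, ∀ ω' ∈ S, wnorm W (a ω - a ω') ≤ ε * edist ω ω'

/-- The functions `g ω x y` are Schur multipliers from the weight `W` to the weight `W'`, bounded
and Lipschitz with constant `c`. -/
structure MultBound (S : Set Λ) (c : ℝ≥0∞) (W W' : I → I → ℝ≥0∞) (g : Λ → I → I → ℂ) : Prop where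
  bound : ∀ ω ∈ S, ∀ x y, W' x y * ‖g ω x y‖ₑ ≤ c * W x y
  lip : ∀ ω ∈ S, ∀ ω' ∈ S, ∀ x y, W' x y * ‖g ω x y - g ω' x y‖ₑ ≤ c * edist ω ω' * W x y

variable {S S' : Set Λ} {W W' : I → I → ℝ≥0∞} {α β : ℝ≥0∞} {a b : Λ → Op I}

theorem LipBound.mono (h : LipBound S W α a) (hS : S' ⊆ S) (hW : ∀ x y, W' x y ≤ W x y)
    (hα : α ≤ β) : LipBound S' W' β a :=
  ⟨fun ω hω => (wnorm_mono hW _).trans ((h.bound ω (hS hω)).trans hα),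
    fun ω hω ω' hω' => (wnorm_mono hW _).trans ((h.lip ω (hS hω) ω' (hS hω')).trans (by gcongr))⟩

theorem LipBound.const {P : Op I} (h : wnorm W P ≤ α) : LipBound S W α fun _ => P :=
  ⟨fun _ _ => h, fun _ _ _ _ => by simp [wnorm_zero]⟩

theorem LipBound.sub (ha : LipBound S W α a) (hb : LipBound S W β b) :
    LipBound S W (α + β) fun ω => a ω - b ω :=
  ⟨fun ω hω => (wnorm_sub_le _ _).trans (add_le_add (ha.bound ω hω) (hb.bound ω hω)),
    fun ω hω ω' hω' => by
      rw [show a ω - b ω - (a ω' - b ω') = (a ω - a ω') - (b ω - b ω') by abel, add_mul]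
      exact (wnorm_sub_le _ _).trans (add_le_add (ha.lip ω hω ω' hω') (hb.lip ω hω ω' hω'))⟩

theorem LipBound.mul (hW : IsWeight W) (ha : LipBound S W α a) (hb : LipBound S W β b) :
    LipBound S W (2 * (α * β)) fun ω => a ω * b ω :=
  ⟨fun ω hω => (wnorm_mul_le hW _ _).trans
      ((mul_le_mul' (ha.bound ω hω) (hb.bound ω hω)).trans (le_mul_of_one_le_left' one_le_two)),
    fun ω hω ω' hω' => by
      rw [show a ω * b ω - a ω' * b ω' = a ω * (b ω - b ω') + (a ω - a ω') * b ω' by noncomm_ring]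
      calc _ ≤ α * (β * edist ω ω') + α * edist ω ω' * β :=
            (wnorm_add_le _ _).trans (add_le_add
              ((wnorm_mul_le hW _ _).trans (mul_le_mul' (ha.bound ω hω) (hb.lip ω hω ω' hω')))
              ((wnorm_mul_le hW _ _).trans (mul_le_mul' (ha.lip ω hω ω' hω') (hb.bound ω' hω'))))
        _ = _ := by ring⟩

theorem dg_sub (P Q : Op I) : dg (P - Q) = dg P - dg Q :=
  op_ext fun x y => by
    rw [entry_sub, entry_dg, entry_dg, entry_dg, entry_sub]; split_ifs <;> simp

theorem wnorm_dg_le (P : Op I) : wnorm W (dg P) ≤ wnorm W P :=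
  schur_mono fun x y => by
    gcongr
    rw [entry_dg]
    split_ifs with h
    · rw [h]
    · simp

theorem LipBound.dg (ha : LipBound S W α a) : LipBound S W α fun ω => dg (a ω) :=
  ⟨fun ω hω => (wnorm_dg_le _).trans (ha.bound ω hω), fun ω hω ω' hω' => by
    rw [← dg_sub]; exact (wnorm_dg_le _).trans (ha.lip ω hω ω' hω')⟩

/-- Resolvent identity: with R = (1 + X)⁻¹ and R' = (1 + X')⁻¹, RQ - R'Q' = R((Q - Q') - (X - X')
R'Q'). Each inverse is again followed by a factor of finite weighted norm. -/
theorem LipBound.inverse_mul (hW : IsWeight W) {X Q : Λ → Op I} {χ q : ℝ≥0∞} (hχ : χ ≤ 1 / 2)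
    (hX : LipBound S W χ X) (hQ : LipBound S W q Q) :
    LipBound S W (4 * q) fun ω => Ring.inverse (1 + X ω) * Q ω := by
  have hx : ∀ ω ∈ S, wnorm W (X ω) ≤ 1 / 2 := fun ω hω => (hX.bound ω hω).trans hχ
  have hb : ∀ ω ∈ S, wnorm W (Ring.inverse (1 + X ω) * Q ω) ≤ 2 * q := fun ω hω =>
    (inverse_mul_bound hW (hx ω hω) _).trans (by gcongr; exact hQ.bound ω hω)
  refine ⟨fun ω hω => (hb ω hω).trans (by gcongr; norm_num), fun ω hω ω' hω' => ?_⟩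
  have hu := isUnit_one_add hW (hx ω hω)
  have hu' := isUnit_one_add hW (hx ω' hω')
  have e : Ring.inverse (1 + X ω) * Q ω - Ring.inverse (1 + X ω') * Q ω'
      = Ring.inverse (1 + X ω)
        * ((Q ω - Q ω') - (X ω - X ω') * (Ring.inverse (1 + X ω') * Q ω')) := by
    have e1 : (1 + X ω') * (Ring.inverse (1 + X ω') * Q ω') = Q ω' := by
      rw [← mul_assoc, Ring.mul_inverse_cancel _ hu', one_mul]
    have e2 : Ring.inverse (1 + X ω) * ((1 + X ω) * (Ring.inverse (1 + X ω') * Q ω'))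
        = Ring.inverse (1 + X ω') * Q ω' := by
      rw [← mul_assoc, Ring.inverse_mul_cancel _ hu, one_mul]
    calc _ = Ring.inverse (1 + X ω) * Q ω
          - Ring.inverse (1 + X ω) * ((1 + X ω) * (Ring.inverse (1 + X ω') * Q ω')) := by rw [e2]
      _ = Ring.inverse (1 + X ω) * (Q ω - (1 + X ω') * (Ring.inverse (1 + X ω') * Q ω')
          - (X ω - X ω') * (Ring.inverse (1 + X ω') * Q ω')) := by noncomm_ring
      _ = _ := by rw [e1]
  rw [e]
  calc _ ≤ 2 * (q * edist ω ω' + χ * edist ω ω' * (2 * q)) := by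
        refine (inverse_mul_bound hW (hx ω hω) _).trans ?_
        gcongr
        refine (wnorm_sub_le _ _).trans (add_le_add (hQ.lip ω hω ω' hω') ?_)
        exact (wnorm_mul_le hW _ _).trans (mul_le_mul' (hX.lip ω hω ω' hω') (hb ω' hω'))
    _ ≤ 2 * (q * edist ω ω' + 1 / 2 * edist ω ω' * (2 * q)) := by gcongr
    _ = 2 * (q * edist ω ω' + (1 / 2 * 2) * (q * edist ω ω')) := by ring
    _ = 4 * q * edist ω ω' := by
        rw [one_div, ENNReal.inv_mul_cancel (by norm_num) (by norm_num)]; ring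

/-- Finiteness of c ε ensures that `ofMat` returns the given matrix and not its default value 0. The
factor 2 comes from the product rule in the Lipschitz estimate. -/
theorem LipBound.ofMat_mul (hW' : ∀ x y, 1 ≤ W' x y) {P : Λ → Op I} {ε c : ℝ≥0∞}
    {g : Λ → I → I → ℂ} (hP : LipBound S W ε P) (hg : MultBound S c W W' g) (hc : c * ε ≠ ∞) :
    (∀ ω ∈ S, ∀ x y, entry (ofMat fun x y => g ω x y * entry (P ω) x y) x y
        = g ω x y * entry (P ω) x y) ∧
      LipBound S W' (2 * (c * ε)) fun ω => ofMat fun x y => g ω x y * entry (P ω) x y := by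
  have h1 : ∀ ω ∈ S, schur (fun x y => W' x y * ‖g ω x y * entry (P ω) x y‖ₑ) ≤ c * ε := by
    intro ω hω
    refine (schur_mono fun x y => ?_).trans ((schur_const_mul_le c _).trans
      (mul_le_mul' le_rfl (hP.bound ω hω)))
    rw [enorm_mul, ← mul_assoc, ← mul_assoc]
    exact mul_le_mul' (hg.bound ω hω x y) le_rfl
  have he : ∀ ω ∈ S, ∀ x y, entry (ofMat fun x y => g ω x y * entry (P ω) x y) x y
        = g ω x y * entry (P ω) x y := by
    intro ω hω x y
    refine entry_ofMat_of_schur (ne_top_of_le_ne_top hc ((schur_mono fun x y => ?_).trans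
      (h1 ω hω))) x y
    exact le_mul_of_one_le_left' (hW' x y)
  refine ⟨he, fun ω hω => ?_, fun ω hω ω' hω' => ?_⟩
  · refine le_trans ?_ ((h1 ω hω).trans (le_mul_of_one_le_left' one_le_two))
    exact schur_mono fun x y => by rw [he ω hω]
  · calc _ ≤ schur (fun x y => c * (W x y * ‖entry (P ω - P ω') x y‖ₑ)
          + c * edist ω ω' * (W x y * ‖entry (P ω') x y‖ₑ)) := by
          refine schur_mono fun x y => ?_
          rw [entry_sub, he ω hω, he ω' hω', entry_sub,
            show g ω x y * entry (P ω) x y - g ω' x y * entry (P ω') x y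
              = g ω x y * (entry (P ω) x y - entry (P ω') x y)
                + (g ω x y - g ω' x y) * entry (P ω') x y by ring]
          refine (mul_le_mul' le_rfl (enorm_add_le _ _)).trans ?_
          rw [mul_add, enorm_mul, enorm_mul, ← mul_assoc, ← mul_assoc, ← mul_assoc, ← mul_assoc]
          exact add_le_add (mul_le_mul' (hg.bound ω hω x y) le_rfl)
            (mul_le_mul' (hg.lip ω hω ω' hω' x y) le_rfl)
      _ ≤ c * (ε * edist ω ω') + c * edist ω ω' * ε := by
          refine (schur_add_le _ _).trans (add_le_add ?_ ?_)
          · exact (schur_const_mul_le c _).trans (mul_le_mul' le_rfl (hP.lip ω hω ω' hω'))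
          · exact (schur_const_mul_le _ _).trans (mul_le_mul' le_rfl (hP.bound ω' hω'))
      _ = _ := by ring

/-- The Schur multiplier in the homological equation. -/
def divMult (L : I → ℝ) (z : I → ℂ) (x y : I) : ℂ :=
  if x = y then 0 else -(L x + z x - (L y + z y))⁻¹

theorem homSol_eq (L : I → ℝ) (z : I → ℂ) (P : Op I) :
    homSol L z P = ofMat fun x y => divMult L z x y * entry P x y := by
  unfold homSol divMult
  congr; ext x y; split_ifs <;> simp

/-- 16 = 4 · (2 + 2): the inverse costs 4, and each of the products P X and X dg P costs 2. -/
theorem LipBound.kamStep_snd (hW : IsWeight W) {z : Λ → I → ℂ} {L : Λ → I → ℝ} {P : Λ → Op I}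
    {ε χ : ℝ≥0∞} (hP : LipBound S W ε P) (hX : LipBound S W χ fun ω => homSol (L ω) (z ω) (P ω))
    (hχ : χ ≤ 1 / 2) :
    LipBound S W (16 * (ε * χ)) fun ω => (kamStep (L ω) (z ω, P ω)).2 := by
  have h := LipBound.inverse_mul hW hχ hX ((hP.mul hW hX).sub (hX.mul hW hP.dg))
  exact h.mono subset_rfl (fun _ _ => le_rfl) (le_of_eq (by ring))

/-- The estimates of the iteration. -/
theorem kam_estimates {L : Λ → I → ℝ} {P₀ : Op I} {S : ℕ → Set Λ} {W : ℕ → I → I → ℝ≥0∞}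
    {V : I → ℝ≥0∞} {c ε : ℕ → ℝ≥0∞} {p χ₀ : ℝ≥0∞}
    (hS : ∀ n, S (n + 1) ⊆ S n) (hW : ∀ n, IsWeight (W n)) (hWm : ∀ n x y, W (n + 1) x y ≤ W n x y)
    (hV : ∀ n x, V x ≤ W n x x)
    (hd : ∀ x, entry P₀ x x = 0) (hp : wnorm (W 0) P₀ ≤ p) (hχ₀ : χ₀ ≤ 1 / 2)
    (h₀ : LipBound (S 0) (W 0) χ₀ fun ω => kamGen (L ω) P₀ 0)
    (hε₀ : 16 * (p * χ₀) ≤ ε 0) (hcε : ∀ n, 2 * (c n * ε n) ≤ 1 / 2)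
    (hε : ∀ n, 16 * (ε n * (2 * (c n * ε n))) ≤ ε (n + 1))
    (hdiv : ∀ n, (∀ ω ∈ S n, ∀ ω' ∈ S n, ∀ x, ‖(kamState (L ω) P₀ (n + 1)).1 x
        - (kamState (L ω') P₀ (n + 1)).1 x‖ₑ ≤ (∑' m, ε m) * edist ω ω') →
      MultBound (S (n + 1)) (c n) (W n) (W (n + 1))
        fun ω => divMult (L ω) (kamState (L ω) P₀ (n + 1)).1) (n : ℕ) :
    LipBound (S n) (W n) (ε n) (fun ω => (kamState (L ω) P₀ (n + 1)).2) ∧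
      (∀ ω ∈ S n, ∀ x, V x * ‖(kamState (L ω) P₀ (n + 1)).1 x‖ₑ ≤ ∑ m ∈ Finset.range n, ε m) ∧
      (∀ ω ∈ S n, ∀ ω' ∈ S n, ∀ x, ‖(kamState (L ω) P₀ (n + 1)).1 x
        - (kamState (L ω') P₀ (n + 1)).1 x‖ₑ ≤ (∑ m ∈ Finset.range n, ε m) * edist ω ω') ∧
      (∀ ω ∈ S (n + 1), ∀ x y, entry (kamGen (L ω) P₀ (n + 1)) x y
        = divMult (L ω) (kamState (L ω) P₀ (n + 1)).1 x y
          * entry (kamState (L ω) P₀ (n + 1)).2 x y) ∧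
      LipBound (S (n + 1)) (W (n + 1)) (2 * (c n * ε n)) fun ω => kamGen (L ω) P₀ (n + 1) := by
  have hgen : ∀ n, LipBound (S n) (W n) (ε n) (fun ω => (kamState (L ω) P₀ (n + 1)).2) →
      (∀ ω ∈ S n, ∀ ω' ∈ S n, ∀ x, ‖(kamState (L ω) P₀ (n + 1)).1 x
        - (kamState (L ω') P₀ (n + 1)).1 x‖ₑ ≤ (∑ m ∈ Finset.range n, ε m) * edist ω ω') →
      (∀ ω ∈ S (n + 1), ∀ x y, entry (kamGen (L ω) P₀ (n + 1)) x y
        = divMult (L ω) (kamState (L ω) P₀ (n + 1)).1 x y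
          * entry (kamState (L ω) P₀ (n + 1)).2 x y) ∧
      LipBound (S (n + 1)) (W (n + 1)) (2 * (c n * ε n)) fun ω => kamGen (L ω) P₀ (n + 1) := by
    intro n h1 h2
    have h3 := hdiv n fun ω hω ω' hω' x => (h2 ω hω ω' hω' x).trans
      (mul_le_mul' (ENNReal.sum_le_tsum _) le_rfl)
    have h4 : c n * ε n ≠ ∞ := fun h => by
      have := hcε n
      rw [h, ENNReal.mul_top (by norm_num), top_le_iff] at this
      norm_num at this
    have h5 := LipBound.ofMat_mul (hW (n + 1)).one_le
      (h1.mono (hS n) (fun _ _ => le_rfl) le_rfl) h3 h4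
    simp only [kamGen, homSol_eq]
    exact h5
  -- Index n refers to the state after n + 1 steps: the first step is supplied by `h₀`, and only the
  -- later ones use the multiplier constants c n.
  induction n with
  | zero =>
    have h1 : LipBound (S 0) (W 0) (ε 0) (fun ω => (kamState (L ω) P₀ (0 + 1)).2) :=
      (LipBound.kamStep_snd (z := fun _ => 0) (hW 0) (LipBound.const hp) h₀ hχ₀).mono subset_rfl
        (fun _ _ => le_rfl) hε₀
    -- The diagonal of P₀ vanishes, so the first step does not move the Floquet exponents.
    have hz : ∀ ω x, (kamState (L ω) P₀ (0 + 1)).1 x = 0 := fun ω x => by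
      simp [kamState, kamStep, hd]
    have h2 : ∀ ω ∈ S 0, ∀ ω' ∈ S 0, ∀ x, ‖(kamState (L ω) P₀ (0 + 1)).1 x
        - (kamState (L ω') P₀ (0 + 1)).1 x‖ₑ ≤ (∑ m ∈ Finset.range 0, ε m) * edist ω ω' := by
      intro ω _ ω' _ x; rw [hz, hz]; simp
    exact ⟨h1, fun ω _ x => by rw [hz]; simp, h2, hgen 0 h1 h2⟩
  | succ n ih =>
    obtain ⟨i1, i2, i3, -, i5⟩ := ih
    have h1 : LipBound (S (n + 1)) (W (n + 1)) (ε (n + 1))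
        (fun ω => (kamState (L ω) P₀ (n + 1 + 1)).2) :=
      (LipBound.kamStep_snd (hW (n + 1)) (i1.mono (hS n) (hWm n) le_rfl) i5 (hcε n)).mono
        subset_rfl (fun _ _ => le_rfl) (hε n)
    have hz : ∀ ω x, (kamState (L ω) P₀ (n + 1 + 1)).1 x = (kamState (L ω) P₀ (n + 1)).1 x
        + entry (kamState (L ω) P₀ (n + 1)).2 x x := fun ω x => rfl
    have hb : ∀ (a : Op I) x, V x * ‖entry a x x‖ₑ ≤ wnorm (W n) a := fun a x =>
      (mul_le_mul' (hV n x) le_rfl).trans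
        (entry_le_schur (fun x y => W n x y * ‖entry a x y‖ₑ) x x)
    have hb' : ∀ (a : Op I) x, ‖entry a x x‖ₑ ≤ wnorm (W n) a := fun a x =>
      (le_mul_of_one_le_left' ((hW n).one_le x x)).trans
        (entry_le_schur (fun x y => W n x y * ‖entry a x y‖ₑ) x x)
    have h2 : ∀ ω ∈ S (n + 1), ∀ ω' ∈ S (n + 1), ∀ x, ‖(kamState (L ω) P₀ (n + 1 + 1)).1 x
        - (kamState (L ω') P₀ (n + 1 + 1)).1 x‖ₑ
          ≤ (∑ m ∈ Finset.range (n + 1), ε m) * edist ω ω' := by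
      intro ω hω ω' hω' x
      rw [hz, hz, Finset.sum_range_succ, add_mul, add_sub_add_comm, ← entry_sub]
      exact (enorm_add_le _ _).trans (add_le_add (i3 ω (hS n hω) ω' (hS n hω') x)
        ((hb' _ x).trans (i1.lip ω (hS n hω) ω' (hS n hω'))))
    refine ⟨h1, fun ω hω x => ?_, h2, hgen (n + 1) h1 h2⟩
    rw [hz, Finset.sum_range_succ]
    refine (mul_le_mul' le_rfl (enorm_add_le _ _)).trans ?_
    rw [mul_add]
    exact add_le_add (i2 ω (hS n hω) x) ((hb _ x).trans (i1.bound ω (hS n hω)))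

end Lipschitz


/-! ### The index set, the frequencies and the weights -/

/-- Indices `(k, (s, m))`: a Fourier mode in time, a component and a sine mode. -/
abbrev Idx (ν : ℕ) := (Fin ν → ℤ) × (Bool × ℕ+)

/-- The `ℓ¹` length of an integer vector. -/
def kabs {ν : ℕ} (k : Fin ν → ℤ) : ℝ := ∑ i, |(k i : ℝ)|

/-- The sign of a component. -/
def sg (b : Bool) : ℝ := if b then -1 else 1

/-- The distance of two sine modes. -/
def mdist (m n : ℕ+) : ℕ := ((m : ℤ) - n).natAbs

/-- The pairing `ω · k`. -/
def dotk {ν : ℕ} (ω : EuclideanSpace ℝ (Fin ν)) (k : Fin ν → ℤ) : ℝ := ∑ i, ω i * k i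

/-- The unperturbed Floquet exponents. -/
def freq {ν : ℕ} (mass : ℝ) (ω : EuclideanSpace ℝ (Fin ν)) (x : Idx ν) : ℝ :=
  dotk ω x.1 + sg x.2.1 * eigB mass x.2.2

/-- The weight of the norms in the iteration. -/
def wt {ν : ℕ} (w : ℕ → ℝ≥0∞) (ρ : ℝ) (x y : Idx ν) : ℝ≥0∞ :=
  ENNReal.ofReal (Real.exp (ρ * kabs (x.1 - y.1))) * w (mdist x.2.2 y.2.2)
    * ENNReal.ofReal (Real.sqrt x.2.2)

/-- The stronger weight in which the given perturbation is bounded. -/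
def wtBig {ν : ℕ} (w : ℕ → ℝ≥0∞) (ρ : ℝ) (x y : Idx ν) : ℝ≥0∞ :=
  ENNReal.ofReal (Real.exp (2 * ρ * kabs (x.1 - y.1))) * w (mdist x.2.2 y.2.2)
    * ENNReal.ofReal (Real.sqrt x.2.2)
    * ENNReal.ofReal ((1 + mdist x.2.2 y.2.2) * Real.sqrt y.2.2)

/-- Submultiplicative weights on `ℕ`. -/
structure IsNatWeight (w : ℕ → ℝ≥0∞) : Prop where
  one_le : ∀ n, 1 ≤ w n
  mono : Monotone w
  le_mul : ∀ m n, w (m + n) ≤ w m * w n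

section Basic

variable {ν : ℕ}

theorem kabs_nonneg (k : Fin ν → ℤ) : 0 ≤ kabs k := Finset.sum_nonneg fun _ _ => abs_nonneg _

theorem kabs_zero : kabs (0 : Fin ν → ℤ) = 0 := by simp [kabs]

theorem kabs_add_le (k l : Fin ν → ℤ) : kabs (k + l) ≤ kabs k + kabs l := by
  unfold kabs
  rw [← Finset.sum_add_distrib]
  refine Finset.sum_le_sum fun i _ => ?_
  push_cast [Pi.add_apply]
  exact abs_add_le _ _

theorem mdist_triangle (m n p : ℕ+) : mdist m p ≤ mdist m n + mdist n p := by
  unfold mdist; omega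

theorem mdist_comm (m n : ℕ+) : mdist m n = mdist n m := by unfold mdist; omega

theorem one_le_pnat (m : ℕ+) : (1 : ℝ) ≤ m := by exact_mod_cast (one_le : 1 ≤ m)

theorem abs_sg (b : Bool) : |sg b| = 1 := by cases b <;> simp [sg]

theorem one_le_sqrt_pnat (m : ℕ+) : 1 ≤ Real.sqrt m := Real.one_le_sqrt.2 (one_le_pnat m)

theorem abs_dotk_le (ω : EuclideanSpace ℝ (Fin ν)) (k : Fin ν → ℤ) :
    |dotk ω k| ≤ ‖ω‖ * kabs k := by
  unfold dotk kabs
  rw [Finset.mul_sum]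
  refine (Finset.abs_sum_le_sum_abs _ _).trans (Finset.sum_le_sum fun i _ => ?_)
  rw [abs_mul]
  gcongr
  exact PiLp.norm_apply_le ω i

theorem dotk_sub_left (ω ω' : EuclideanSpace ℝ (Fin ν)) (k : Fin ν → ℤ) :
    dotk (ω - ω') k = dotk ω k - dotk ω' k := by
  simp [dotk, sub_mul]

theorem dotk_sub_right (ω : EuclideanSpace ℝ (Fin ν)) (k l : Fin ν → ℤ) :
    dotk ω (k - l) = dotk ω k - dotk ω l := by
  simp [dotk, mul_sub]

theorem dotk_add_right (ω : EuclideanSpace ℝ (Fin ν)) (k l : Fin ν → ℤ) :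
    dotk ω (k + l) = dotk ω k + dotk ω l := by
  simp [dotk, mul_add, Finset.sum_add_distrib]

theorem eigB_nonneg (mass : ℝ) (m : ℕ+) : 0 ≤ eigB mass m := Real.sqrt_nonneg _

theorem le_eigB (mass : ℝ) (m : ℕ+) : (m : ℝ) ≤ eigB mass m := by
  unfold eigB
  exact Real.le_sqrt_of_sq_le (by nlinarith [sq_nonneg mass])

theorem eigB_le {mass : ℝ} (hm : 0 ≤ mass) (m : ℕ+) : eigB mass m ≤ m + mass := by
  unfold eigB
  refine Real.sqrt_le_iff.2 ⟨by positivity, ?_⟩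
  nlinarith [one_le_pnat m]

/-- A factor depending on the row mode alone is harmless for submultiplicativity, because √ of the
intermediate mode is at least 1. -/
theorem isWeight_wt {w : ℕ → ℝ≥0∞} (hw : IsNatWeight w) {ρ : ℝ} (hρ : 0 ≤ ρ) :
    IsWeight (wt (ν := ν) w ρ) := by
  have hs : ∀ m : ℕ+, 1 ≤ ENNReal.ofReal (Real.sqrt m) := fun m => by
    rw [← ENNReal.ofReal_one]; exact ENNReal.ofReal_le_ofReal (one_le_sqrt_pnat m)
  refine ⟨fun x y => ?_, fun x z y => ?_⟩
  · have h1 : 1 ≤ ENNReal.ofReal (Real.exp (ρ * kabs (x.1 - y.1))) := by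
      rw [← ENNReal.ofReal_one]
      exact ENNReal.ofReal_le_ofReal (Real.one_le_exp (mul_nonneg hρ (kabs_nonneg _)))
    exact one_le_mul (one_le_mul h1 (hw.one_le _)) (hs _)
  · have h1 : ENNReal.ofReal (Real.exp (ρ * kabs (x.1 - y.1)))
        ≤ ENNReal.ofReal (Real.exp (ρ * kabs (x.1 - z.1)))
          * ENNReal.ofReal (Real.exp (ρ * kabs (z.1 - y.1))) := by
      rw [← ENNReal.ofReal_mul (Real.exp_nonneg _), ← Real.exp_add, ← mul_add]
      refine ENNReal.ofReal_le_ofReal (Real.exp_le_exp.2 (mul_le_mul_of_nonneg_left ?_ hρ))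
      rw [show x.1 - y.1 = (x.1 - z.1) + (z.1 - y.1) by abel]
      exact kabs_add_le _ _
    have h2 : w (mdist x.2.2 y.2.2) ≤ w (mdist x.2.2 z.2.2) * w (mdist z.2.2 y.2.2) :=
      (hw.mono (mdist_triangle _ _ _)).trans (hw.le_mul _ _)
    have h3 : ENNReal.ofReal (Real.sqrt x.2.2)
        ≤ ENNReal.ofReal (Real.sqrt x.2.2) * ENNReal.ofReal (Real.sqrt z.2.2) :=
      le_mul_of_one_le_right' (hs _)
    calc wt w ρ x y ≤ _ := mul_le_mul' (mul_le_mul' h1 h2) h3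
      _ = wt w ρ x z * wt w ρ z y := by unfold wt; ring

theorem wt_mono (w : ℕ → ℝ≥0∞) {ρ ρ' : ℝ} (h : ρ' ≤ ρ) (x y : Idx ν) : wt w ρ' x y ≤ wt w ρ x y := by
  unfold wt
  gcongr
  exact kabs_nonneg _

theorem wt_le_wtBig (w : ℕ → ℝ≥0∞) {ρ : ℝ} (h : 0 ≤ ρ) (x y : Idx ν) :
    wt w ρ x y ≤ wtBig w ρ x y := by
  unfold wtBig
  refine le_trans ?_ (le_mul_of_one_le_right' ?_)
  · unfold wt
    gcongr
    · exact kabs_nonneg _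
    · linarith
  · rw [← ENNReal.ofReal_one]
    refine ENNReal.ofReal_le_ofReal ?_
    have := one_le_sqrt_pnat y.2.2
    have : (0 : ℝ) ≤ mdist x.2.2 y.2.2 := Nat.cast_nonneg _
    nlinarith

/-- A power of |k| is paid for by a part σ of the analyticity width, at the price σ^{-q}; one term
of the exponential series gives this. -/
theorem pow_le_exp (q : ℕ) {σ x : ℝ} (hσ : 0 < σ) (hx : 0 ≤ x) :
    (1 + x) ^ q ≤ (q.factorial * Real.exp σ / σ ^ q) * Real.exp (σ * x) := by
  have h := Real.pow_div_factorial_le_exp (σ * (1 + x)) (by positivity) q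
  rw [div_le_iff₀ (by positivity), mul_pow] at h
  rw [div_mul_eq_mul_div, le_div_iff₀ (by positivity), mul_assoc, ← Real.exp_add]
  calc _ = σ ^ q * (1 + x) ^ q := mul_comm _ _
    _ ≤ _ := h
    _ = _ := by rw [mul_comm]; congr 2; ring

/-! ### Small divisors -/

/-- From 1/D - 1/D' = (D' - D)/(DD'). In the Lipschitz bound one inverse divisor is left as it
stands, so that the first step can insert its better estimate there. -/
theorem divMult_bounds {Λ : Type*} [PseudoMetricSpace Λ] {L : Λ → Idx ν → ℝ} {z : Λ → Idx ν → ℂ}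
    {S : Set Λ} {B d : Idx ν → Idx ν → ℝ} (hd : ∀ x y, x ≠ y → 0 < d x y)
    (hS : ∀ ω ∈ S, ∀ x y, x ≠ y → d x y ≤ ‖(L ω x + z ω x - (L ω y + z ω y) : ℂ)‖)
    (hL : ∀ ω ∈ S, ∀ ω' ∈ S, ∀ x y, x ≠ y → ‖((L ω x + z ω x - (L ω y + z ω y) : ℂ)
      - (L ω' x + z ω' x - (L ω' y + z ω' y)))‖ ≤ B x y * dist ω ω') :
    (∀ ω ∈ S, ∀ x y, x ≠ y → ‖divMult (L ω) (z ω) x y‖ ≤ (d x y)⁻¹) ∧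
    ∀ ω ∈ S, ∀ ω' ∈ S, ∀ x y, x ≠ y → ‖divMult (L ω) (z ω) x y - divMult (L ω') (z ω') x y‖
      ≤ B x y * dist ω ω' * (‖divMult (L ω) (z ω) x y‖ * (d x y)⁻¹) := by
  have h1 : ∀ ω ∈ S, ∀ x y, x ≠ y → ‖divMult (L ω) (z ω) x y‖ ≤ (d x y)⁻¹ := by
    intro ω hω x y hxy
    rw [divMult, if_neg hxy, norm_neg, norm_inv]
    exact inv_anti₀ (hd x y hxy) (hS ω hω x y hxy)
  refine ⟨h1, fun ω hω ω' hω' x y hxy => ?_⟩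
  have h2 := h1 ω' hω' x y hxy
  have p1 := (hd x y hxy).trans_le (hS ω hω x y hxy)
  have p2 := (hd x y hxy).trans_le (hS ω' hω' x y hxy)
  have n1 := norm_pos_iff.1 p1
  have n2 := norm_pos_iff.1 p2
  have e : divMult (L ω) (z ω) x y - divMult (L ω') (z ω') x y
      = ((L ω x + z ω x - (L ω y + z ω y) : ℂ) - (L ω' x + z ω' x - (L ω' y + z ω' y)))
        * (divMult (L ω) (z ω) x y * divMult (L ω') (z ω') x y) := by
    simp only [divMult, if_neg hxy]
    field_simp
    ring
  rw [e, norm_mul, norm_mul]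
  exact mul_le_mul (hL ω hω ω' hω' x y hxy) (mul_le_mul_of_nonneg_left h2 (norm_nonneg _))
    (by positivity) ((norm_nonneg _).trans (hL ω hω ω' hω' x y hxy))

theorem freq_sub_lipschitz (mass : ℝ) (ω ω' : EuclideanSpace ℝ (Fin ν)) (x y : Idx ν) :
    |(freq mass ω x - freq mass ω y) - (freq mass ω' x - freq mass ω' y)|
      ≤ kabs (x.1 - y.1) * dist ω ω' := by
  have : (freq mass ω x - freq mass ω y) - (freq mass ω' x - freq mass ω' y)
      = dotk (ω - ω') (x.1 - y.1) := by
    rw [dotk_sub_left, dotk_sub_right, dotk_sub_right]; unfold freq; ring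
  rw [this, dist_eq_norm, mul_comm]
  exact abs_dotk_le _ _

end Basic


/-! ### Nonresonance conditions and the multipliers of the homological equation -/

section Nonresonance

variable {ν : ℕ}

/-- The frequencies that are nonresonant in the first `n` steps of the iteration. -/
def goodSet (mass : ℝ) (P₀ : Op (Idx ν)) (g δ : ℝ) (τ₁ τ : ℕ) (M : ℝ) :
    ℕ → Set (EuclideanSpace ℝ (Fin ν))
  | 0 => {ω | ω ∈ annulus ν M ∧ (∀ k : Fin ν → ℤ, k ≠ 0 → g * M ≤ |dotk ω k| * (1 + kabs k) ^ τ₁) ∧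
      (∀ k : Fin ν → ℤ, k ≠ 0 → ∀ l : ℤ, g ≤ |dotk ω k + l| * (1 + kabs k) ^ τ₁) ∧
      ∀ x y : Idx ν, x ≠ y → δ ≤ |freq mass ω x - freq mass ω y| * (1 + kabs (x.1 - y.1)) ^ τ}
  | n + 1 => {ω | ω ∈ goodSet mass P₀ g δ τ₁ τ M n ∧ ∀ x y : Idx ν, x ≠ y →
      δ / 2 ^ (n + 1) ≤ ‖(freq mass ω x + (kamState (freq mass ω) P₀ (n + 1)).1 x
        - (freq mass ω y + (kamState (freq mass ω) P₀ (n + 1)).1 y) : ℂ)‖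
        * (1 + kabs (x.1 - y.1)) ^ τ}

theorem wt_mul_le {w : ℕ → ℝ≥0∞} {ρ ρ' C G : ℝ} {x y : Idx ν} (hC : 0 ≤ C)
    (h : Real.exp (ρ' * kabs (x.1 - y.1)) * G ≤ C * Real.exp (ρ * kabs (x.1 - y.1))) :
    wt w ρ' x y * ENNReal.ofReal G ≤ ENNReal.ofReal C * wt w ρ x y := by
  have h1 := ENNReal.ofReal_le_ofReal h
  rw [ENNReal.ofReal_mul (Real.exp_nonneg _), ENNReal.ofReal_mul hC] at h1
  calc _ = ENNReal.ofReal (Real.exp (ρ' * kabs (x.1 - y.1))) * ENNReal.ofReal G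
        * (w (mdist x.2.2 y.2.2) * ENNReal.ofReal (Real.sqrt x.2.2)) := by unfold wt; ring
    _ ≤ _ := mul_le_mul' h1 le_rfl
    _ = _ := by unfold wt; ring

theorem wt_mul_le_wtBig {w : ℕ → ℝ≥0∞} {ρ C G : ℝ} {x y : Idx ν} (hC : 0 ≤ C)
    (h : G ≤ C * (Real.exp (ρ * kabs (x.1 - y.1))
      * ((1 + mdist x.2.2 y.2.2) * Real.sqrt y.2.2))) :
    wt w ρ x y * ENNReal.ofReal G ≤ ENNReal.ofReal C * wtBig w ρ x y := by
  have h1 := ENNReal.ofReal_le_ofReal (mul_le_mul_of_nonneg_left h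
    (Real.exp_nonneg (ρ * kabs (x.1 - y.1))))
  rw [ENNReal.ofReal_mul (Real.exp_nonneg _), mul_left_comm, ← mul_assoc (Real.exp _),
    ← Real.exp_add, ENNReal.ofReal_mul hC, ENNReal.ofReal_mul (Real.exp_nonneg _)] at h1
  calc _ = ENNReal.ofReal (Real.exp (ρ * kabs (x.1 - y.1))) * ENNReal.ofReal G
        * (w (mdist x.2.2 y.2.2) * ENNReal.ofReal (Real.sqrt x.2.2)) := by unfold wt; ring
    _ ≤ _ := mul_le_mul' h1 le_rfl
    _ = _ := by
      unfold wtBig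
      rw [show 2 * ρ * kabs (x.1 - y.1) = ρ * kabs (x.1 - y.1) + ρ * kabs (x.1 - y.1) by ring]
      ring

/-- The multiplier bounds in the general step. -/
theorem multBound_step {w : ℕ → ℝ≥0∞} {mass ρ δ : ℝ} (hρ : 0 < ρ) (hδ : 0 < δ) (hδ1 : δ ≤ 1)
    (τ n : ℕ) {S : Set (EuclideanSpace ℝ (Fin ν))}
    {z : EuclideanSpace ℝ (Fin ν) → Idx ν → ℂ}
    (hS : ∀ ω ∈ S, ∀ x y : Idx ν, x ≠ y → δ / 2 ^ (n + 1) ≤ ‖(freq mass ω x + z ω x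
        - (freq mass ω y + z ω y) : ℂ)‖ * (1 + kabs (x.1 - y.1)) ^ τ)
    (hz : ∀ ω ∈ S, ∀ ω' ∈ S, ∀ x, ‖z ω x - z ω' x‖ ≤ 1 / 2 * dist ω ω') :
    MultBound S (ENNReal.ofReal ((2 * τ + 1).factorial * Real.exp ρ * (4 / ρ) ^ (2 * τ + 1)
        * (2 / δ) ^ 2 * (2 ^ (2 * τ + 3)) ^ n))
      (wt w (ρ / 2 + ρ / 2 ^ (n + 1))) (wt w (ρ / 2 + ρ / 2 ^ (n + 2)))
      fun ω => divMult (freq mass ω) (z ω) := by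
  -- The Lipschitz bound contains two inverse divisors, each at most (1 + |k|)^τ / d with d =
  -- δ/2^{n+1}, and one factor 1 + |k| from the frequencies. This explains the exponent 2τ + 1,
  -- which is absorbed by the loss ρ/2^{n+2} of width. The powers of 2^n add up to 2τ + 1 from the
  -- width and 2 from d.
  set c : ℝ := (2 * τ + 1).factorial * Real.exp ρ * (4 / ρ) ^ (2 * τ + 1)
        * (2 / δ) ^ 2 * (2 ^ (2 * τ + 3)) ^ n with hc
  have hc0 : 0 ≤ c := by positivity
  set X : Idx ν → Idx ν → ℝ := fun x y => 1 + kabs (x.1 - y.1) with hX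
  have hX1 : ∀ x y, 1 ≤ X x y := fun x y => by have := kabs_nonneg (x.1 - y.1); simp [hX, this]
  set d : ℝ := δ / 2 ^ (n + 1) with hd
  have hd0 : 0 < d := by positivity
  have hd1 : d ≤ 1 := (div_le_self hδ.le (one_le_pow₀ one_le_two)).trans hδ1
  obtain ⟨b1, b2⟩ := divMult_bounds (L := fun ω => freq mass ω) (z := z) (S := S) (B := X)
    (d := fun x y => d / X x y ^ τ)
    (fun x y _ => div_pos hd0 (pow_pos (zero_lt_one.trans_le (hX1 x y)) τ))
    (fun ω hω x y hxy => by
      rw [div_le_iff₀ (pow_pos (zero_lt_one.trans_le (hX1 x y)) τ)]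
      exact hS ω hω x y hxy)
    (fun ω hω ω' hω' x y hxy => by
      have e : ((freq mass ω x + z ω x - (freq mass ω y + z ω y) : ℂ)
          - (freq mass ω' x + z ω' x - (freq mass ω' y + z ω' y)))
          = (((freq mass ω x - freq mass ω y) - (freq mass ω' x - freq mass ω' y) : ℝ) : ℂ)
            + (z ω x - z ω' x) - (z ω y - z ω' y) := by push_cast; ring
      rw [e]
      calc _ ≤ kabs (x.1 - y.1) * dist ω ω' + 1 / 2 * dist ω ω' + 1 / 2 * dist ω ω' := by
            refine (norm_sub_le _ _).trans (add_le_add ((norm_add_le _ _).trans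
              (add_le_add ?_ (hz ω hω ω' hω' x))) (hz ω hω ω' hω' y))
            rw [Complex.norm_real]
            exact freq_sub_lipschitz mass ω ω' x y
        _ = _ := by simp only [hX]; ring)
  have hexp : ∀ x y, Real.exp ((ρ / 2 + ρ / 2 ^ (n + 2)) * kabs (x.1 - y.1))
      * (X x y ^ (2 * τ + 1) / d ^ 2)
      ≤ c * Real.exp ((ρ / 2 + ρ / 2 ^ (n + 1)) * kabs (x.1 - y.1)) := by
    intro x y
    have h := pow_le_exp (2 * τ + 1) (σ := ρ / 2 ^ (n + 2)) (by positivity)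
      (kabs_nonneg (x.1 - y.1))
    have h2 : Real.exp (ρ / 2 ^ (n + 2)) ≤ Real.exp ρ :=
      Real.exp_le_exp.2 (div_le_self hρ.le (one_le_pow₀ one_le_two))
    have e1 : (ρ / 2 + ρ / 2 ^ (n + 1)) * kabs (x.1 - y.1)
        = (ρ / 2 + ρ / 2 ^ (n + 2)) * kabs (x.1 - y.1) + ρ / 2 ^ (n + 2) * kabs (x.1 - y.1) := by
      field_simp; ring
    rw [e1, Real.exp_add]
    have e2 : c = (2 * τ + 1).factorial * Real.exp ρ / (ρ / 2 ^ (n + 2)) ^ (2 * τ + 1) / d ^ 2 := by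
      have a1 : ((2 : ℝ) ^ (2 * τ + 3)) ^ n = (2 ^ n) ^ (2 * τ + 1) * (2 ^ n) ^ 2 := by
        rw [← pow_mul, ← pow_mul, ← pow_mul, ← pow_add]; congr 1; ring
      rw [hc, hd, a1, pow_add 2 n 2, pow_add 2 n 1, div_pow ρ, mul_pow, div_pow 4]
      norm_num
      field_simp
    calc _ ≤ Real.exp ((ρ / 2 + ρ / 2 ^ (n + 2)) * kabs (x.1 - y.1))
        * (((2 * τ + 1).factorial * Real.exp ρ / (ρ / 2 ^ (n + 2)) ^ (2 * τ + 1)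
          * Real.exp (ρ / 2 ^ (n + 2) * kabs (x.1 - y.1))) / d ^ 2) := by
          gcongr
          refine h.trans ?_
          gcongr
      _ = _ := by rw [e2]; ring
  have hpos : ∀ x y, 0 < X x y := fun x y => zero_lt_one.trans_le (hX1 x y)
  have hg1 : ∀ ω ∈ S, ∀ x y, ‖divMult (freq mass ω) (z ω) x y‖ ≤ X x y ^ (2 * τ + 1) / d ^ 2 := by
    intro ω hω x y
    by_cases hxy : x = y
    · have := hpos x y
      simp only [divMult, if_pos hxy, norm_zero]; positivity
    · refine (b1 ω hω x y hxy).trans ?_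
      rw [inv_div]
      have h1 : X x y ^ τ ≤ X x y ^ (2 * τ + 1) := pow_le_pow_right₀ (hX1 x y) (by omega)
      have h2 : d ^ 2 ≤ d := by nlinarith
      have := hpos x y
      exact div_le_div₀ (by positivity) h1 (by positivity) h2
  have hg2 : ∀ ω ∈ S, ∀ ω' ∈ S, ∀ x y, ‖divMult (freq mass ω) (z ω) x y
      - divMult (freq mass ω') (z ω') x y‖ ≤ X x y ^ (2 * τ + 1) / d ^ 2 * dist ω ω' := by
    intro ω hω ω' hω' x y
    by_cases hxy : x = y
    · have := hpos x y
      simp only [divMult, if_pos hxy, sub_zero, norm_zero]; positivity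
    · refine (b2 ω hω ω' hω' x y hxy).trans ?_
      have := hpos x y
      calc _ ≤ X x y * dist ω ω' * ((d / X x y ^ τ)⁻¹ * (d / X x y ^ τ)⁻¹) := by
            gcongr; exact b1 ω hω x y hxy
        _ = _ := by rw [inv_div]; field_simp; ring
  refine ⟨fun ω hω x y => ?_, fun ω hω ω' hω' x y => ?_⟩
  · rw [← ofReal_norm]
    refine wt_mul_le hc0 (le_trans ?_ (hexp x y))
    gcongr
    exact hg1 ω hω x y
  · rw [← ofReal_norm, edist_dist, mul_right_comm (ENNReal.ofReal c)]
    calc _ ≤ wt w (ρ / 2 + ρ / 2 ^ (n + 2)) x y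
          * ENNReal.ofReal (X x y ^ (2 * τ + 1) / d ^ 2 * dist ω ω') := by
          gcongr; exact hg2 ω hω ω' hω' x y
      _ ≤ _ := by
        rw [ENNReal.ofReal_mul (by have := hpos x y; positivity), ← mul_assoc]
        exact mul_le_mul' (wt_mul_le hc0 (hexp x y)) le_rfl

/-- The multiplier of the first step, where the perturbation has no time average. -/
def divMult₀ (L : Idx ν → ℝ) (x y : Idx ν) : ℂ := if x.1 = y.1 then 0 else divMult L 0 x y

/-- Let a = ω·(k - l) and let b be the difference of the ±λ's. If |b| ≤ |a|/2, the divisor is at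
least |a|/2, hence of order M, which is more than needed. Otherwise |a| < 2|b| is at most a constant
times (1 + |m - n|) n, so this number is at least of order M up to a power of 1 + |k - l|. Taking
square roots, (1 + |m - n|) √n / √M is bounded below up to such a power, and multiplying the generic
small divisor bound by it gives the claim. This second case is why only M^{-1/2} is gained. -/
theorem divMult_first_le {mass δ g : ℝ} (hm : 0 ≤ mass) (hδ : 0 < δ) (hg : 0 < g) {τ₁ τ : ℕ}
    {M : ℝ} (hM : 1 ≤ M) {ω : EuclideanSpace ℝ (Fin ν)} {x y : Idx ν} (hxy1 : x.1 ≠ y.1)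
    (hωk : g * M ≤ |dotk ω (x.1 - y.1)| * (1 + kabs (x.1 - y.1)) ^ τ₁)
    (hb : ‖divMult (freq mass ω) 0 x y‖ ≤ (δ / (1 + kabs (x.1 - y.1)) ^ τ)⁻¹) :
    ‖divMult (freq mass ω) 0 x y‖ ≤ (2 * (4 * (1 + mass) / g + 1) / δ + 2 / g) / Real.sqrt M
      * ((1 + kabs (x.1 - y.1)) ^ (τ + τ₁)
        * ((1 + mdist x.2.2 y.2.2) * Real.sqrt y.2.2)) := by
  set A : ℝ := 4 * (1 + mass) / g with hA
  have hA0 : 0 < A := by positivity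
  set C₁ : ℝ := (2 * (A + 1) / δ + 2 / g) with hC₁
  have hC₁0 : 0 < C₁ := by positivity
  have hM0 : 0 < Real.sqrt M := Real.sqrt_pos.2 (by linarith)
  set X := 1 + kabs (x.1 - y.1) with hX
  have hX' : 1 ≤ X := by have := kabs_nonneg (x.1 - y.1); simp [hX, this]
  have hxy : x ≠ y := fun h => hxy1 (by rw [h])
  set a := dotk ω (x.1 - y.1) with ha
  set b := sg x.2.1 * eigB mass x.2.2 - sg y.2.1 * eigB mass y.2.2 with hbdef
  have hD : freq mass ω x - freq mass ω y = a + b := by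
    rw [ha, dotk_sub_right, hbdef]; unfold freq; ring
  have hl0 : (0 : ℝ) ≤ mdist x.2.2 y.2.2 := Nat.cast_nonneg _
  have hn1 := one_le_sqrt_pnat y.2.2
  have hXp : 0 < X := by linarith
  have hX0 : 0 < X ^ τ₁ := pow_pos hXp _
  have hg0 : ‖divMult (freq mass ω) 0 x y‖ = |a + b|⁻¹ := by
    rw [divMult, if_neg hxy, norm_neg, norm_inv, ← hD, ← Real.norm_eq_abs, ← Complex.norm_real]
    simp
  have hsM : Real.sqrt M * Real.sqrt M = M := Real.mul_self_sqrt (by linarith)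
  have hsM1 : 1 ≤ Real.sqrt M := Real.one_le_sqrt.2 hM
  have hprod : 1 ≤ (1 + (mdist x.2.2 y.2.2 : ℝ)) * Real.sqrt y.2.2 := by nlinarith
  rcases le_or_gt |b| (|a| / 2) with hcase | hcase
  · have h1 : g * M / (2 * X ^ τ₁) ≤ |a + b| := by
      rw [div_le_iff₀ (by positivity)]
      have h2 : |a| / 2 ≤ |a + b| := by
        have := abs_sub_abs_le_abs_sub a (-b)
        rw [abs_neg, sub_neg_eq_add] at this
        linarith
      calc g * M ≤ |a| * X ^ τ₁ := hωk
        _ = |a| / 2 * (2 * X ^ τ₁) := by ring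
        _ ≤ _ := by gcongr
    rw [hg0]
    have hM1 : (0 : ℝ) < M := by linarith
    calc |a + b|⁻¹ ≤ (g * M / (2 * X ^ τ₁))⁻¹ := inv_anti₀ (by positivity) h1
      _ = 2 / g * X ^ τ₁ / M := by rw [inv_div]; field_simp
      _ ≤ C₁ * X ^ (τ + τ₁) / Real.sqrt M := by
          have h3 : Real.sqrt M ≤ M := by nlinarith
          have h4 : X ^ τ₁ ≤ X ^ (τ + τ₁) := pow_le_pow_right₀ hX' (by omega)
          have h5 : 2 / g ≤ C₁ := by rw [hC₁]; linarith [show 0 < 2 * (A + 1) / δ by positivity]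
          exact div_le_div₀ (by positivity) (mul_le_mul h5 h4 (by positivity) hC₁0.le) hM0 h3
      _ = C₁ / Real.sqrt M * (X ^ (τ + τ₁) * 1) := by ring
      _ ≤ _ := by gcongr
  · -- here `y` is a high mode
    have h1 : |b| ≤ 2 * (1 + mass) * ((1 + mdist x.2.2 y.2.2) * y.2.2) := by
      have h2 : |b| ≤ eigB mass x.2.2 + eigB mass y.2.2 := by
        refine (abs_sub _ _).trans ?_
        rw [abs_mul, abs_mul, abs_sg, abs_sg, one_mul, one_mul, abs_of_nonneg (eigB_nonneg _ _),
          abs_of_nonneg (eigB_nonneg _ _)]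
      have h3 : (x.2.2 : ℝ) ≤ y.2.2 + mdist x.2.2 y.2.2 := by
        have : (x.2.2 : ℕ) ≤ y.2.2 + mdist x.2.2 y.2.2 := by unfold mdist; omega
        exact_mod_cast this
      have h4 := eigB_le hm x.2.2
      have h5 := eigB_le hm y.2.2
      have h6 := one_le_pnat y.2.2
      have h7 := one_le_pnat x.2.2
      have h8 : (mdist x.2.2 y.2.2 : ℝ) ≤ mdist x.2.2 y.2.2 * y.2.2 := le_mul_of_one_le_right hl0 h6
      have h9 : mass ≤ mass * ((1 + mdist x.2.2 y.2.2) * y.2.2) :=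
        le_mul_of_one_le_right hm (one_le_mul_of_one_le_of_one_le (by linarith) h6)
      have e : 2 * (1 + mass) * ((1 + (mdist x.2.2 y.2.2 : ℝ)) * y.2.2)
          = 2 * (y.2.2 + mdist x.2.2 y.2.2 * y.2.2)
            + 2 * (mass * ((1 + mdist x.2.2 y.2.2) * y.2.2)) := by ring
      rw [e]
      linarith
    set u : ℝ := (1 + mdist x.2.2 y.2.2) * y.2.2 with hu
    have hu1 : 1 ≤ u := by nlinarith [one_le_pnat y.2.2]
    have h2 : M ≤ A * X ^ τ₁ * u := by
      have h3 : g * M ≤ 4 * (1 + mass) * u * X ^ τ₁ := by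
        refine hωk.trans ?_
        gcongr
        linarith
      rw [hA, div_mul_eq_mul_div, div_mul_eq_mul_div, le_div_iff₀ hg]
      linarith
    have h3 : Real.sqrt M ≤ (A + 1) * X ^ τ₁ * ((1 + mdist x.2.2 y.2.2) * Real.sqrt y.2.2) := by
      refine Real.sqrt_le_iff.2 ⟨by positivity, h2.trans ?_⟩
      have e : ((A + 1) * X ^ τ₁ * ((1 + mdist x.2.2 y.2.2) * Real.sqrt y.2.2)) ^ 2
          = (A + 1) ^ 2 * (X ^ τ₁) ^ 2 * ((1 + mdist x.2.2 y.2.2) * u) := by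
        rw [hu, mul_pow, mul_pow, mul_pow (1 + (mdist x.2.2 y.2.2 : ℝ)),
          Real.sq_sqrt (by positivity)]; ring
      rw [e]
      have hX3 : 1 ≤ X ^ τ₁ := one_le_pow₀ hX'
      have hX2 : X ^ τ₁ ≤ (X ^ τ₁) ^ 2 := le_self_pow₀ hX3 two_ne_zero
      have hA2 : A ≤ (A + 1) ^ 2 := by nlinarith
      have hu2 : u ≤ (1 + mdist x.2.2 y.2.2) * u :=
        le_mul_of_one_le_left (by linarith) (by linarith)
      exact mul_le_mul (mul_le_mul hA2 hX2 (by linarith) (by positivity)) hu2 (by linarith)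
        (by positivity)
    have h4 := hb
    rw [inv_div] at h4
    refine h4.trans ?_
    calc X ^ τ / δ = X ^ τ / δ * Real.sqrt M / Real.sqrt M := by field_simp
      _ ≤ X ^ τ / δ * ((A + 1) * X ^ τ₁ * ((1 + mdist x.2.2 y.2.2) * Real.sqrt y.2.2))
          / Real.sqrt M := by gcongr
      _ = (A + 1) / δ / Real.sqrt M
          * (X ^ (τ + τ₁) * ((1 + mdist x.2.2 y.2.2) * Real.sqrt y.2.2)) := by
          rw [pow_add]; ring
      _ ≤ _ := by
          have h5 : (A + 1) / δ ≤ C₁ := by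
            rw [hC₁]
            have e : 2 * (A + 1) / δ = 2 * ((A + 1) / δ) := by ring
            have : 0 < (A + 1) / δ := by positivity
            have : 0 < 2 / g := by positivity
            rw [e]; linarith
          gcongr

/-- The multiplier bounds in the first step: the fast driving makes the generator small. -/
theorem multBound_first {w : ℕ → ℝ≥0∞} {mass ρ δ g : ℝ} (hm : 0 ≤ mass) (hρ : 0 < ρ) (hδ : 0 < δ)
    (hδ1 : δ ≤ 1) (hg : 0 < g) (τ₁ τ : ℕ) : ∃ C > 0, ∀ M ≥ 1, ∀ P₀ : Op (Idx ν),
    MultBound (goodSet mass P₀ g δ τ₁ τ M 0) (ENNReal.ofReal (C / Real.sqrt M))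
      (wtBig w ρ) (wt w ρ) fun ω => divMult₀ (freq mass ω) := by
  set A : ℝ := 4 * (1 + mass) / g with hA
  have hA0 : 0 < A := by positivity
  set C₁ : ℝ := (2 * (A + 1) / δ + 2 / g) with hC₁
  have hC₁0 : 0 < C₁ := by positivity
  -- The improved bound for one inverse divisor costs τ + τ₁ powers, the generic bound for the other
  -- costs τ, and the Lipschitz constant of the frequencies costs 1.
  set q := 2 * τ + τ₁ + 1 with hq
  set C : ℝ := C₁ / δ * (q.factorial * Real.exp ρ / ρ ^ q) with hC
  refine ⟨C, by positivity, fun M hM P₀ => ?_⟩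
  have hM0 : 0 < Real.sqrt M := Real.sqrt_pos.2 (by linarith)
  set S := goodSet mass P₀ g δ τ₁ τ M 0 with hSdef
  set X : Idx ν → Idx ν → ℝ := fun x y => 1 + kabs (x.1 - y.1) with hX
  have hX1 : ∀ x y, 1 ≤ X x y := fun x y => by have := kabs_nonneg (x.1 - y.1); simp [hX, this]
  have hpos : ∀ x y, 0 < X x y := fun x y => zero_lt_one.trans_le (hX1 x y)
  obtain ⟨b1, b2⟩ := divMult_bounds (L := fun ω => freq mass ω) (z := fun _ => (0 : Idx ν → ℂ))
    (S := S) (B := X) (d := fun x y => δ / X x y ^ τ)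
    (fun x y _ => div_pos hδ (pow_pos (hpos x y) τ))
    (fun ω hω x y hxy => by
      rw [div_le_iff₀ (pow_pos (hpos x y) τ)]
      have := hω.2.2.2 x y hxy
      rw [← Real.norm_eq_abs, ← Complex.norm_real] at this
      simpa using this)
    (fun ω hω ω' hω' x y hxy => by
      have e : ((freq mass ω x + (0 : Idx ν → ℂ) x - (freq mass ω y + (0 : Idx ν → ℂ) y) : ℂ)
          - (freq mass ω' x + (0 : Idx ν → ℂ) x - (freq mass ω' y + (0 : Idx ν → ℂ) y)))
          = (((freq mass ω x - freq mass ω y) - (freq mass ω' x - freq mass ω' y) : ℝ) : ℂ) := by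
        push_cast; simp
      rw [e, Complex.norm_real]
      refine (freq_sub_lipschitz mass ω ω' x y).trans ?_
      gcongr
      simp [hX])
  have hmain : ∀ ω ∈ S, ∀ x y, x.1 ≠ y.1 → ‖divMult (freq mass ω) 0 x y‖
      ≤ C₁ / Real.sqrt M * (X x y ^ (τ + τ₁) * ((1 + mdist x.2.2 y.2.2) * Real.sqrt y.2.2)) :=
    fun ω hω x y hxy => divMult_first_le hm hδ hg hM hxy (hω.2.1 _ (sub_ne_zero.2 hxy))
      (b1 ω hω x y fun h => hxy (by rw [h]))
  have hfin : ∀ x y : Idx ν, C₁ / Real.sqrt M * (X x y ^ (τ + τ₁)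
        * ((1 + mdist x.2.2 y.2.2) * Real.sqrt y.2.2)) * (X x y ^ (τ + 1) / δ)
      ≤ C / Real.sqrt M * (Real.exp (ρ * kabs (x.1 - y.1))
        * ((1 + mdist x.2.2 y.2.2) * Real.sqrt y.2.2)) := by
    intro x y
    have h := pow_le_exp q hρ (kabs_nonneg (x.1 - y.1))
    have e : X x y ^ (τ + τ₁) * X x y ^ (τ + 1) = X x y ^ q := by rw [← pow_add]; congr 1; omega
    calc _ = C₁ / δ * (X x y ^ (τ + τ₁) * X x y ^ (τ + 1)) / Real.sqrt M
          * ((1 + mdist x.2.2 y.2.2) * Real.sqrt y.2.2) := by ring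
      _ = C₁ / δ * X x y ^ q / Real.sqrt M
          * ((1 + mdist x.2.2 y.2.2) * Real.sqrt y.2.2) := by rw [e]
      _ ≤ C₁ / δ * ((q.factorial * Real.exp ρ / ρ ^ q) * Real.exp (ρ * kabs (x.1 - y.1)))
          / Real.sqrt M * ((1 + mdist x.2.2 y.2.2) * Real.sqrt y.2.2) := by gcongr
      _ = _ := by rw [hC]; ring
  have hone : ∀ x y : Idx ν, 1 ≤ X x y ^ (τ + 1) / δ := fun x y => by
    rw [le_div_iff₀ hδ, one_mul]; exact hδ1.trans (one_le_pow₀ (hX1 x y))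
  have hC0 : 0 ≤ C / Real.sqrt M := by positivity
  have hbd : ∀ ω ∈ S, ∀ x y, ‖divMult₀ (freq mass ω) x y‖ ≤ C / Real.sqrt M
      * (Real.exp (ρ * kabs (x.1 - y.1)) * ((1 + mdist x.2.2 y.2.2) * Real.sqrt y.2.2)) := by
    intro ω hω x y
    unfold divMult₀
    split_ifs with h
    · rw [norm_zero]; positivity
    · refine (hmain ω hω x y h).trans (le_trans ?_ (hfin x y))
      exact le_mul_of_one_le_right (by have := hpos x y; positivity) (hone x y)
  have hlip : ∀ ω ∈ S, ∀ ω' ∈ S, ∀ x y, ‖divMult₀ (freq mass ω) x y - divMult₀ (freq mass ω') x y‖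
      ≤ C / Real.sqrt M * (Real.exp (ρ * kabs (x.1 - y.1))
        * ((1 + mdist x.2.2 y.2.2) * Real.sqrt y.2.2)) * dist ω ω' := by
    intro ω hω ω' hω' x y
    unfold divMult₀
    split_ifs with h
    · rw [sub_zero, norm_zero]; positivity
    · have hxy : x ≠ y := fun h' => h (by rw [h'])
      refine (b2 ω hω ω' hω' x y hxy).trans ?_
      refine le_trans ?_ (mul_le_mul_of_nonneg_right (hfin x y) dist_nonneg)
      have := hpos x y
      calc X x y * dist ω ω' * (‖divMult (freq mass ω) 0 x y‖ * (δ / X x y ^ τ)⁻¹)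
          = ‖divMult (freq mass ω) 0 x y‖ * (X x y ^ (τ + 1) / δ) * dist ω ω' := by
            rw [inv_div, pow_succ]; ring
        _ ≤ _ := by gcongr; exact hmain ω hω x y h
  refine ⟨fun ω hω x y => ?_, fun ω hω ω' hω' x y => ?_⟩
  · rw [← ofReal_norm]
    exact wt_mul_le_wtBig hC0 (hbd ω hω x y)
  · rw [← ofReal_norm, edist_dist, mul_right_comm (ENNReal.ofReal _)]
    calc _ ≤ wt w ρ x y * ENNReal.ofReal (C / Real.sqrt M * (Real.exp (ρ * kabs (x.1 - y.1))
          * ((1 + mdist x.2.2 y.2.2) * Real.sqrt y.2.2)) * dist ω ω') := by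
          gcongr; exact hlip ω hω ω' hω' x y
      _ ≤ _ := by
        rw [ENNReal.ofReal_mul (by positivity), ← mul_assoc]
        exact mul_le_mul' (wt_mul_le_wtBig hC0 le_rfl) le_rfl

end Nonresonance


/-! ### Convergence of the iteration for nonresonant frequencies -/

section Reducibility

variable {ν : ℕ}

theorem tsum_ofReal_geometric_le {f : ℕ → ℝ} {e : ℝ} (he : 0 ≤ e)
    (h : ∀ n, f n ≤ e * (1 / 2) ^ n) : ∑' n, ENNReal.ofReal (f n) ≤ ENNReal.ofReal (2 * e) := by
  refine (ENNReal.tsum_le_tsum fun n => ENNReal.ofReal_le_ofReal (h n)).trans ?_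
  rw [← ENNReal.ofReal_tsum_of_nonneg (fun n => by positivity)
    ((summable_geometric_two).mul_left e), tsum_mul_left, tsum_geometric_two, mul_comm]

theorem two_mul_ofReal (x : ℝ) : 2 * ENNReal.ofReal x = ENNReal.ofReal (2 * x) := by
  rw [ENNReal.ofReal_mul (by norm_num)]; simp

theorem homSol_zero_eq {mass : ℝ} {ω : EuclideanSpace ℝ (Fin ν)} {P₀ : Op (Idx ν)}
    (h0 : ∀ x y : Idx ν, x.1 = y.1 → entry P₀ x y = 0) :
    homSol (freq mass ω) 0 P₀ = ofMat fun x y => divMult₀ (freq mass ω) x y * entry P₀ x y := by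
  rw [homSol_eq]
  congr; ext x y
  unfold divMult₀
  split_ifs with h
  · rw [h0 x y h, mul_zero, mul_zero]
  · rfl

/-- The shift of the Fourier index by `κ`. -/
def shift (κ : Fin ν → ℤ) : Equiv.Perm (Idx ν) := (Equiv.addRight κ).prodCongr (Equiv.refl _)

theorem shift_apply (κ : Fin ν → ℤ) (x : Idx ν) : shift κ x = (x.1 + κ, x.2) := rfl

theorem freq_shift (mass : ℝ) (ω : EuclideanSpace ℝ (Fin ν)) (κ : Fin ν → ℤ) (x y : Idx ν) :
    freq mass ω (shift κ x) - freq mass ω (shift κ y) = freq mass ω x - freq mass ω y := by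
  simp only [freq, shift_apply, dotk_add_right]; ring

set_option maxHeartbeats 1000000 in
/-- Reducibility for nonresonant frequencies, with the bounds on the corrections to the Floquet
exponents that enter the measure estimates. -/
theorem reducibility {w : ℕ → ℝ≥0∞} (hw : IsNatWeight w) {mass ρ δ g η p : ℝ} (hm : 0 ≤ mass)
    (hρ : 0 < ρ) (hδ : 0 < δ) (hδ1 : δ ≤ 1) (hg : 0 < g) (hη : 0 < η) (hp : 0 < p) (τ₁ τ : ℕ) :
    ∃ M₁ ≥ 1, ∃ C > 0, ∀ M ≥ M₁, ∀ P₀ : Op (Idx ν), wnorm (wtBig w ρ) P₀ ≤ ENNReal.ofReal p →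
      (∀ x y : Idx ν, x.1 = y.1 → entry P₀ x y = 0) →
      (∀ n, ∀ ω ∈ goodSet mass P₀ g δ τ₁ τ M n, ∀ x : Idx ν,
        Real.sqrt x.2.2 * ‖(kamState (freq mass ω) P₀ (n + 1)).1 x‖ ≤ η) ∧
      (∀ n, ∀ ω ∈ goodSet mass P₀ g δ τ₁ τ M n, ∀ ω' ∈ goodSet mass P₀ g δ τ₁ τ M n,
        ∀ x : Idx ν, ‖(kamState (freq mass ω) P₀ (n + 1)).1 x
          - (kamState (freq mass ω') P₀ (n + 1)).1 x‖ ≤ η * dist ω ω') ∧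
      (∀ n, ∀ ω ∈ goodSet mass P₀ g δ τ₁ τ M n, ∀ κ, Inv (shift κ) P₀ → ∀ x,
        (kamState (freq mass ω) P₀ (n + 1)).1 (shift κ x) = (kamState (freq mass ω) P₀ (n + 1)).1 x) ∧
      ∀ ω, (∀ n, ω ∈ goodSet mass P₀ g δ τ₁ τ M n) → ∃ (Y : Op (Idx ν)) (z : Idx ν → ℂ),
        wnorm (wt w (ρ / 2)) Y ≤ ENNReal.ofReal (C / Real.sqrt M) ∧
        wnorm (wt w (ρ / 2)) Y ≤ 1 / 2 ∧
        Conj (freq mass ω) P₀ (1 + Y) z 0 ∧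
        ∀ κ, Inv (shift κ) P₀ → Inv (shift κ) Y ∧ ∀ x, z (shift κ x) = z x := by
  obtain ⟨C₀, hC₀, hfirst⟩ := multBound_first (ν := ν) (w := w) hm hρ hδ hδ1 hg τ₁ τ
  set κ : ℝ := (2 * τ + 1).factorial * Real.exp ρ * (4 / ρ) ^ (2 * τ + 1) * (2 / δ) ^ 2 with hκ
  have hκ0 : 0 < κ := by positivity
  set B : ℝ := 2 ^ (2 * τ + 3) with hB
  have hB2 : 2 ≤ B := le_self_pow₀ one_le_two (by omega)
  have hB0 : 0 < B := by linarith
  set E : ℝ := 32 * C₀ * p ^ 2 with hE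
  have hE0 : 0 < E := by positivity
  -- Each summand turns √M ≥ T into one smallness condition: the first generator is at most 1/8
  -- (`c1`), the induction closes (`c2`), the corrections are 1/2-Lipschitz (`c3`), and they are
  -- bounded by η (`c4`).
  set T : ℝ := 1 + 16 * C₀ * p + 32 * κ * E * B ^ 2 + 4 * E + 2 * E / η with hT
  have hT1 : 1 ≤ T := by
    have : 0 < 16 * C₀ * p + 32 * κ * E * B ^ 2 + 4 * E + 2 * E / η := by positivity
    rw [hT]; linarith
  refine ⟨T ^ 2, one_le_pow₀ hT1, 2 * (2 * C₀ * p + 4 * κ * E), by positivity, fun M hM P₀ hP h0 => ?_⟩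
  have hsM : T ≤ Real.sqrt M := Real.le_sqrt_of_sq_le hM
  have hs0 : 0 < Real.sqrt M := by linarith
  have hM1 : 1 ≤ M := (one_le_pow₀ hT1).trans hM
  set χ : ℝ := 2 * (C₀ / Real.sqrt M * p) with hχ
  set e : ℝ := 16 * (p * χ) with he
  have hχ0 : 0 < χ := by positivity
  have he0 : 0 < e := by positivity
  have heE : e = E / Real.sqrt M := by rw [he, hχ, hE]; ring
  have hdivle : ∀ a b : ℝ, 0 < b → a / b ≤ T → a / Real.sqrt M ≤ b := fun a b hb h => by
    rw [div_le_iff₀ hs0]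
    rw [div_le_iff₀ hb] at h
    nlinarith
  have p1 : 0 < 16 * C₀ * p := by positivity
  have p2 : 0 < 32 * κ * E * B ^ 2 := by positivity
  have p3 : 0 < 2 * E / η := by positivity
  have c1 : χ ≤ 1 / 8 := by
    have := hdivle (2 * C₀ * p) (1 / 8) (by norm_num) (by
      rw [show 2 * C₀ * p / (1 / 8) = 16 * C₀ * p by ring, hT]; linarith)
    calc χ = 2 * C₀ * p / Real.sqrt M := by rw [hχ]; ring
      _ ≤ _ := this
  have c2 : 32 * κ * e * B ^ 2 ≤ 1 := by
    have := hdivle (32 * κ * E * B ^ 2) 1 (by norm_num) (by rw [div_one, hT]; linarith)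
    calc _ = 32 * κ * E * B ^ 2 / Real.sqrt M := by rw [heE]; ring
      _ ≤ _ := this
  have c3 : 2 * e ≤ 1 / 2 := by
    have := hdivle (2 * E) (1 / 2) (by norm_num) (by
      rw [show 2 * E / (1 / 2) = 4 * E by ring, hT]; linarith)
    calc _ = 2 * E / Real.sqrt M := by rw [heE]; ring
      _ ≤ _ := this
  have c4 : 2 * e ≤ η := by
    have := hdivle (2 * E) η hη (by rw [hT]; linarith)
    calc _ = 2 * E / Real.sqrt M := by rw [heE]; ring
      _ ≤ _ := this
  have c5 : 32 * κ * e ≤ 1 / B ^ 2 := by rw [le_div_iff₀ (by positivity)]; exact c2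
  have hB4 : 1 / B ^ 2 ≤ 1 := by rw [div_le_one (by positivity)]; nlinarith
  have hBh : ∀ n : ℕ, (1 / B) ^ n ≤ (1 / 2 : ℝ) ^ n := fun n =>
    pow_le_pow_left₀ (by positivity) (one_div_le_one_div_of_le two_pos hB2) n
  have hBh2 : ∀ n : ℕ, (1 / B ^ 2) ^ n ≤ (1 / 2 : ℝ) ^ n := fun n =>
    pow_le_pow_left₀ (by positivity) (one_div_le_one_div_of_le two_pos (by nlinarith)) n
  have hB1 : ∀ n : ℕ, (1 / B) ^ n ≤ 1 := fun n =>
    pow_le_one₀ (by positivity) (by rw [div_le_one hB0]; linarith)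
  -- Geometric decay is enough: the multipliers grow like B^n, so with ε_n of order B^{-2n} the
  -- generators are of order B^{-n}. The quadratic remainder is then of order B^{-3n}, and `c2`
  -- places it below ε_{n+1}.
  set ε : ℕ → ℝ≥0∞ := fun n => ENNReal.ofReal (e * (1 / B ^ 2) ^ n) with hεdef
  set c : ℕ → ℝ≥0∞ := fun n => ENNReal.ofReal (κ * B ^ n) with hcdef
  have hcε : ∀ n, 2 * (c n * ε n) = ENNReal.ofReal (2 * (κ * e) * (1 / B) ^ n) := by
    intro n
    simp only [hcdef, hεdef]
    rw [← ENNReal.ofReal_mul (by positivity), two_mul_ofReal]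
    congr 1
    rw [div_pow, div_pow, one_pow]
    field_simp
    ring_nf
  have hεsum : ∑' n, ε n ≤ ENNReal.ofReal (2 * e) :=
    tsum_ofReal_geometric_le he0.le fun n => mul_le_mul_of_nonneg_left (hBh2 n) he0.le
  set S := goodSet mass P₀ g δ τ₁ τ M with hSdef
  set W : ℕ → Idx ν → Idx ν → ℝ≥0∞ := fun n => wt w (ρ / 2 + ρ / 2 ^ (n + 1)) with hWdef
  have hρn : ∀ n : ℕ, 0 ≤ ρ / 2 + ρ / 2 ^ (n + 1) := fun n => by positivity
  have hW : ∀ n, IsWeight (W n) := fun n => isWeight_wt hw (hρn n)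
  have hWm : ∀ n x y, W (n + 1) x y ≤ W n x y := fun n x y => by
    refine wt_mono w (add_le_add le_rfl ?_) x y
    exact div_le_div_of_nonneg_left hρ.le (by positivity)
      (pow_le_pow_right₀ one_le_two (Nat.le_succ _))
  have hW0 : W 0 = wt w ρ := by simp only [hWdef, zero_add, pow_one, add_halves]
  have hWi : ∀ n x y, wt w (ρ / 2) x y ≤ W n x y := fun n x y =>
    wt_mono w (by have : 0 < ρ / 2 ^ (n + 1) := by positivity
                  linarith) x y
  have hfst := hfirst M hM1 P₀
  have hctop : ENNReal.ofReal (C₀ / Real.sqrt M) * ENNReal.ofReal p ≠ ∞ :=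
    ENNReal.mul_ne_top ENNReal.ofReal_ne_top ENNReal.ofReal_ne_top
  obtain ⟨f1, f2⟩ := LipBound.ofMat_mul (S := S 0) (isWeight_wt hw hρ.le).one_le
    (LipBound.const hP) hfst hctop
  simp only [← homSol_zero_eq h0] at f1 f2
  have hχE : 2 * (ENNReal.ofReal (C₀ / Real.sqrt M) * ENNReal.ofReal p) = ENNReal.ofReal χ := by
    rw [← ENNReal.ofReal_mul (by positivity), two_mul_ofReal]
  rw [hχE] at f2
  have half : (1 / 2 : ℝ≥0∞) = ENNReal.ofReal (1 / 2) := by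
    rw [ENNReal.ofReal_div_of_pos two_pos]; simp
  have quarter : (1 / 4 : ℝ≥0∞) = ENNReal.ofReal (1 / 4) := by
    rw [ENNReal.ofReal_div_of_pos (by norm_num)]; simp
  have est := kam_estimates (L := fun ω => freq mass ω) (P₀ := P₀) (S := S) (W := W)
    (V := fun x => ENNReal.ofReal (Real.sqrt x.2.2)) (c := c) (ε := ε) (p := ENNReal.ofReal p)
    (χ₀ := ENNReal.ofReal χ) (fun n ω hω => hω.1) hW hWm
    (fun n x => by
      have : 1 ≤ ENNReal.ofReal (Real.exp ((ρ / 2 + ρ / 2 ^ (n + 1)) * kabs (x.1 - x.1)))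
          * w (mdist x.2.2 x.2.2) := one_le_mul (by
            rw [sub_self, kabs_zero, mul_zero, Real.exp_zero, ENNReal.ofReal_one]) (hw.one_le _)
      exact le_mul_of_one_le_left' this)
    (fun x => h0 x x rfl)
    ((wnorm_mono (fun x y => by rw [hW0]; exact wt_le_wtBig w hρ.le x y) _).trans hP)
    (by rw [half]; exact ENNReal.ofReal_le_ofReal (by linarith))
    (by rw [hW0]; exact f2)
    (by
      simp only [hεdef, pow_zero, mul_one, he]
      rw [← ENNReal.ofReal_mul hp.le, ENNReal.ofReal_mul (by norm_num : (0 : ℝ) ≤ 16)]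
      simp)
    (fun n => by
      rw [hcε, half]
      refine ENNReal.ofReal_le_ofReal ?_
      have := hB1 n
      have : 2 * (κ * e) * (1 / B) ^ n ≤ 2 * (κ * e) := mul_le_of_le_one_right (by positivity) this
      linarith)
    (fun n => by
      rw [hcε]
      simp only [hεdef]
      rw [← ENNReal.ofReal_mul (by positivity), show (16 : ℝ≥0∞) = ENNReal.ofReal 16 by simp,
        ← ENNReal.ofReal_mul (by norm_num)]
      refine ENNReal.ofReal_le_ofReal ?_
      have h1 : (1 / B) ^ n * (32 * κ * e) ≤ 1 * (1 / B ^ 2) :=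
        mul_le_mul (hB1 n) c5 (by positivity) zero_le_one
      calc _ = e * (1 / B ^ 2) ^ n * ((1 / B) ^ n * (32 * κ * e)) := by ring
        _ ≤ e * (1 / B ^ 2) ^ n * (1 * (1 / B ^ 2)) := by gcongr
        _ = _ := by ring)
    (fun n hz => by
      have := multBound_step (w := w) (mass := mass) hρ hδ hδ1 τ n (S := S (n + 1))
        (z := fun ω => (kamState (freq mass ω) P₀ (n + 1)).1) (fun ω hω => hω.2)
        (fun ω hω ω' hω' x => by
          have h1 := (hz ω hω.1 ω' hω'.1 x).trans (mul_le_mul' hεsum le_rfl)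
          rw [edist_dist, ← ENNReal.ofReal_mul (by positivity), ← ofReal_norm] at h1
          rw [ENNReal.ofReal_le_ofReal_iff (by positivity)] at h1
          exact h1.trans (by gcongr))
      exact this)
  have hreal : ∀ n, ∑ m ∈ Finset.range n, ε m ≤ ENNReal.ofReal η := fun n =>
    (ENNReal.sum_le_tsum _).trans (hεsum.trans (ENNReal.ofReal_le_ofReal c4))
  have hE0 : ∀ ω ∈ S 0, ∀ x y, entry (kamGen (freq mass ω) P₀ 0) x y = if x = y then 0 else
      -(freq mass ω x + (kamState (freq mass ω) P₀ 0).1 x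
        - (freq mass ω y + (kamState (freq mass ω) P₀ 0).1 y))⁻¹
        * entry (kamState (freq mass ω) P₀ 0).2 x y := by
    intro ω hω x y
    refine (f1 ω hω x y).trans ?_
    unfold divMult₀ divMult
    by_cases hxy : x.1 = y.1
    · rw [h0 x y hxy, if_pos hxy]; simp [kamState, h0 x y hxy]
    · rw [if_neg hxy]; split_ifs <;> simp [kamState]
  have hE1 : ∀ n, ∀ ω ∈ S (n + 1), ∀ x y, entry (kamGen (freq mass ω) P₀ (n + 1)) x y
      = if x = y then 0 else
      -(freq mass ω x + (kamState (freq mass ω) P₀ (n + 1)).1 x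
        - (freq mass ω y + (kamState (freq mass ω) P₀ (n + 1)).1 y))⁻¹
        * entry (kamState (freq mass ω) P₀ (n + 1)).2 x y := by
    intro n ω hω x y
    refine ((est n).2.2.2.1 ω hω x y).trans ?_
    unfold divMult
    split_ifs <;> simp
  have hcεh : ∀ n, 2 * (c n * ε n) ≤ 1 / 2 := fun n => by
    rw [hcε, half]
    refine ENNReal.ofReal_le_ofReal ?_
    have : 2 * (κ * e) * (1 / B) ^ n ≤ 2 * (κ * e) :=
      mul_le_of_le_one_right (by positivity) (hB1 n)
    linarith
  have hinv : ∀ κ, Inv (shift κ) P₀ → ∀ n, ∀ ω ∈ S n,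
      (∀ x, (kamState (freq mass ω) P₀ (n + 1)).1 (shift κ x)
        = (kamState (freq mass ω) P₀ (n + 1)).1 x) ∧
      Inv (shift κ) (kamState (freq mass ω) P₀ (n + 1)).2 := by
    intro κ' hκ' n
    induction n with
    | zero =>
      intro ω hω
      exact (kamState_inv_step (isWeight_wt hw hρ.le) (freq_shift mass ω κ') (n := 0)
        ((f2.bound ω hω).trans (by rw [half]; exact ENNReal.ofReal_le_ofReal (by linarith)))
        (hE0 ω hω) (fun _ => rfl) hκ').2
    | succ n ih =>
      intro ω hω
      obtain ⟨i1, i2⟩ := ih ω hω.1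
      exact (kamState_inv_step (hW (n + 1)) (freq_shift mass ω κ') (n := n + 1)
        (((est n).2.2.2.2.bound ω hω).trans (hcεh n)) (hE1 n ω hω) i1 i2).2
  refine ⟨fun n ω hω x => ?_, fun n ω hω ω' hω' x => ?_, fun n ω hω κ' hκ' =>
    (hinv κ' hκ' n ω hω).1, fun ω hω => ?_⟩
  · have h1 := ((est n).2.1 ω hω x).trans (hreal n)
    rw [← ofReal_norm, ← ENNReal.ofReal_mul (Real.sqrt_nonneg _),
      ENNReal.ofReal_le_ofReal_iff hη.le] at h1
    exact h1
  · have h1 := ((est n).2.2.1 ω hω ω' hω' x).trans (mul_le_mul' (hreal n) le_rfl)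
    rw [edist_dist, ← ENNReal.ofReal_mul hη.le, ← ofReal_norm,
      ENNReal.ofReal_le_ofReal_iff (by positivity)] at h1
    exact h1
  · set X : ℕ → ℝ≥0∞ := fun n => Nat.casesOn n (ENNReal.ofReal χ) fun n => 2 * (c n * ε n) with hX
    have hXsum : ∑' n, X n ≤ ENNReal.ofReal (χ + 4 * (κ * e)) := by
      rw [tsum_eq_zero_add' ENNReal.summable, ENNReal.ofReal_add hχ0.le (by positivity)]
      refine add_le_add le_rfl ?_
      simp only [hX, hcε]
      refine (tsum_ofReal_geometric_le (e := 2 * (κ * e)) (by positivity) fun n =>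
        mul_le_mul_of_nonneg_left (hBh n) (by positivity)).trans (le_of_eq (by ring_nf))
    have hX4 : χ + 4 * (κ * e) ≤ 1 / 4 := by linarith
    have hdeltan : ∀ n, (0 : ℝ) < δ / 2 ^ n := fun n => by positivity
    have hDne : ∀ n (x y : Idx ν), x ≠ y → ((freq mass ω x : ℂ) + (kamState (freq mass ω) P₀ n).1 x
        - (freq mass ω y + (kamState (freq mass ω) P₀ n).1 y)) ≠ 0 := by
      intro n x y hxy h
      cases n with
      | zero =>
        have h1 := (hω 0).2.2.2 x y hxy
        simp only [kamState, Pi.zero_apply, add_zero] at h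
        have h2 : freq mass ω x - freq mass ω y = 0 := by exact_mod_cast h
        rw [h2, abs_zero, zero_mul] at h1
        linarith
      | succ n =>
        have h1 := (hω (n + 1)).2 x y hxy
        rw [h, norm_zero, zero_mul] at h1
        exact absurd h1 (not_le.2 (hdeltan _))
    -- The widths ρ/2 + ρ/2^{n+1} never fall below ρ/2, so all steps are compared in the single
    -- weight of width ρ/2.
    obtain ⟨Y, z, y1, y2, -, y4⟩ := exists_conj_of_summable (W := wt w (ρ / 2))
      (isWeight_wt hw (by positivity)) (L := freq mass ω) (P₀ := P₀) (χ := X)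
      (ε := fun n => Nat.casesOn n (ENNReal.ofReal p) ε)
      (hXsum.trans (by rw [quarter]; exact ENNReal.ofReal_le_ofReal hX4))
      (by
        rw [tsum_eq_zero_add' ENNReal.summable]
        exact ENNReal.add_ne_top.2 ⟨ENNReal.ofReal_ne_top,
          ne_top_of_le_ne_top ENNReal.ofReal_ne_top hεsum⟩)
      (fun n => by
        cases n with
        | zero => exact (wnorm_mono (wt_mono w (by linarith)) _).trans (f2.bound ω (hω 0))
        | succ n => exact (wnorm_mono (hWi (n + 1)) _).trans ((est n).2.2.2.2.bound ω (hω (n + 1))))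
      (fun n => by
        cases n with
        | zero =>
          exact (wnorm_mono (fun x y => (wt_mono w (by linarith) x y).trans
            (wt_le_wtBig w hρ.le x y)) _).trans hP
        | succ n => exact (wnorm_mono (hWi n) _).trans ((est n).1.bound ω (hω n)))
      hDne
      (fun n x y => by
        cases n with
        | zero =>
          exact hE0 ω (hω 0) x y
        | succ n => exact hE1 n ω (hω (n + 1)) x y)
    have y1' := y1.trans (mul_le_mul' le_rfl hXsum)
    rw [two_mul_ofReal] at y1'
    refine ⟨Y, z, y1'.trans (ENNReal.ofReal_le_ofReal (le_of_eq ?_)),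
      y1'.trans (by rw [half]; exact ENNReal.ofReal_le_ofReal (by linarith)), y2, fun κ' hκ' =>
      y4 (shift κ') (freq_shift mass ω κ') hκ'⟩
    rw [heE, hχ]; field_simp

end Reducibility


/-! ### Measure estimates -/

section Measure

open MeasureTheory

variable {ν : ℕ}

theorem tsum_pi_prod (f : ℤ → ℝ≥0∞) (n : ℕ) :
    ∑' k : Fin n → ℤ, ∏ i, f (k i) = (∑' m, f m) ^ n := by
  induction n with
  | zero => simp
  | succ n ih =>
    rw [← (Fin.consEquiv fun _ : Fin (n + 1) => ℤ).tsum_eq, pow_succ', ← ih,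
      ENNReal.tsum_prod', ← ENNReal.tsum_mul_right]
    refine tsum_congr fun m => ?_
    rw [← ENNReal.tsum_mul_left]
    refine tsum_congr fun k => ?_
    simp [Fin.prod_univ_succ, Fin.consEquiv]

/-- (1 + |k|)^{2ν} dominates the product of the (1 + |k_i|)², so the sum is at most the ν-th power
of a convergent one-dimensional sum. -/
theorem exists_tsum_kabs_le (ν : ℕ) : ∃ K > 0,
    ∑' k : Fin ν → ℤ, ENNReal.ofReal (1 / (1 + kabs k) ^ (2 * ν)) ≤ ENNReal.ofReal K := by
  have hs : Summable fun m : ℤ => 1 / (1 + |(m : ℝ)|) ^ 2 := by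
    refine Summable.of_nat_of_neg ?_ ?_ <;>
    · have h := (summable_nat_add_iff 1).2 (Real.summable_one_div_nat_pow (p := 2).2 one_lt_two)
      refine h.congr fun n => ?_
      push_cast
      simp [add_comm]
  have hfin : ∑' m : ℤ, ENNReal.ofReal (1 / (1 + |(m : ℝ)|) ^ 2) ≠ ∞ := by
    rw [← ENNReal.ofReal_tsum_of_nonneg (fun m => by positivity) hs]
    exact ENNReal.ofReal_ne_top
  set A := (∑' m : ℤ, ENNReal.ofReal (1 / (1 + |(m : ℝ)|) ^ 2)) ^ ν with hA
  have hA' : A ≠ ∞ := ENNReal.pow_ne_top hfin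
  refine ⟨A.toReal + 1, by positivity, ?_⟩
  calc _ ≤ ∑' k : Fin ν → ℤ, ∏ i, ENNReal.ofReal (1 / (1 + |(k i : ℝ)|) ^ 2) := by
        refine ENNReal.tsum_le_tsum fun k => ?_
        rw [← ENNReal.ofReal_prod_of_nonneg fun i _ => by positivity]
        refine ENNReal.ofReal_le_ofReal ?_
        rw [Finset.prod_div_distrib, Finset.prod_const_one]
        refine one_div_le_one_div_of_le (Finset.prod_pos fun i _ => by positivity) ?_
        calc _ ≤ ∏ i : Fin ν, (1 + kabs k) ^ 2 := by
              refine Finset.prod_le_prod (fun i _ => by positivity) fun i _ => ?_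
              gcongr
              exact Finset.single_le_sum (f := fun i => |(k i : ℝ)|) (fun i _ => abs_nonneg _)
                (Finset.mem_univ i)
          _ = _ := by rw [Finset.prod_const, Finset.card_univ, Fintype.card_fin, ← pow_mul]
    _ = A := tsum_pi_prod (fun m => ENNReal.ofReal (1 / (1 + |(m : ℝ)|) ^ 2)) ν
    _ = ENNReal.ofReal A.toReal := (ENNReal.ofReal_toReal hA').symm
    _ ≤ _ := ENNReal.ofReal_le_ofReal (by linarith)

theorem norm_le_sum_abs (a : EuclideanSpace ℝ (Fin ν)) : ‖a‖ ≤ ∑ i, |a i| := by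
  rw [EuclideanSpace.norm_eq]
  refine Real.sqrt_le_iff.2 ⟨Finset.sum_nonneg fun _ _ => abs_nonneg _, ?_⟩
  exact Finset.sum_sq_le_sq_sum_of_nonneg fun _ _ => abs_nonneg _

/-- The measure of a neighbourhood of a resonant hypersurface. No measurability is needed. -/
theorem volume_slab_le {M δ : ℝ} (hM : 0 ≤ M) {k : Fin ν → ℤ} (hk : k ≠ 0)
    {S : Set (EuclideanSpace ℝ (Fin ν))} (hS : ∀ ω ∈ S, ‖ω‖ ≤ 2 * M)
    {h : EuclideanSpace ℝ (Fin ν) → ℝ}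
    (hh : ∀ ω ∈ S, ∀ ω' ∈ S, |h ω - h ω'| ≤ 1 / 2 * dist ω ω')
    (hb : ∀ ω ∈ S, |dotk ω k + h ω| ≤ δ) :
    volume S ≤ ENNReal.ofReal ((3 * ν) ^ ν * (4 * M) ^ (ν - 1) * (2 * δ)) := by
  obtain ⟨j, hj⟩ := Function.ne_iff.1 hk
  obtain ⟨i₀, -, hi₀⟩ := Finset.exists_max_image Finset.univ (fun i => |(k i : ℝ)|)
    ⟨j, Finset.mem_univ j⟩
  have hki : (1 : ℝ) ≤ |(k i₀ : ℝ)| := by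
    refine le_trans ?_ (hi₀ j (Finset.mem_univ j))
    exact_mod_cast Int.one_le_abs hj
  have hkpos : (0 : ℝ) < |(k i₀ : ℝ)| := by linarith
  have hk0 : (k i₀ : ℝ) ≠ 0 := abs_pos.1 hkpos
  set e := (@WithLp.ofLp 2 (Fin ν → ℝ)) with he
  set S' : Set (Fin ν → ℝ) := (fun y => (WithLp.toLp 2 y : EuclideanSpace ℝ (Fin ν))) ⁻¹' S with hS'
  have hvol : volume S = volume S' :=
    ((PiLp.volume_preserving_toLp (Fin ν)).measure_preimage_equiv
      (f := (MeasurableEquiv.toLp 2 (Fin ν → ℝ))) S).symm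
  -- Straighten the slab: the coordinate i₀ with |k_{i₀}| largest is replaced by (ω·k + h)/k_{i₀}.
  -- Since |k_{i₀}| ≥ 1 and h is 1/2-Lipschitz, the h-term can be absorbed, and f contracts
  -- distances by at most 3ν. The image lies in a box of side 2δ in direction i₀ and 4M in the
  -- others. Comparing Hausdorff measures gives the factor (3ν)^ν.
  set f : S' → (Fin ν → ℝ) := fun y => Function.update y.1 i₀
    ((dotk (WithLp.toLp 2 y.1) k + h (WithLp.toLp 2 y.1)) / k i₀) with hf
  have hanti : AntilipschitzWith (3 * ν : ℝ≥0) f := by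
    refine AntilipschitzWith.of_le_mul_dist fun y y' => ?_
    set s := dist (f y) (f y') with hs
    set a : EuclideanSpace ℝ (Fin ν) := WithLp.toLp 2 y.1 - WithLp.toLp 2 y'.1 with ha
    have hai : ∀ i, a i = y.1 i - y'.1 i := fun i => rfl
    have hs0 : 0 ≤ s := dist_nonneg
    have hoff : ∀ i, i ≠ i₀ → |a i| ≤ s := fun i hi => by
      have := dist_le_pi_dist (f y) (f y') i
      simp only [hf, Function.update_of_ne hi] at this
      rwa [hai, ← Real.dist_eq]
    have hν : (1 : ℝ) ≤ ν := by exact_mod_cast Fin.pos i₀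
    have hsum : ∑ i, |a i| ≤ (ν - 1) * s + |a i₀| := by
      rw [← Finset.add_sum_erase _ _ (Finset.mem_univ i₀), add_comm]
      gcongr
      refine (Finset.sum_le_sum fun i hi => hoff i (Finset.ne_of_mem_erase hi)).trans ?_
      rw [Finset.sum_const, Finset.card_erase_of_mem (Finset.mem_univ _), nsmul_eq_mul,
        Finset.card_univ, Fintype.card_fin, Nat.cast_sub (Fin.pos i₀), Nat.cast_one]
    have h0 : |a i₀| ≤ s + (ν - 1) * s + 1 / 2 * ((ν - 1) * s + |a i₀|) := by
      have hd := dist_le_pi_dist (f y) (f y') i₀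
      simp only [hf, Function.update_self] at hd
      rw [Real.dist_eq] at hd
      have e1 : dotk (WithLp.toLp 2 y.1) k - dotk (WithLp.toLp 2 y'.1) k
          = k i₀ * a i₀ + ∑ i ∈ Finset.univ.erase i₀, a i * k i := by
        rw [← dotk_sub_left, dotk, ← Finset.add_sum_erase _ _ (Finset.mem_univ i₀), mul_comm]
      set t := ∑ i ∈ Finset.univ.erase i₀, a i * k i with ht
      have htb : |t| ≤ |(k i₀ : ℝ)| * ((ν - 1) * s) := by
        refine (Finset.abs_sum_le_sum_abs _ _).trans ?_
        calc _ ≤ ∑ i ∈ Finset.univ.erase i₀, s * |(k i₀ : ℝ)| := by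
              refine Finset.sum_le_sum fun i hi => ?_
              rw [abs_mul]
              exact mul_le_mul (hoff i (Finset.ne_of_mem_erase hi)) (hi₀ i (Finset.mem_univ i))
                (abs_nonneg _) hs0
          _ = _ := by
              rw [Finset.sum_const, Finset.card_erase_of_mem (Finset.mem_univ _), nsmul_eq_mul,
                Finset.card_univ, Fintype.card_fin, Nat.cast_sub (Fin.pos i₀), Nat.cast_one]
              ring
      have hhb : |h (WithLp.toLp 2 y.1) - h (WithLp.toLp 2 y'.1)|
          ≤ 1 / 2 * ((ν - 1) * s + |a i₀|) := by
        refine (hh _ y.2 _ y'.2).trans ?_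
        rw [dist_eq_norm]
        gcongr
        exact (norm_le_sum_abs _).trans hsum
      have hd' : |(k i₀ * a i₀ + t + (h (WithLp.toLp 2 y.1) - h (WithLp.toLp 2 y'.1)))|
          ≤ |(k i₀ : ℝ)| * s := by
        have e2 : k i₀ * a i₀ + t + (h (WithLp.toLp 2 y.1) - h (WithLp.toLp 2 y'.1))
            = k i₀ * ((dotk (WithLp.toLp 2 y.1) k + h (WithLp.toLp 2 y.1)) / k i₀
              - (dotk (WithLp.toLp 2 y'.1) k + h (WithLp.toLp 2 y'.1)) / k i₀) := by
          rw [← e1]; field_simp; ring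
        rw [e2, abs_mul]
        gcongr
      have h1 : |(k i₀ : ℝ)| * |a i₀| ≤ |(k i₀ : ℝ)| * s + |(k i₀ : ℝ)| * ((ν - 1) * s)
          + 1 / 2 * ((ν - 1) * s + |a i₀|) := by
        rw [← abs_mul]
        have e3 : k i₀ * a i₀ = (k i₀ * a i₀ + t + (h (WithLp.toLp 2 y.1) - h (WithLp.toLp 2 y'.1)))
            - t - (h (WithLp.toLp 2 y.1) - h (WithLp.toLp 2 y'.1)) := by ring
        rw [e3]
        exact (abs_sub _ _).trans (add_le_add ((abs_sub _ _).trans (add_le_add hd' htb)) hhb)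
      have hν0 : 0 ≤ (ν - 1) * s := mul_nonneg (by linarith) hs0
      have h2 : 1 / 2 * ((ν - 1) * s + |a i₀|)
          ≤ |(k i₀ : ℝ)| * (1 / 2 * ((ν - 1) * s + |a i₀|)) :=
        le_mul_of_one_le_left (by positivity) hki
      refine le_of_mul_le_mul_left ?_ hkpos
      linarith
    have h3 : |a i₀| ≤ 3 * ν * s := by nlinarith
    push_cast
    rw [Subtype.dist_eq]
    refine (dist_pi_le_iff (by positivity)).2 fun i => ?_
    rw [Real.dist_eq, ← hai]
    by_cases hi : i = i₀
    · rw [hi]; exact h3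
    · refine (hoff i hi).trans (le_mul_of_one_le_left hs0 (by linarith))
  set c : Fin ν → ℝ := fun i => if i = i₀ then δ else 2 * M with hc
  have himg : f '' Set.univ ⊆ Set.univ.pi fun i => Set.Icc (-c i) (c i) := by
    rintro _ ⟨y, -, rfl⟩ i -
    rw [Set.mem_Icc, ← abs_le]
    by_cases hi : i = i₀
    · subst hi
      simp only [hf, hc, Function.update_self, if_true, abs_div]
      exact (div_le_self (abs_nonneg _) hki).trans (hb _ y.2)
    · simp only [hf, hc, Function.update_of_ne hi, if_neg hi]
      exact (PiLp.norm_apply_le (WithLp.toLp 2 y.1 : EuclideanSpace ℝ (Fin ν)) i).trans (hS _ y.2)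
  have h1 := hanti.le_hausdorffMeasure_image (d := (ν : ℝ)) (Nat.cast_nonneg _) Set.univ
  have h2 : (MeasureTheory.Measure.hausdorffMeasure (ν : ℝ)) (Set.univ : Set S') = volume S' := by
    rw [← (isometry_subtype_coe (s := S')).hausdorffMeasure_image (Or.inl (Nat.cast_nonneg _))
      Set.univ, Set.image_univ, Subtype.range_coe, ← hausdorffMeasure_pi_real, Fintype.card_fin]
  have h3 : (MeasureTheory.Measure.hausdorffMeasure (ν : ℝ)) (f '' Set.univ)
      ≤ ENNReal.ofReal ((4 * M) ^ (ν - 1) * (2 * δ)) := by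
    have e1 : (MeasureTheory.Measure.hausdorffMeasure (ν : ℝ) : Measure (Fin ν → ℝ)) = volume := by
      rw [← hausdorffMeasure_pi_real, Fintype.card_fin]
    rw [e1]
    refine (measure_mono himg).trans (le_of_eq ?_)
    rw [volume_pi_pi]
    simp only [Real.volume_Icc]
    rw [← Finset.mul_prod_erase _ _ (Finset.mem_univ i₀),
      Finset.prod_congr rfl (g := fun _ => ENNReal.ofReal (4 * M)) (fun i hi => by
        simp only [hc, if_neg (Finset.ne_of_mem_erase hi)]; congr 1; ring),
      Finset.prod_const, Finset.card_erase_of_mem (Finset.mem_univ _), Finset.card_univ,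
      Fintype.card_fin, ENNReal.ofReal_mul (p := (4 * M) ^ (ν - 1)) (by positivity),
      ENNReal.ofReal_pow (by positivity), mul_comm]
    simp only [hc, if_true]
    congr 2; ring
  rw [hvol, ← h2]
  refine h1.trans ((mul_le_mul' le_rfl h3).trans (le_of_eq ?_))
  rw [mul_assoc, ENNReal.ofReal_mul (p := (3 * (ν : ℝ)) ^ ν) (by positivity), ENNReal.rpow_natCast,
    ENNReal.ofReal_pow (p := 3 * (ν : ℝ)) (by positivity)]
  congr 2
  rw [ENNReal.ofReal_mul (by norm_num)]
  simp

theorem exists_le_volume_annulus (hν : 1 ≤ ν) : ∃ c > 0, ∀ M ≥ (1 : ℝ),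
    ENNReal.ofReal (c * M ^ ν) ≤ volume (annulus ν M) := by
  have : Nonempty (Fin ν) := ⟨⟨0, hν⟩⟩
  have : Nontrivial (EuclideanSpace ℝ (Fin ν)) := inferInstance
  have hball := Metric.measure_ball_pos (volume : Measure (EuclideanSpace ℝ (Fin ν))) 0 one_pos
  have hfin : volume (Metric.ball (0 : EuclideanSpace ℝ (Fin ν)) 1) ≠ ∞ := measure_ball_lt_top.ne
  refine ⟨(volume (Metric.ball (0 : EuclideanSpace ℝ (Fin ν)) 1)).toReal,
    ENNReal.toReal_pos hball.ne' hfin, fun M hM => ?_⟩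
  have hM0 : 0 ≤ M := by linarith
  have h1 := le_measure_sdiff (μ := volume) (s₁ := Metric.closedBall (0 : EuclideanSpace ℝ (Fin ν)) (2 * M))
    (s₂ := Metric.ball 0 M)
  refine le_trans ?_ h1
  rw [Measure.addHaar_closedBall _ _ (by linarith), Measure.addHaar_ball _ _ hM0]
  rw [finrank_euclideanSpace, Fintype.card_fin, mul_comm, ENNReal.ofReal_mul (by positivity),
    ENNReal.ofReal_toReal hfin]
  refine ENNReal.le_sub_of_add_le_left (ENNReal.mul_ne_top ENNReal.ofReal_ne_top hfin) ?_
  rw [← add_mul, ← ENNReal.ofReal_add (by positivity) (by positivity)]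
  gcongr
  rw [mul_pow]
  have : (2 : ℝ) ≤ 2 ^ ν := le_self_pow₀ one_le_two (by omega)
  nlinarith [pow_nonneg hM0 ν]

end Measure


/-! ### Measure of the resonant frequencies -/

section Exclusion

open MeasureTheory

variable {ν : ℕ}

theorem volume_iUnion_kabs_le {K a : ℝ} (ha : 0 ≤ a)
    (hK : ∑' k : Fin ν → ℤ, ENNReal.ofReal (1 / (1 + kabs k) ^ (2 * ν)) ≤ ENNReal.ofReal K)
    {E : (Fin ν → ℤ) → Set (EuclideanSpace ℝ (Fin ν))}
    (hE : ∀ k, volume (E k) ≤ ENNReal.ofReal (a * (1 / (1 + kabs k) ^ (2 * ν)))) :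
    volume (⋃ k, E k) ≤ ENNReal.ofReal (a * K) := by
  refine (measure_iUnion_le E).trans ((ENNReal.tsum_le_tsum hE).trans ?_)
  simp_rw [ENNReal.ofReal_mul ha]
  rw [ENNReal.tsum_mul_left]
  gcongr

theorem volume_iUnion_fintype_le {ι : Type*} [Fintype ι] {N c : ℝ} (hc : 0 ≤ c)
    (hN : (Fintype.card ι : ℝ) ≤ N) {E : ι → Set (EuclideanSpace ℝ (Fin ν))}
    (hE : ∀ i, volume (E i) ≤ ENNReal.ofReal c) :
    volume (⋃ i, E i) ≤ ENNReal.ofReal (N * c) := by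
  refine (measure_iUnion_fintype_le _ E).trans ((Finset.sum_le_sum fun i _ => hE i).trans ?_)
  rw [Finset.sum_const, Finset.card_univ, nsmul_eq_mul, ← ENNReal.ofReal_natCast,
    ← ENNReal.ofReal_mul (Nat.cast_nonneg _)]
  exact ENNReal.ofReal_le_ofReal (mul_le_mul_of_nonneg_right hN hc)

/-- λ_m - m is at most of order 1/m; only m^{-1/2} is kept, to match the decay of the corrections z.
-/
theorem abs_eigB_sub_le (mass : ℝ) (m : ℕ+) :
    |eigB mass m - m| ≤ mass ^ 2 / Real.sqrt m := by
  have h1 := le_eigB mass m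
  have hm := one_le_pnat m
  have h2 : eigB mass m ^ 2 = (m : ℝ) ^ 2 + mass ^ 2 := Real.sq_sqrt (by positivity)
  have h3 : Real.sqrt m ≤ m := by
    rw [Real.sqrt_le_iff]; exact ⟨by linarith, by nlinarith⟩
  have h4 := one_le_sqrt_pnat m
  rw [abs_of_nonneg (by linarith), le_div_iff₀ (by linarith)]
  nlinarith [mul_le_mul_of_nonneg_left h3 (sub_nonneg.2 h1)]

/-- For equal signs, λ_m² - λ_n² = m² - n² gives |λ_m - λ_n| = |m - n| (m + n)/(λ_m + λ_n); for
opposite signs λ_m + λ_n ≥ 2. This handles the divisors with k = 0, in which ω·k is absent and the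
slab estimate gives nothing. -/
theorem le_abs_sub_eigB {mass : ℝ} (hm : 0 ≤ mass) {i j : Bool × ℕ+} (hij : i ≠ j) :
    1 / (1 + mass) ≤ |sg i.1 * eigB mass i.2 - sg j.1 * eigB mass j.2| := by
  obtain ⟨s, m⟩ := i
  obtain ⟨t, n⟩ := j
  have h1 := le_eigB mass m
  have h2 := le_eigB mass n
  have h3 := one_le_pnat m
  have h4 := one_le_pnat n
  have h5 : 1 / (1 + mass) ≤ 1 := by
    rw [div_le_one (by linarith)]; linarith
  by_cases hst : s = t
  · subst hst
    have hmn : (m : ℤ) ≠ n := fun h => hij (by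
      rw [Prod.mk.injEq]; exact ⟨rfl, PNat.coe_injective (by exact_mod_cast h)⟩)
    have h6 : (1 : ℝ) ≤ |(m : ℝ) - n| := by
      have := Int.one_le_abs (sub_ne_zero.2 hmn)
      exact_mod_cast this
    have e1 : eigB mass m ^ 2 = (m : ℝ) ^ 2 + mass ^ 2 := Real.sq_sqrt (by positivity)
    have e2 : eigB mass n ^ 2 = (n : ℝ) ^ 2 + mass ^ 2 := Real.sq_sqrt (by positivity)
    have l1 := eigB_le hm m
    have l2 := eigB_le hm n
    simp only
    rw [← mul_sub, abs_mul, abs_sg, one_mul]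
    have e3 : |eigB mass m - eigB mass n| * (eigB mass m + eigB mass n)
        = |(m : ℝ) - n| * (m + n) := by
      have a1 : |eigB mass m + eigB mass n| = eigB mass m + eigB mass n :=
        abs_of_pos (by linarith)
      have a2 : |(m : ℝ) + n| = m + n := abs_of_pos (by linarith)
      rw [← a1, ← a2, ← abs_mul, ← abs_mul]
      congr 1
      linear_combination e1 - e2
    rw [div_le_iff₀ (by linarith)]
    have h7 := abs_nonneg (eigB mass m - eigB mass n)
    have h8 : eigB mass m + eigB mass n ≤ (1 + mass) * (m + n) := by nlinarith
    have h9 := mul_le_mul_of_nonneg_left h8 h7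
    have h10 : (m + n : ℝ) ≤ |(m : ℝ) - n| * (m + n) := le_mul_of_one_le_left (by linarith) h6
    refine le_of_mul_le_mul_right ?_ (show (0 : ℝ) < m + n by linarith)
    linarith
  · simp only
    refine h5.trans ?_
    cases s <;> cases t <;> simp [sg] at hst ⊢
    · rw [abs_of_nonneg (by linarith)]; linarith
    · rw [abs_sub_comm, abs_of_nonneg (by linarith)]; linarith

/-- Among frequencies of size M a slab of width gM occupies only a fraction of order g. The
threshold may thus grow like M, and this is where the large divisors of the first step come from. -/
theorem volume_small_divisor_le {K g M : ℝ} {τ₁ : ℕ} (hτ : 2 * ν ≤ τ₁) (hM : 1 ≤ M) (hg : 0 < g)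
    (hK : ∑' k : Fin ν → ℤ, ENNReal.ofReal (1 / (1 + kabs k) ^ (2 * ν)) ≤ ENNReal.ofReal K)
    (hν : 1 ≤ ν) :
    volume {ω : EuclideanSpace ℝ (Fin ν) | ‖ω‖ ≤ 2 * M ∧
      ∃ k, k ≠ 0 ∧ |dotk ω k| * (1 + kabs k) ^ τ₁ < g * M}
      ≤ ENNReal.ofReal ((3 * ν) ^ ν * 4 ^ (ν - 1) * 2 * g * M ^ ν * K) := by
  refine (measure_mono (t := ⋃ k, {ω : EuclideanSpace ℝ (Fin ν) | ‖ω‖ ≤ 2 * M ∧ k ≠ 0 ∧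
    |dotk ω k| * (1 + kabs k) ^ τ₁ < g * M}) ?_).trans
    (volume_iUnion_kabs_le (by positivity) hK fun k => ?_)
  · rintro ω ⟨h1, k, h2, h3⟩
    exact Set.mem_iUnion.2 ⟨k, h1, h2, h3⟩
  · by_cases hk : k = 0
    · simp [hk]
    have hX : 1 ≤ 1 + kabs k := by linarith [kabs_nonneg k]
    refine (volume_slab_le (δ := g * M / (1 + kabs k) ^ τ₁) (h := fun _ => 0)
      (by linarith : 0 ≤ M) hk (fun ω h => h.1) (fun ω _ ω' _ => by simp)
      fun ω h => ?_).trans (ENNReal.ofReal_le_ofReal ?_)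
    · rw [add_zero, le_div_iff₀ (by positivity)]; exact h.2.2.le
    · have e : M ^ ν = M ^ (ν - 1) * M := by rw [← pow_succ]; congr 1; omega
      rw [e, mul_pow 4 M]
      calc _ ≤ (3 * (ν : ℝ)) ^ ν * (4 ^ (ν - 1) * M ^ (ν - 1))
            * (2 * (g * M / (1 + kabs k) ^ (2 * ν))) := by gcongr
        _ = _ := by ring

/-- For fixed k only O(M (1 + |k|)) integers l come close to -ω·k, and each contributes a slab of
width g. Their number replaces the factor M in the threshold of `volume_small_divisor_le` and costs
one more power of 1 + |k|. -/
theorem volume_integer_divisor_le {K g M : ℝ} {τ₁ : ℕ} (hτ : 2 * ν + 1 ≤ τ₁) (hM : 1 ≤ M)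
    (hg : 0 < g) (hg1 : g ≤ 1)
    (hK : ∑' k : Fin ν → ℤ, ENNReal.ofReal (1 / (1 + kabs k) ^ (2 * ν)) ≤ ENNReal.ofReal K)
    (hν : 1 ≤ ν) :
    volume {ω : EuclideanSpace ℝ (Fin ν) | ‖ω‖ ≤ 2 * M ∧
      ∃ k, k ≠ 0 ∧ ∃ l : ℤ, |dotk ω k + l| * (1 + kabs k) ^ τ₁ < g}
      ≤ ENNReal.ofReal (9 * ((3 * ν) ^ ν * 4 ^ (ν - 1) * 2) * g * M ^ ν * K) := by
  refine (measure_mono (t := ⋃ k, {ω : EuclideanSpace ℝ (Fin ν) | ‖ω‖ ≤ 2 * M ∧ k ≠ 0 ∧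
    ∃ l : ℤ, |dotk ω k + l| * (1 + kabs k) ^ τ₁ < g}) ?_).trans
    (volume_iUnion_kabs_le (by positivity) hK fun k => ?_)
  · rintro ω ⟨h1, k, h2, h3⟩
    exact Set.mem_iUnion.2 ⟨k, h1, h2, h3⟩
  · by_cases hk : k = 0
    · simp [hk]
    have hX : 1 ≤ 1 + kabs k := by linarith [kabs_nonneg k]
    set X := 1 + kabs k with hXd
    set N : ℕ := ⌈2 * M * X + 1⌉₊ with hN
    have hN1 : 2 * M * X + 1 ≤ N := Nat.le_ceil _
    have hN2 : (N : ℝ) < 2 * M * X + 1 + 1 := Nat.ceil_lt_add_one (by positivity)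
    have hMX : 1 ≤ M * X := one_le_mul_of_one_le_of_one_le hM hX
    refine (measure_mono (t := ⋃ l : Finset.Icc (-(N : ℤ)) N, {ω : EuclideanSpace ℝ (Fin ν) |
      ‖ω‖ ≤ 2 * M ∧ |dotk ω k + (l : ℤ)| * X ^ τ₁ < g}) ?_).trans
      ((volume_iUnion_fintype_le (N := 9 * (M * X))
        (c := (3 * ν) ^ ν * (4 * M) ^ (ν - 1) * (2 * (g / X ^ τ₁))) (by positivity) ?_
        fun l => ?_).trans (ENNReal.ofReal_le_ofReal ?_))
    · rintro ω ⟨h1, -, l, h3⟩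
      refine Set.mem_iUnion.2 ⟨⟨l, ?_⟩, h1, h3⟩
      have h4 := abs_dotk_le ω k
      have h5 : ‖ω‖ * kabs k ≤ 2 * M * X := by
        have := kabs_nonneg k
        gcongr
        linarith
      have h6 : |dotk ω k + l| ≤ 1 :=
        (le_mul_of_one_le_right (abs_nonneg _) (one_le_pow₀ hX)).trans (h3.le.trans hg1)
      have h7 : |(l : ℝ)| ≤ N := by
        have : |(l : ℝ)| ≤ |dotk ω k + l| + |dotk ω k| := by
          have := abs_sub (dotk ω k + l) (dotk ω k)
          rwa [add_sub_cancel_left] at this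
        linarith
      rw [Finset.mem_Icc, ← abs_le]
      exact_mod_cast h7
    · rw [Fintype.card_coe, Int.card_Icc]
      have : ((N : ℤ) + 1 - -(N : ℤ)).toNat = 2 * N + 1 := by omega
      rw [this]; push_cast
      nlinarith
    · refine volume_slab_le (h := fun _ => ((l : ℤ) : ℝ)) (by linarith : 0 ≤ M) hk
        (fun ω h => h.1) (fun ω _ ω' _ => by simp) fun ω h => ?_
      rw [le_div_iff₀ (by positivity)]; exact h.2.le
    · have e : M ^ ν = M ^ (ν - 1) * M := by rw [← pow_succ]; congr 1; omega
      rw [e, mul_pow 4 M]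
      have : X / X ^ τ₁ ≤ 1 / X ^ (2 * ν) := by
        rw [div_le_div_iff₀ (by positivity) (by positivity), one_mul, ← pow_succ']
        exact pow_le_pow_right₀ hX hτ
      calc _ = 9 * ((3 * (ν : ℝ)) ^ ν * (4 ^ (ν - 1) * M ^ (ν - 1) * M) * 2 * g)
            * (X / X ^ τ₁) := by ring
        _ ≤ 9 * ((3 * (ν : ℝ)) ^ ν * (4 ^ (ν - 1) * M ^ (ν - 1) * M) * 2 * g)
            * (1 / X ^ (2 * ν)) := by gcongr
        _ = _ := by ring

/-- The measure of the frequencies in `S` that violate the second order nonresonance condition. -/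
theorem exists_volume_resonant_le {mass g K : ℝ} (hm : 0 ≤ mass) (hg : 0 < g) (hg1 : g ≤ 1)
    {τ₁ τ : ℕ} (hτ₁ : 1 ≤ τ₁) (hτ : 4 * τ₁ + 2 * ν ≤ τ)
    (hK : ∑' k : Fin ν → ℤ, ENNReal.ofReal (1 / (1 + kabs k) ^ (2 * ν)) ≤ ENNReal.ofReal K)
    (hν : 1 ≤ ν) : ∃ A > 0, ∃ δ₀ > 0, δ₀ ≤ 1 ∧ ∃ η > 0, ∀ M ≥ 1, ∀ δ, 0 < δ → δ ≤ δ₀ →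
      ∀ (S : Set (EuclideanSpace ℝ (Fin ν))) (z : EuclideanSpace ℝ (Fin ν) → Idx ν → ℂ),
      (∀ ω ∈ S, ‖ω‖ ≤ 2 * M) →
      (∀ ω ∈ S, ∀ k : Fin ν → ℤ, k ≠ 0 → ∀ l : ℤ, g ≤ |dotk ω k + l| * (1 + kabs k) ^ τ₁) →
      (∀ ω ∈ S, ∀ x, Real.sqrt x.2.2 * ‖z ω x‖ ≤ η) →
      (∀ ω ∈ S, ∀ ω' ∈ S, ∀ x, ‖z ω x - z ω' x‖ ≤ η * dist ω ω') →
      (∀ ω ∈ S, ∀ κ x, z ω (shift κ x) = z ω x) →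
      volume {ω | ω ∈ S ∧ ∃ x y : Idx ν, x ≠ y ∧ ‖(freq mass ω x + z ω x
        - (freq mass ω y + z ω y) : ℂ)‖ * (1 + kabs (x.1 - y.1)) ^ τ < δ}
        ≤ ENNReal.ofReal (A * M ^ ν * δ * K) := by
  set c : ℝ := 1 / (1 + mass) with hc
  have hc0 : 0 < c := by positivity
  have hc1 : c ≤ 1 := by rw [hc, div_le_one (by linarith)]; linarith
  set b : ℝ := mass ^ 2 + 1 with hb
  have hb1 : 1 ≤ b := by rw [hb]; nlinarith
  set h₁ : ℝ := (4 * b / g) ^ 2 + 1 with hh₁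
  have hh₁0 : 1 ≤ h₁ := by rw [hh₁]; nlinarith [sq_nonneg (4 * b / g)]
  set r₁ : ℝ := h₁ + 2 * b + 4 with hr₁
  refine ⟨8 * (h₁ * r₁) * ((3 * ν) ^ ν * 4 ^ (ν - 1) * 2), by positivity, min (c / 2) (g / 2),
    by positivity, (min_le_right _ _).trans (by linarith), c / 4, by positivity, ?_⟩
  intro M hM δ hδ hδ₀ S z hS hint hz hzL hzs
  have hδc : δ ≤ c / 2 := hδ₀.trans (min_le_left _ _)
  have hδg : δ ≤ g / 2 := hδ₀.trans (min_le_right _ _)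
  have hM0 : (0 : ℝ) < M := by linarith
  have hz' : ∀ ω ∈ S, ∀ x, ‖z ω x‖ ≤ c / 4 := fun ω hω x =>
    (le_mul_of_one_le_left (norm_nonneg _) (one_le_sqrt_pnat _)).trans (hz ω hω x)
  have hz0 : ∀ ω ∈ S, ∀ x, z ω x = z ω (0, x.2) := fun ω hω x => by
    rw [← hzs ω hω x.1 (0, x.2), shift_apply, zero_add]
  -- Nothing is assumed about the reality of z here. The modulus of the divisor is at least that of
  -- its real part, so only real parts are kept.
  set D : (Bool × ℕ+) → (Bool × ℕ+) → EuclideanSpace ℝ (Fin ν) → ℝ := fun i j ω =>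
    (sg i.1 * eigB mass i.2 - sg j.1 * eigB mass j.2) + (z ω (0, i) - z ω (0, j)).re with hD
  set T : (Fin ν → ℤ) → (Bool × ℕ+) → (Bool × ℕ+) → Set (EuclideanSpace ℝ (Fin ν)) :=
    fun k i j => {ω | ω ∈ S ∧ |dotk ω k + D i j ω| * (1 + kabs k) ^ τ < δ} with hT
  have hcover : {ω | ω ∈ S ∧ ∃ x y : Idx ν, x ≠ y ∧ ‖(freq mass ω x + z ω x
        - (freq mass ω y + z ω y) : ℂ)‖ * (1 + kabs (x.1 - y.1)) ^ τ < δ}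
      ⊆ ⋃ k : Fin ν → ℤ, {ω | k ≠ 0 ∧ ∃ i j, ω ∈ T k i j} := by
    rintro ω ⟨hω, x, y, hxy, h⟩
    have hle : |dotk ω (x.1 - y.1) + D x.2 y.2 ω| ≤ ‖(freq mass ω x + z ω x
        - (freq mass ω y + z ω y) : ℂ)‖ := by
      refine le_trans (le_of_eq ?_) (Complex.abs_re_le_norm _)
      congr 1
      rw [hz0 ω hω x, hz0 ω hω y]
      simp only [hD, dotk_sub_right, freq, Complex.sub_re, Complex.add_re, Complex.ofReal_re]
      ring
    have hX : 1 ≤ 1 + kabs (x.1 - y.1) := by linarith [kabs_nonneg (x.1 - y.1)]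
    have h' : |dotk ω (x.1 - y.1) + D x.2 y.2 ω| * (1 + kabs (x.1 - y.1)) ^ τ < δ :=
      lt_of_le_of_lt (mul_le_mul_of_nonneg_right hle (by positivity)) h
    refine Set.mem_iUnion.2 ⟨x.1 - y.1, fun h0 => ?_, x.2, y.2, hω, h'⟩
    -- The case k = 0 is impossible: the unperturbed difference is at least c, the corrections
    -- change it by at most c/2, and δ ≤ c/2.
    have hij : x.2 ≠ y.2 := fun h2 => hxy (Prod.ext (sub_eq_zero.1 h0) h2)
    rw [h0, kabs_zero, add_zero, one_pow, mul_one] at h'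
    have e0 : dotk ω 0 = 0 := by simp [dotk]
    rw [e0, zero_add] at h'
    have h1 := le_abs_sub_eigB hm hij
    have h2 : |(z ω (0, x.2) - z ω (0, y.2)).re| ≤ c / 4 + c / 4 :=
      (Complex.abs_re_le_norm _).trans ((norm_sub_le _ _).trans
        (add_le_add (hz' ω hω _) (hz' ω hω _)))
    have h3 := abs_sub_abs_le_abs_sub (sg x.2.1 * eigB mass x.2.2 - sg y.2.1 * eigB mass y.2.2)
      (-(z ω (0, x.2) - z ω (0, y.2)).re)
    rw [abs_neg, sub_neg_eq_add] at h3
    change 1 / (1 + mass) ≤ _ at h1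
    rw [← hc] at h1
    have h4 : |D x.2 y.2 ω| < δ := h'
    simp only [hD] at h4
    linarith
  refine (measure_mono hcover).trans (volume_iUnion_kabs_le (by positivity) hK fun k => ?_)
  by_cases hk : k = 0
  · simp [hk]
  have hX : 1 ≤ 1 + kabs k := by linarith [kabs_nonneg k]
  set X := 1 + kabs k with hXd
  have hX0 : 0 < X := by linarith
  -- From H₀ on, a perturbed frequency is within b/√m ≤ g/(4 X^{τ₁}) of an integer, a quarter of the
  -- integer nonresonance threshold.
  set H₀ : ℝ := (4 * b * X ^ τ₁ / g) ^ 2 with hH₀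
  set H : ℕ := ⌈H₀⌉₊ with hH
  set R : ℕ := ⌈H₀ + 2 * M * X + 2 * b + 1⌉₊ with hR
  have hvol : ∀ i j, volume (T k i j)
      ≤ ENNReal.ofReal ((3 * ν) ^ ν * (4 * M) ^ (ν - 1) * (2 * (δ / X ^ τ))) := fun i j => by
    refine volume_slab_le (h := D i j) hM0.le hk (fun ω h => hS ω h.1)
      (fun ω h ω' h' => ?_) fun ω h => ?_
    · have e : D i j ω - D i j ω'
          = ((z ω (0, i) - z ω' (0, i)) - (z ω (0, j) - z ω' (0, j))).re := by
        simp only [hD, Complex.sub_re]; ring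
      rw [e]
      refine (Complex.abs_re_le_norm _).trans ((norm_sub_le _ _).trans ((add_le_add
        (hzL ω h.1 ω' h'.1 _) (hzL ω h.1 ω' h'.1 _)).trans ?_))
      rw [← add_mul]
      gcongr
      linarith
    · rw [le_div_iff₀ (by positivity)]; exact h.2.le
  -- If both modes were at least H₀, ω·k would be closer to an integer than g/X^{τ₁}: the divisor
  -- accounts for less than half of this and each mode for a quarter. The bound on m - n follows
  -- from |ω·k| ≤ 2MX, since everything else is bounded.
  have hkey : ∀ i j, ∀ ω ∈ T k i j, ((i.2 : ℝ) < H₀ ∨ (j.2 : ℝ) < H₀) ∧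
      |(i.2 : ℝ) - j.2| ≤ 2 * M * X + 2 * b + 1 := by
    rintro ⟨s, m⟩ ⟨t, n⟩ ω ⟨hω, h⟩
    have hσ : ∀ (s : Bool) (m : ℕ+),
        |sg s * eigB mass m + (z ω (0, (s, m))).re - sg s * m| ≤ b / Real.sqrt m := fun s m => by
      have h1 : |(z ω (0, (s, m))).re| ≤ 1 / Real.sqrt m := by
        have hp : 0 < Real.sqrt m := by linarith [one_le_sqrt_pnat m]
        rw [le_div_iff₀ hp, mul_comm]
        have := hz ω hω (0, (s, m))
        refine le_trans ?_ (this.trans (by linarith))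
        exact mul_le_mul_of_nonneg_left (Complex.abs_re_le_norm _) hp.le
      have h2 := abs_eigB_sub_le mass m
      have e : sg s * eigB mass m + (z ω (0, (s, m))).re - sg s * m
          = sg s * (eigB mass m - m) + (z ω (0, (s, m))).re := by ring
      rw [e, hb, add_div]
      refine (abs_add_le _ _).trans (add_le_add ?_ h1)
      rw [abs_mul, abs_sg, one_mul]; exact h2
    have hXτ : |dotk ω k + D (s, m) (t, n) ω| * X ^ τ₁ < g / 2 :=
      lt_of_le_of_lt (mul_le_mul_of_nonneg_left (pow_le_pow_right₀ hX (by omega))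
        (abs_nonneg _)) (h.trans_le hδg)
    have hXτ' : |dotk ω k + D (s, m) (t, n) ω| < 1 := by
      have := le_mul_of_one_le_right (abs_nonneg (dotk ω k + D (s, m) (t, n) ω))
        (one_le_pow₀ hX (n := τ₁))
      linarith
    have e : dotk ω k + (sg s * m - sg t * n) = (dotk ω k + D (s, m) (t, n) ω)
        - (sg s * eigB mass m + (z ω (0, (s, m))).re - sg s * m)
        + (sg t * eigB mass n + (z ω (0, (t, n))).re - sg t * n) := by
      simp only [hD, Complex.sub_re]; ring
    have hb2 : |dotk ω k + (sg s * m - sg t * n)| ≤ |dotk ω k + D (s, m) (t, n) ω|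
        + b / Real.sqrt m + b / Real.sqrt n := by
      rw [e]
      exact (abs_add_le _ _).trans (add_le_add ((abs_sub _ _).trans
        (add_le_add le_rfl (hσ s m))) (hσ t n))
    refine ⟨?_, ?_⟩
    · by_contra! hmn
      have hlarge : ∀ m : ℕ+, H₀ ≤ m → b / Real.sqrt m * X ^ τ₁ ≤ g / 4 := fun m hm => by
        have h1 : 4 * b * X ^ τ₁ / g ≤ Real.sqrt m := Real.le_sqrt_of_sq_le hm
        have hp : 0 < Real.sqrt m := by linarith [one_le_sqrt_pnat m]
        rw [div_le_iff₀ hg] at h1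
        rw [div_mul_eq_mul_div, div_le_iff₀ hp]
        linarith
      obtain ⟨l, hl⟩ : ∃ l : ℤ, (l : ℝ) = sg s * m - sg t * n := by
        cases s <;> cases t
        · exact ⟨(m : ℤ) - n, by simp [sg]⟩
        · exact ⟨(m : ℤ) + n, by simp [sg]⟩
        · exact ⟨-(m : ℤ) - n, by simp [sg]⟩
        · exact ⟨-(m : ℤ) + n, by simp [sg]⟩
      have h1 := hint ω hω k hk l
      rw [hl] at h1
      have h2 := mul_le_mul_of_nonneg_right hb2 (show 0 ≤ X ^ τ₁ by positivity)
      rw [add_mul, add_mul] at h2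
      linarith [hlarge m hmn.1, hlarge n hmn.2]
    · have h4 := abs_dotk_le ω k
      have h5 : ‖ω‖ * kabs k ≤ 2 * M * X := by
        have := kabs_nonneg k
        have := hS ω hω
        gcongr
        linarith
      have h6 : |sg s * (m : ℝ) - sg t * n| ≤ 2 * M * X + 2 * b + 1 := by
        have h7 : |sg s * (m : ℝ) - sg t * n| ≤ |dotk ω k + (sg s * m - sg t * n)|
            + |dotk ω k| := by
          have := abs_sub (dotk ω k + (sg s * m - sg t * n)) (dotk ω k)
          rwa [add_sub_cancel_left] at this
        have h8 : ∀ m : ℕ+, b / Real.sqrt m ≤ b := fun m =>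
          div_le_self (by linarith) (one_le_sqrt_pnat m)
        linarith [h8 m, h8 n]
      refine le_trans ?_ h6
      have p1 := one_le_pnat m
      have p2 := one_le_pnat n
      cases s <;> cases t <;> simp only [sg] <;> norm_num
      · rw [abs_of_nonneg (show (0 : ℝ) ≤ m + n by linarith)]
        exact abs_sub_le_of_nonneg_of_le (by linarith) (by linarith) (by linarith) (by linarith)
      · rw [abs_sub_comm (-(m : ℝ)), sub_neg_eq_add,
          abs_of_nonneg (show (0 : ℝ) ≤ n + m by linarith)]
        exact abs_sub_le_of_nonneg_of_le (by linarith) (by linarith) (by linarith) (by linarith)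
      · rw [← abs_neg]; apply le_of_eq; congr 1; ring
  have hcount : H ≤ h₁ * X ^ (2 * τ₁) ∧ R ≤ r₁ * M * X ^ (2 * τ₁) := by
    have e : H₀ = (4 * b / g) ^ 2 * X ^ (2 * τ₁) := by
      rw [hH₀, mul_div_right_comm, mul_pow, ← pow_mul, mul_comm 2]
    have hX1 : 1 ≤ X ^ (2 * τ₁) := one_le_pow₀ hX
    have hX2 : X ≤ X ^ (2 * τ₁) := le_self_pow₀ hX (by omega)
    have a1 : (H : ℝ) < H₀ + 1 := Nat.ceil_lt_add_one (by positivity)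
    have a2 : (R : ℝ) < H₀ + 2 * M * X + 2 * b + 1 + 1 := Nat.ceil_lt_add_one (by positivity)
    constructor
    · rw [hh₁, add_mul, ← e]; linarith
    · have b1 : 1 ≤ M * X ^ (2 * τ₁) := one_le_mul_of_one_le_of_one_le hM hX1
      have b2 : H₀ ≤ (4 * b / g) ^ 2 * (M * X ^ (2 * τ₁)) := by
        rw [e]; gcongr; exact le_mul_of_one_le_left (by positivity) hM
      have b3 : 2 * M * X ≤ 2 * (M * X ^ (2 * τ₁)) := by rw [mul_assoc]; gcongr
      have b4 : 2 * b + 2 ≤ (2 * b + 2) * (M * X ^ (2 * τ₁)) :=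
        le_mul_of_one_le_right (by positivity) b1
      have b5 : r₁ * M * X ^ (2 * τ₁) = (4 * b / g) ^ 2 * (M * X ^ (2 * τ₁))
        + 2 * (M * X ^ (2 * τ₁)) + (2 * b + 2) * (M * X ^ (2 * τ₁)) + M * X ^ (2 * τ₁) := by
        rw [hr₁, hh₁]; ring
      rw [b5]; linarith
  -- The low mode runs over `Fin H` and the other over `Fin R`; the last Boolean tells which of the
  -- two is the low one. `Nat.succPNat` accounts for modes starting at 1.
  set pr : (Fin H × Fin R) × Bool × Bool × Bool → (Bool × ℕ+) × (Bool × ℕ+) := fun q =>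
    if q.2.2.2 then ((q.2.1, Nat.succPNat q.1.1), (q.2.2.1, Nat.succPNat q.1.2))
    else ((q.2.1, Nat.succPNat q.1.2), (q.2.2.1, Nat.succPNat q.1.1)) with hpr
  refine (measure_mono (t := ⋃ q, T k (pr q).1 (pr q).2) ?_).trans
    ((volume_iUnion_fintype_le (N := 8 * ((h₁ * X ^ (2 * τ₁)) * (r₁ * M * X ^ (2 * τ₁))))
      (by positivity) ?_ fun q => hvol _ _).trans (ENNReal.ofReal_le_ofReal ?_))
  · rintro ω ⟨-, ⟨s, m⟩, ⟨t, n⟩, hω⟩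
    obtain ⟨h1, h2⟩ := hkey _ _ ω hω
    rw [abs_le] at h2
    simp only at h1 h2
    have hlt : ∀ (m : ℕ+) (B : ℝ), (m : ℝ) ≤ B → m.natPred < ⌈B⌉₊ := fun m B h => by
      have h1 : m.natPred + 1 = (m : ℕ) := PNat.natPred_add_one m
      have h3 : ((m.natPred : ℕ) : ℝ) + 1 = m := by exact_mod_cast h1
      have h2 : ((m.natPred : ℕ) : ℝ) < ⌈B⌉₊ := by linarith [Nat.le_ceil B]
      exact_mod_cast h2
    rcases h1 with h1 | h1
    · refine Set.mem_iUnion.2 ⟨((⟨m.natPred, hlt m _ h1.le⟩,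
        ⟨n.natPred, hlt n _ (by linarith)⟩), s, t, true), ?_⟩
      simpa [hpr] using hω
    · refine Set.mem_iUnion.2 ⟨((⟨n.natPred, hlt n _ h1.le⟩,
        ⟨m.natPred, hlt m _ (by linarith)⟩), s, t, false), ?_⟩
      simpa [hpr] using hω
  · simp only [Fintype.card_prod, Fintype.card_fin, Fintype.card_bool]
    push_cast
    have := mul_le_mul hcount.1 hcount.2 (Nat.cast_nonneg _) (by positivity)
    linarith
  · have e : M ^ ν = M ^ (ν - 1) * M := by rw [← pow_succ]; congr 1; omega
    rw [e, mul_pow 4 M]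
    have : X ^ (2 * τ₁) * X ^ (2 * τ₁) / X ^ τ ≤ 1 / X ^ (2 * ν) := by
      rw [div_le_div_iff₀ (by positivity) (by positivity), one_mul, ← pow_add, ← pow_add]
      exact pow_le_pow_right₀ hX (by omega)
    calc _ = 8 * (h₁ * r₁) * ((3 * ν) ^ ν * 4 ^ (ν - 1) * 2) * (M ^ (ν - 1) * M) * δ
          * (X ^ (2 * τ₁) * X ^ (2 * τ₁) / X ^ τ) := by ring
      _ ≤ _ := mul_le_mul_of_nonneg_left this (by positivity)

end Exclusion

/-! ### Measure of the nonresonant set and reducibility for most frequencies -/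

section Exclusion

open MeasureTheory

variable {ν : ℕ}

theorem norm_le_of_mem_annulus {M : ℝ} {ω : EuclideanSpace ℝ (Fin ν)} (h : ω ∈ annulus ν M) :
    ‖ω‖ ≤ 2 * M := by simpa using h.1

theorem goodSet_subset {mass g δ M : ℝ} {τ₁ τ : ℕ} {P₀ : Op (Idx ν)} (n : ℕ) :
    goodSet mass P₀ g δ τ₁ τ M n ⊆ goodSet mass P₀ g δ τ₁ τ M 0 := by
  induction n with
  | zero => exact subset_rfl
  | succ n ih => exact fun ω h => ih h.1

/-- The frequencies in the annulus that satisfy all nonresonance conditions have large measure. -/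
theorem exists_volume_compl_goodSet_le (hν : 1 ≤ ν) {mass : ℝ} (hm : 0 ≤ mass) {γ : ℝ}
    (hγ : 0 < γ) : ∃ g > 0, ∃ δ > 0, δ ≤ 1 ∧ ∃ η > 0, ∃ τ₁ τ : ℕ, ∀ M ≥ 1, ∀ P₀ : Op (Idx ν),
      (∀ n, ∀ ω ∈ goodSet mass P₀ g δ τ₁ τ M n, ∀ x : Idx ν,
        Real.sqrt x.2.2 * ‖(kamState (freq mass ω) P₀ (n + 1)).1 x‖ ≤ η) →
      (∀ n, ∀ ω ∈ goodSet mass P₀ g δ τ₁ τ M n, ∀ ω' ∈ goodSet mass P₀ g δ τ₁ τ M n,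
        ∀ x : Idx ν, ‖(kamState (freq mass ω) P₀ (n + 1)).1 x
          - (kamState (freq mass ω') P₀ (n + 1)).1 x‖ ≤ η * dist ω ω') →
      (∀ n, ∀ ω ∈ goodSet mass P₀ g δ τ₁ τ M n, ∀ κ, ∀ x,
        (kamState (freq mass ω) P₀ (n + 1)).1 (shift κ x)
          = (kamState (freq mass ω) P₀ (n + 1)).1 x) →
      volume (annulus ν M \ ⋂ n, goodSet mass P₀ g δ τ₁ τ M n)
        ≤ ENNReal.ofReal γ * volume (annulus ν M) := by
  obtain ⟨K, hK0, hK⟩ := exists_tsum_kabs_le ν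
  obtain ⟨c, hc0, hc⟩ := exists_le_volume_annulus hν
  set B : ℝ := (3 * ν) ^ ν * 4 ^ (ν - 1) * 2 with hB
  have hB0 : 0 < B := by positivity
  -- First g, then δ depending on g: the two small divisor sets together and the union of the
  -- resonant sets each take at most half of γ c M^ν. The resonant sets have thresholds δ/2^n, whose
  -- sum is 2δ.
  set g : ℝ := min 1 (γ * c / (20 * B * K)) with hg
  have hg0 : 0 < g := by positivity
  have hg1 : g ≤ 1 := min_le_left _ _
  have hg2 : 10 * B * K * g ≤ γ * c / 2 := by
    have : g ≤ γ * c / (20 * B * K) := min_le_right _ _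
    rw [le_div_iff₀ (by positivity)] at this
    linarith
  obtain ⟨A, hA, δ₀, hδ₀, hδ₀1, η, hη, hres⟩ := exists_volume_resonant_le (ν := ν) hm hg0 hg1
    (τ₁ := 2 * ν + 1) (τ := 4 * (2 * ν + 1) + 2 * ν) (by omega) le_rfl hK hν
  set δ : ℝ := min δ₀ (γ * c / (4 * A * K)) with hδ
  have hδ0 : 0 < δ := by positivity
  have hδ2 : 2 * A * K * δ ≤ γ * c / 2 := by
    have : δ ≤ γ * c / (4 * A * K) := min_le_right _ _
    rw [le_div_iff₀ (by positivity)] at this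
    linarith
  refine ⟨g, hg0, δ, hδ0, (min_le_left _ _).trans hδ₀1, η, hη, 2 * ν + 1,
    4 * (2 * ν + 1) + 2 * ν, fun M hM P₀ h1 h2 h3 => ?_⟩
  set G := goodSet mass P₀ g δ (2 * ν + 1) (4 * (2 * ν + 1) + 2 * ν) M with hG
  have hM0 : 0 < M := by linarith
  set E₁ : Set (EuclideanSpace ℝ (Fin ν)) := {ω | ‖ω‖ ≤ 2 * M ∧
      ∃ k, k ≠ 0 ∧ |dotk ω k| * (1 + kabs k) ^ (2 * ν + 1) < g * M} with hE₁
  set E₂ : Set (EuclideanSpace ℝ (Fin ν)) := {ω | ‖ω‖ ≤ 2 * M ∧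
      ∃ k, k ≠ 0 ∧ ∃ l : ℤ, |dotk ω k + l| * (1 + kabs k) ^ (2 * ν + 1) < g} with hE₂
  -- The unperturbed resonances are estimated inside S₀, where only the integer condition is
  -- imposed. The set T (n + 1) is estimated inside `G n`, the domain where the corrections after n
  -- + 1 steps are controlled.
  set S₀ : Set (EuclideanSpace ℝ (Fin ν)) := {ω | ω ∈ annulus ν M ∧
      ∀ k : Fin ν → ℤ, k ≠ 0 → ∀ l : ℤ, g ≤ |dotk ω k + l| * (1 + kabs k) ^ (2 * ν + 1)} with hS₀
  set S : ℕ → Set (EuclideanSpace ℝ (Fin ν)) := fun n => n.casesOn S₀ G with hS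
  set z : ℕ → EuclideanSpace ℝ (Fin ν) → Idx ν → ℂ := fun n => n.casesOn (fun _ _ => 0)
    fun m ω => (kamState (freq mass ω) P₀ (m + 1)).1 with hz
  set T : ℕ → Set (EuclideanSpace ℝ (Fin ν)) := fun n => {ω | ω ∈ S n ∧ ∃ x y : Idx ν, x ≠ y ∧
      ‖(freq mass ω x + z n ω x - (freq mass ω y + z n ω y) : ℂ)‖
        * (1 + kabs (x.1 - y.1)) ^ (4 * (2 * ν + 1) + 2 * ν) < δ / 2 ^ n} with hT
  have hG0 : ∀ n, ∀ ω ∈ G n, ω ∈ S₀ := fun n ω hω => by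
    obtain ⟨a1, a2, a3, a4⟩ := goodSet_subset n hω
    exact ⟨a1, a3⟩
  have hTvol : ∀ n, volume (T n) ≤ ENNReal.ofReal (A * M ^ ν * (δ / 2 ^ n) * K) := by
    intro n
    refine hres M hM (δ / 2 ^ n) (by positivity) ((div_le_self hδ0.le
      (one_le_pow₀ one_le_two)).trans (min_le_left _ _)) (S n) (z n) ?_ ?_ ?_ ?_ ?_
    · cases n with
      | zero => exact fun ω hω => norm_le_of_mem_annulus hω.1
      | succ n => exact fun ω hω => norm_le_of_mem_annulus (hG0 n ω hω).1
    · cases n with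
      | zero => exact fun ω hω => hω.2
      | succ n => exact fun ω hω => (hG0 n ω hω).2
    · cases n with
      | zero => intro ω _ x; simp [hz, hη.le]
      | succ n => exact h1 n
    · cases n with
      | zero => 
        intro ω _ ω' _ x
        change ‖(0 : ℂ) - 0‖ ≤ η * dist ω ω'
        rw [sub_self, norm_zero]; positivity
      | succ n => exact h2 n
    · cases n with
      | zero => intro ω _ κ x; rfl
      | succ n => exact h3 n
  have hsub : annulus ν M \ ⋂ n, G n ⊆ (E₁ ∪ E₂) ∪ ⋃ n, T n := by
    rintro ω ⟨hω, hn⟩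
    by_contra hcon
    simp only [Set.mem_union, Set.mem_iUnion, not_or, not_exists] at hcon
    obtain ⟨⟨c1, c2⟩, c3⟩ := hcon
    have hωn := norm_le_of_mem_annulus hω
    have d1 : ∀ k : Fin ν → ℤ, k ≠ 0 → g * M ≤ |dotk ω k| * (1 + kabs k) ^ (2 * ν + 1) := by
      intro k hk
      by_contra! h
      exact c1 ⟨hωn, k, hk, h⟩
    have d2 : ω ∈ S₀ := by
      refine ⟨hω, fun k hk l => ?_⟩
      by_contra! h
      exact c2 ⟨hωn, k, hk, l, h⟩
    have d3 : ∀ n, ω ∈ S n → ∀ x y : Idx ν, x ≠ y → δ / 2 ^ n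
        ≤ ‖(freq mass ω x + z n ω x - (freq mass ω y + z n ω y) : ℂ)‖
        * (1 + kabs (x.1 - y.1)) ^ (4 * (2 * ν + 1) + 2 * ν) := by
      intro n hs x y hxy
      by_contra! h
      exact c3 n ⟨hs, x, y, hxy, h⟩
    refine hn (Set.mem_iInter.2 fun n => ?_)
    induction n with
    | zero =>
      refine ⟨hω, d1, d2.2, fun x y hxy => ?_⟩
      have := d3 0 d2 x y hxy
      change _ ≤ ‖(freq mass ω x + 0 - (freq mass ω y + 0) : ℂ)‖ * _ at this
      rwa [pow_zero, div_one, add_zero, add_zero, ← Complex.ofReal_sub, Complex.norm_real, Real.norm_eq_abs] at this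
    | succ n ih => exact ⟨ih, d3 (n + 1) ih⟩
  have hTsum : volume (⋃ n, T n) ≤ ENNReal.ofReal (2 * A * K * δ * M ^ ν) := by
    refine (measure_iUnion_le T).trans ((ENNReal.tsum_le_tsum hTvol).trans ?_)
    have hs : HasSum (fun n : ℕ => A * M ^ ν * (δ / 2 ^ n) * K) (2 * A * K * δ * M ^ ν) := by
      rw [show 2 * A * K * δ * M ^ ν = A * M ^ ν * δ * K * 2 by ring,
        show (fun n : ℕ => A * M ^ ν * (δ / 2 ^ n) * K)
          = fun n : ℕ => A * M ^ ν * δ * K * (1 / 2) ^ n by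
          funext n; rw [div_pow, one_pow]; ring]
      exact hasSum_geometric_two.mul_left _
    rw [← ENNReal.ofReal_tsum_of_nonneg (fun n => by positivity) hs.summable, hs.tsum_eq]
  have e1 := volume_small_divisor_le (ν := ν) (g := g) (τ₁ := 2 * ν + 1) (by omega) hM hg0 hK hν
  have e2 := volume_integer_divisor_le (ν := ν) (τ₁ := 2 * ν + 1) le_rfl hM hg0 hg1 hK hν
  calc volume (annulus ν M \ ⋂ n, G n) ≤ volume E₁ + volume E₂ + volume (⋃ n, T n) :=
        (measure_mono hsub).trans ((measure_union_le _ _).trans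
          (add_le_add (measure_union_le _ _) le_rfl))
    _ ≤ ENNReal.ofReal (B * g * M ^ ν * K) + ENNReal.ofReal (9 * B * g * M ^ ν * K)
        + ENNReal.ofReal (2 * A * K * δ * M ^ ν) := add_le_add (add_le_add e1 e2) hTsum
    _ = ENNReal.ofReal (B * g * M ^ ν * K + 9 * B * g * M ^ ν * K + 2 * A * K * δ * M ^ ν) := by
        rw [ENNReal.ofReal_add (by positivity) (by positivity),
          ENNReal.ofReal_add (by positivity) (by positivity)]
    _ ≤ ENNReal.ofReal (γ * (c * M ^ ν)) := by
        refine ENNReal.ofReal_le_ofReal ?_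
        have p : 0 < M ^ ν := by positivity
        nlinarith
    _ = ENNReal.ofReal γ * ENNReal.ofReal (c * M ^ ν) := ENNReal.ofReal_mul hγ.le
    _ ≤ _ := mul_le_mul' le_rfl (hc M hM)

/-- Reducibility of the Floquet operator for most frequencies. -/
theorem exists_reducible_frequencies (hν : 1 ≤ ν) {w : ℕ → ℝ≥0∞} (hw : IsNatWeight w)
    {mass ρ p γ : ℝ} (hm : 0 ≤ mass) (hρ : 0 < ρ) (hp : 0 < p) (hγ : 0 < γ) :
    ∃ M₁ > 1, ∃ C > 0, ∀ M ≥ M₁, ∀ P₀ : Op (Idx ν), wnorm (wtBig w ρ) P₀ ≤ ENNReal.ofReal p →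
      (∀ x y : Idx ν, x.1 = y.1 → entry P₀ x y = 0) → (∀ κ, Inv (shift κ) P₀) →
      ∃ Ω ⊆ annulus ν M, MeasurableSet Ω ∧
        volume (annulus ν M \ Ω) ≤ ENNReal.ofReal γ * volume (annulus ν M) ∧
        ∀ ω ∈ Ω, ∃ (Y : Op (Idx ν)) (z : Idx ν → ℂ),
          wnorm (wt w (ρ / 2)) Y ≤ ENNReal.ofReal (C / Real.sqrt M) ∧
          wnorm (wt w (ρ / 2)) Y ≤ 1 / 2 ∧ Conj (freq mass ω) P₀ (1 + Y) z 0 ∧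
          ∀ κ, Inv (shift κ) Y ∧ ∀ x, z (shift κ x) = z x := by
  obtain ⟨g, hg, δ, hδ, hδ1, η, hη, τ₁, τ, hvol⟩ := exists_volume_compl_goodSet_le hν hm hγ
  obtain ⟨M₁, hM₁, C, hC, hred⟩ := reducibility (ν := ν) hw hm hρ hδ hδ1 hg hη hp τ₁ τ
  refine ⟨M₁ + 1, by linarith, C, hC, fun M hM P₀ hP hP0 hPs => ?_⟩
  obtain ⟨a1, a2, a3, a4⟩ := hred M (by linarith) P₀ hP hP0
  have hv := hvol M (by linarith) P₀ a1 a2 fun n ω hω κ => a3 n ω hω κ (hPs κ)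
  set N := annulus ν M \ ⋂ n, goodSet mass P₀ g δ τ₁ τ M n with hN
  have hmeas : MeasurableSet (annulus ν M) :=
    Metric.isClosed_closedBall.measurableSet.diff Metric.isOpen_ball.measurableSet
  -- The exceptional set is only known through its outer measure, so a measurable hull of the same
  -- measure is removed instead.
  refine ⟨annulus ν M \ toMeasurable volume N, Set.sdiff_subset,
    hmeas.diff (measurableSet_toMeasurable _ _), ?_, fun ω hω => ?_⟩
  · rw [Set.sdiff_sdiff_right_self]
    refine (measure_mono Set.inter_subset_right).trans ?_
    rwa [measure_toMeasurable]
  · obtain ⟨Y, z, b1, b2, b3, b4⟩ := a4 ω fun n => by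
      by_contra h
      exact hω.2 (subset_toMeasurable _ _ ⟨hω.1, fun h' => h (Set.mem_iInter.1 h' n)⟩)
    exact ⟨Y, z, b1, b2, b3, fun κ => b4 κ (hPs κ)⟩

end Exclusion

/-! ### Fourier series of periodic functions -/

section FourierSeries

open MeasureTheory Complex

/-- Move the segment [0, 1] to imaginary part ∓σ, with sign opposite to that of n, where the
exponential has modulus e^{-2πσ|n|}. The vertical sides cancel because periodicity extends from the
real line to the strip by the identity theorem. -/
theorem norm_integral_exp_mul_le {g : ℂ → ℂ} {σ C : ℝ} (hσ : 0 ≤ σ)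
    (hg : AnalyticOnNhd ℂ g {z | |z.im| ≤ σ}) (hb : ∀ z : ℂ, |z.im| ≤ σ → ‖g z‖ ≤ C)
    (hper : ∀ t : ℝ, g (t + 1) = g t) (n : ℤ) :
    ‖∫ s in (0 : ℝ)..1, cexp (-(2 * Real.pi * I * n * s)) * g s‖
      ≤ C * Real.exp (-(2 * Real.pi * σ * |(n : ℝ)|)) := by
  set U : Set ℂ := {z | |z.im| ≤ σ} with hU
  have hconv : Convex ℝ U := by
    have : U = Complex.imLm ⁻¹' Set.Icc (-σ) σ := by ext z; simp [hU, abs_le]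
    rw [this]
    exact (convex_Icc _ _).linear_preimage _
  have hper' : ∀ z ∈ U, g (z + 1) = g z := by
    have hg1 : AnalyticOnNhd ℂ (fun z => g (z + 1)) U :=
      hg.comp (fun z _ => analyticAt_id.add analyticAt_const) fun z hz => by
        simpa [hU] using hz
    refine hg1.eqOn_of_preconnected_of_frequently_eq hg hconv.isPreconnected
      (z₀ := 0) (by simpa [hU] using hσ) ?_
    have ht : Filter.Tendsto (fun t : ℝ => (t : ℂ)) (nhdsWithin 0 {0}ᶜ) (nhdsWithin 0 {0}ᶜ) := by
      refine tendsto_nhdsWithin_iff.2 ⟨?_, ?_⟩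
      · have := (continuous_ofReal.tendsto 0).mono_left (nhdsWithin_le_nhds (s := {0}ᶜ))
        simpa using this
      · filter_upwards [self_mem_nhdsWithin] with t ht
        simpa using ht
    exact ht.frequently (Filter.Eventually.frequently (Filter.Eventually.of_forall fun t => hper t))
  set s : ℝ := if 0 ≤ n then -σ else σ with hs
  have hs1 : |s| = σ := by
    rw [hs]; split_ifs <;> simp [abs_of_nonneg hσ]
  have hs2 : (n : ℝ) * s = -(σ * |(n : ℝ)|) := by
    rw [hs]; split_ifs with h
    · rw [abs_of_nonneg (by exact_mod_cast h)]; ring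
    · rw [abs_of_neg (by exact_mod_cast not_le.1 h)]; ring
  set F : ℂ → ℂ := fun z => cexp (-(2 * Real.pi * I * n * z)) * g z with hF
  have hFper : ∀ z ∈ U, F (z + 1) = F z := fun z hz => by
    simp only [hF]
    rw [hper' z hz]
    congr 1
    rw [Complex.exp_eq_exp_iff_exists_int]
    exact ⟨-n, by push_cast; ring⟩
  have hFd : DifferentiableOn ℂ F U := by
    refine DifferentiableOn.mul ?_ hg.differentiableOn
    fun_prop
  have hrect := integral_boundary_rect_eq_zero_of_differentiableOn F 0 (1 + s * I) (hFd.mono ?_)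
  · simp only [zero_re, zero_im, ofReal_zero, zero_mul, add_zero, add_re, one_re, mul_re, ofReal_re,
      I_re, mul_zero, ofReal_im, I_im, mul_one, sub_self, add_im, one_im, mul_im, zero_add,
      ofReal_one] at hrect
    have hv : ∫ y in (0 : ℝ)..s, F (1 + y * I) = ∫ y in (0 : ℝ)..s, F (y * I) := by
      refine intervalIntegral.integral_congr fun y hy => ?_
      have : |y| ≤ σ := by
        rw [← hs1]
        rcases Set.mem_uIcc.1 hy with h | h
        · exact abs_le_abs_of_nonneg h.1 h.2
        · rw [abs_of_nonpos h.2, abs_of_nonpos (h.1.trans h.2)]; linarith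
      rw [add_comm]
      exact hFper _ (by simpa [hU] using this)
    rw [hv, add_sub_cancel_right, sub_eq_zero] at hrect
    change ‖∫ s in (0 : ℝ)..1, F s‖ ≤ _
    rw [hrect]
    have := intervalIntegral.norm_integral_le_of_norm_le_const (a := (0 : ℝ)) (b := 1)
      (f := fun x : ℝ => F (x + s * I)) (C := C * Real.exp (-(2 * Real.pi * σ * |(n : ℝ)|)))
      fun x _ => ?_
    · simpa using this
    · simp only [hF]
      rw [norm_mul, mul_comm, Complex.norm_exp]
      refine mul_le_mul (hb _ ?_) (le_of_eq ?_) (Real.exp_nonneg _)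
        ((norm_nonneg _).trans (hb 0 (by simpa using hσ)))
      · simp [hs1]
      · congr 1
        simp
        linear_combination 2 * Real.pi * hs2
  · intro z hz
    obtain ⟨-, h2⟩ := hz
    simp only [Set.mem_preimage, zero_im, add_im, one_im, mul_im, ofReal_re, I_im, mul_one,
      ofReal_im, I_re, mul_zero, add_zero, zero_add] at h2
    change |z.im| ≤ σ
    rw [← hs1]
    rcases Set.mem_uIcc.1 h2 with h | h
    · exact abs_le_abs_of_nonneg h.1 h.2
    · rw [abs_of_nonpos h.2, abs_of_nonpos (h.1.trans h.2)]; linarith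

variable {ν : ℕ}

/-- The half-open unit cube with corner `a`. -/
def cube (a : Fin ν → ℝ) : Set (Fin ν → ℝ) := {y | ∀ i, y i ∈ Set.Ioc (a i) (a i + 1)}

/-- The character `y ↦ exp (2π i k · y)`. -/
def expChar (k : Fin ν → ℤ) (y : Fin ν → ℝ) : ℂ := cexp (2 * Real.pi * I * ∑ i, (k i : ℂ) * y i)

/-- The Fourier coefficients of a function that is `1`-periodic in every coordinate. -/
def fcoef (u : (Fin ν → ℝ) → ℂ) (k : Fin ν → ℤ) : ℂ := ∫ y in cube 0, expChar (-k) y * u y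

theorem continuous_expChar (k : Fin ν → ℤ) : Continuous (expChar k) := by
  unfold expChar; fun_prop

theorem norm_expChar (k : Fin ν → ℤ) (y : Fin ν → ℝ) : ‖expChar k y‖ = 1 := by
  have : expChar k y = cexp ((2 * Real.pi * ∑ i, (k i : ℝ) * y i : ℝ) * I) := by
    unfold expChar; push_cast; congr 1; ring
  rw [this, Complex.norm_exp_ofReal_mul_I]

theorem expChar_add (k : Fin ν → ℤ) (y y' : Fin ν → ℝ) :
    expChar k (y + y') = expChar k y * expChar k y' := by
  unfold expChar
  rw [← Complex.exp_add, ← mul_add, ← Finset.sum_add_distrib]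
  congr 2
  exact Finset.sum_congr rfl fun i _ => by push_cast [Pi.add_apply]; ring

theorem expChar_single (k : Fin ν → ℤ) (i : Fin ν) (s : ℝ) :
    expChar k (Pi.single i s) = cexp (2 * Real.pi * I * k i * s) := by
  unfold expChar
  rw [Finset.sum_eq_single i]
  · simp; ring_nf
  · intro j _ hj; simp [Pi.single_eq_of_ne hj]
  · simp

theorem mFourier_coe (k : Fin ν → ℤ) (y : Fin ν → ℝ) :
    UnitAddTorus.mFourier k (fun i => (y i : UnitAddCircle)) = expChar k y := by
  simp only [UnitAddTorus.mFourier, ContinuousMap.coe_mk, fourier_coe_apply, expChar]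
  rw [← Complex.exp_sum, Finset.mul_sum]
  congr 1
  refine Finset.sum_congr rfl fun i _ => ?_
  push_cast; ring

theorem isOpenQuotientMap_torus :
    IsOpenQuotientMap fun (y : Fin ν → ℝ) (i : Fin ν) => (y i : UnitAddCircle) :=
  IsOpenQuotientMap.piMap fun _ => QuotientAddGroup.isOpenQuotientMap_mk

theorem add_int_eq {u : (Fin ν → ℝ) → ℂ} (hper : ∀ i y, u (y + Pi.single i 1) = u y)
    (n : Fin ν → ℤ) (y : Fin ν → ℝ) : u (y + fun i => (n i : ℝ)) = u y := by
  have h1 : ∀ (i : Fin ν) (m : ℤ) y, u (y + Pi.single i (m : ℝ)) = u y := by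
    intro i m y
    have hp : Function.Periodic (fun t : ℝ => u (y + Pi.single i t)) 1 := fun t => by
      change u (y + Pi.single i (t + 1)) = _
      rw [Pi.single_add, ← add_assoc, hper]
    have := hp.int_mul m 0
    simpa using this
  have h2 : ∀ (s : Finset (Fin ν)) y, u (y + ∑ i ∈ s, Pi.single i (n i : ℝ)) = u y := by
    intro s
    induction s using Finset.induction_on with
    | empty => simp
    | insert i s hi ih =>
      intro y
      rw [Finset.sum_insert hi, ← add_assoc, ih, h1]
  rw [← h2 Finset.univ y, Finset.univ_sum_single (fun i => (n i : ℝ))]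

theorem exists_lift {u : (Fin ν → ℝ) → ℂ} (hu : Continuous u)
    (hper : ∀ i y, u (y + Pi.single i 1) = u y) :
    ∃ f : C(UnitAddTorus (Fin ν), ℂ), ∀ y : Fin ν → ℝ, f (fun i => (y i : UnitAddCircle)) = u y := by
  set π : (Fin ν → ℝ) → UnitAddTorus (Fin ν) := fun y i => (y i : UnitAddCircle) with hπ
  have hq : IsOpenQuotientMap π := isOpenQuotientMap_torus
  have hf : ∀ y, u (Function.surjInv hq.surjective (π y)) = u y := fun y => by
    have h1 : π (Function.surjInv hq.surjective (π y)) = π y := Function.surjInv_eq _ _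
    have h2 : ∀ i, ∃ m : ℤ, (m : ℝ) = (Function.surjInv hq.surjective (π y)) i - y i := fun i => by
      have h3 := congrFun h1 i
      simp only [hπ] at h3
      rw [← sub_eq_zero, ← AddCircle.coe_sub, AddCircle.coe_eq_zero_iff] at h3
      obtain ⟨m, hm⟩ := h3
      exact ⟨m, by rw [← hm, zsmul_eq_mul, mul_one]⟩
    choose m hm using h2
    have h4 : Function.surjInv hq.surjective (π y) = y + fun i => (m i : ℝ) := by
      funext i; simp [hm]
    rw [h4, add_int_eq hper]
  refine ⟨⟨fun t => u (Function.surjInv hq.surjective t), ?_⟩, hf⟩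
  refine hq.isQuotientMap.continuous_iff.2 ?_
  refine hu.congr fun y => (hf y).symm

theorem volume_cube (a : Fin ν → ℝ) : volume (cube a) = 1 := by
  have : cube a = Set.univ.pi fun i => Set.Ioc (a i) (a i + 1) := by ext; simp [cube]
  rw [this, volume_pi_pi]
  simp

theorem cube_subset_Icc (a : Fin ν → ℝ) : cube a ⊆ Set.Icc a (a + 1) :=
  fun _ hy => ⟨fun i => (hy i).1.le, fun i => (hy i).2⟩

theorem mFourierCoeff_eq {u : (Fin ν → ℝ) → ℂ} {f : C(UnitAddTorus (Fin ν), ℂ)}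
    (hf : ∀ y : Fin ν → ℝ, f (fun i => (y i : UnitAddCircle)) = u y) (k : Fin ν → ℤ)
    (a : Fin ν → ℝ) :
    UnitAddTorus.mFourierCoeff f k = ∫ y in cube a, expChar (-k) y * u y := by
  rw [UnitAddTorus.mFourierCoeff_eq_integral f k a]
  simp_rw [mFourier_coe, hf, smul_eq_mul]
  rfl

theorem hasSum_fcoef {u : (Fin ν → ℝ) → ℂ} (hu : Continuous u)
    (hper : ∀ i y, u (y + Pi.single i 1) = u y) (hs : Summable (fcoef u)) (y : Fin ν → ℝ) :
    HasSum (fun k => fcoef u k * expChar k y) (u y) := by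
  obtain ⟨f, hf⟩ := exists_lift hu hper
  have e : UnitAddTorus.mFourierCoeff f = fcoef u := funext fun k => mFourierCoeff_eq hf k 0
  have := UnitAddTorus.hasSum_mFourier_series_apply_of_summable (f := f) (by rwa [e])
    (fun i => (y i : UnitAddCircle))
  rw [hf, e] at this
  simpa only [mFourier_coe, smul_eq_mul] using this

theorem fcoef_eq_translate {u : (Fin ν → ℝ) → ℂ} (hu : Continuous u)
    (hper : ∀ i y, u (y + Pi.single i 1) = u y) (k : Fin ν → ℤ) (c : Fin ν → ℝ) :
    fcoef u k = ∫ y in cube 0, expChar (-k) (y + c) * u (y + c) := by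
  obtain ⟨f, hf⟩ := exists_lift hu hper
  have h1 := (measurePreserving_add_right volume c).setIntegral_preimage_emb
    (MeasurableEquiv.addRight c).measurableEmbedding (fun y => expChar (-k) y * u y) (cube c)
  have h2 : (fun y => y + c) ⁻¹' cube c = cube 0 := by
    ext y
    simp only [cube, Set.mem_preimage, Set.mem_ofPred_eq, Set.mem_Ioc, Pi.add_apply, Pi.zero_apply]
    refine forall_congr' fun i => ⟨fun h => ⟨by linarith [h.1], by linarith [h.2]⟩,
      fun h => ⟨by linarith [h.1], by linarith [h.2]⟩⟩
  rw [h2] at h1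
  rw [h1, ← mFourierCoeff_eq hf k c, mFourierCoeff_eq hf k 0, fcoef]

/-- Translating the cube does not change the coefficient. Averaging over translations in the i-th
direction and applying Fubini leaves a one-dimensional integral in that direction. -/
theorem norm_fcoef_le {u : (Fin ν → ℝ) → ℂ} (hu : Continuous u)
    (hper : ∀ i y, u (y + Pi.single i 1) = u y) (k : Fin ν → ℤ) (i : Fin ν) {B : ℝ}
    (hB : ∀ y : Fin ν → ℝ, ‖∫ s in (0 : ℝ)..1, cexp (-(2 * Real.pi * I * k i * s))
      * u (y + Pi.single i s)‖ ≤ B) : ‖fcoef u k‖ ≤ B := by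
  have h1 : fcoef u k = ∫ s in (0 : ℝ)..1, ∫ y in cube 0,
      expChar (-k) (y + Pi.single i s) * u (y + Pi.single i s) := by
    rw [← intervalIntegral.integral_congr fun s _ => fcoef_eq_translate hu hper k (Pi.single i s)]
    simp
  have hcont : Continuous fun q : ℝ × (Fin ν → ℝ) =>
      expChar (-k) (q.2 + Pi.single i q.1) * u (q.2 + Pi.single i q.1) := by
    have : Continuous fun q : ℝ × (Fin ν → ℝ) => q.2 + Pi.single i q.1 :=
      continuous_snd.add ((continuous_single i).comp continuous_fst)
    exact ((continuous_expChar _).comp this).mul (hu.comp this)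
  have h2 : fcoef u k = ∫ y in cube 0, ∫ s in (0 : ℝ)..1,
      expChar (-k) (y + Pi.single i s) * u (y + Pi.single i s) := by
    rw [h1]
    simp only [intervalIntegral.integral_of_le zero_le_one]
    refine integral_integral_swap ?_
    rw [Measure.prod_restrict]
    exact (hcont.continuousOn.integrableOn_compact
      ((isCompact_Icc (a := (0 : ℝ)) (b := 1)).prod (isCompact_Icc (a := (0 : Fin ν → ℝ)) (b := 0 + 1)))).mono_set
      (Set.prod_mono Set.Ioc_subset_Icc_self (cube_subset_Icc 0))
  rw [h2]
  refine (norm_setIntegral_le_of_norm_le_const (C := B) (by rw [volume_cube]; simp)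
    fun y _ => ?_).trans (by rw [Measure.real, volume_cube]; simp)
  have : ∫ s in (0 : ℝ)..1, expChar (-k) (y + Pi.single i s) * u (y + Pi.single i s)
      = expChar (-k) y * ∫ s in (0 : ℝ)..1, cexp (-(2 * Real.pi * I * k i * s))
      * u (y + Pi.single i s) := by
    rw [← intervalIntegral.integral_const_mul]
    refine intervalIntegral.integral_congr fun s _ => ?_
    rw [expChar_add, expChar_single, mul_assoc]
    congr 3
    simp
  rw [this, norm_mul, norm_expChar, one_mul]
  exact hB y

theorem norm_fcoef_le_of_bound {u : (Fin ν → ℝ) → ℂ} {B : ℝ} (hB : ∀ y, ‖u y‖ ≤ B)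
    (k : Fin ν → ℤ) : ‖fcoef u k‖ ≤ B := by
  refine (norm_setIntegral_le_of_norm_le_const (C := B) (by rw [volume_cube]; simp)
    fun y _ => ?_).trans (by rw [Measure.real, volume_cube]; simp)
  rw [norm_mul, norm_expChar, one_mul]
  exact hB y

theorem conj_fcoef {u : (Fin ν → ℝ) → ℂ} (hu : ∀ y, starRingEnd ℂ (u y) = u y) (k : Fin ν → ℤ) :
    starRingEnd ℂ (fcoef u k) = fcoef u (-k) := by
  unfold fcoef
  rw [← integral_conj]
  refine integral_congr_ae (Filter.Eventually.of_forall fun y => ?_)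
  simp only [map_mul, hu]
  congr 1
  unfold expChar
  rw [← Complex.exp_conj]
  congr 1
  simp only [map_neg, map_mul, map_ofNat, conj_ofReal, conj_I, map_sum, map_intCast, Pi.neg_apply,
    Int.cast_neg, neg_neg, neg_mul, mul_neg, Finset.sum_neg_distrib]

end FourierSeries

/-! ### Cosine coefficients of even functions -/

section Cosine

open MeasureTheory Complex

/-- The cosine coefficients of a function on `[0, π]`. -/
def cosCoef (f : ℝ → ℂ) (l : ℕ) : ℂ :=
  (1 / (Real.pi : ℂ)) * ∫ x in (0 : ℝ)..Real.pi, f x * (Real.cos (l * x) : ℂ)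

theorem neg_pi_lt_pi : -Real.pi < Real.pi := by linarith [Real.pi_pos]

theorem fourierCoeffOn_neg_pi_pi (f : ℝ → ℂ) (l : ℤ) :
    fourierCoeffOn neg_pi_lt_pi f l
      = (1 / (2 * Real.pi : ℂ)) * ∫ x in (-Real.pi)..Real.pi, cexp (-(l * x * I)) * f x := by
  rw [fourierCoeffOn_eq_integral, real_smul]
  congr 1
  · push_cast; congr 1; ring
  · refine intervalIntegral.integral_congr fun x _ => ?_
    rw [fourier_coe_apply, smul_eq_mul]
    congr 2
    have : (Real.pi : ℂ) ≠ 0 := by exact_mod_cast Real.pi_pos.ne'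
    push_cast
    field_simp
    ring

theorem norm_fourierCoeffOn_le {f : ℝ → ℂ} {C : ℝ} (hf : ∀ x, ‖f x‖ ≤ C) (l : ℤ) :
    ‖fourierCoeffOn neg_pi_lt_pi f l‖ ≤ C := by
  have h := intervalIntegral.norm_integral_le_of_norm_le_const (a := -Real.pi) (b := Real.pi)
    (f := fun x : ℝ => cexp (-(l * x * I)) * f x) (C := C) fun x _ => by
      have : -((l : ℂ) * x * I) = ((-(l * x) : ℝ) : ℂ) * I := by push_cast; ring
      rw [norm_mul, this, Complex.norm_exp_ofReal_mul_I, one_mul]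
      exact hf x
  rw [fourierCoeffOn_neg_pi_pi, norm_mul]
  have hp := Real.pi_pos
  have e : ‖(1 / (2 * Real.pi : ℂ))‖ = 1 / (2 * Real.pi) := by
    rw [norm_div, norm_mul, norm_one, Complex.norm_real, Real.norm_eq_abs, abs_of_pos hp]
    norm_num
  rw [e, div_mul_eq_mul_div, one_mul, div_le_iff₀ (by positivity)]
  refine h.trans (le_of_eq ?_)
  rw [abs_of_pos (by linarith)]; ring

/-- Integration by parts s times; the boundary terms cancel by periodicity. -/
theorem pow_mul_norm_fourierCoeffOn_le (s : ℕ) : ∀ {f : ℝ → ℂ} {C : ℝ},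
    ContDiff ℝ ((⊤ : ℕ∞) : WithTop ℕ∞) f → Function.Periodic f (2 * Real.pi) →
    (∀ x, ‖iteratedDeriv s f x‖ ≤ C) → ∀ l : ℤ, l ≠ 0 →
    |(l : ℝ)| ^ s * ‖fourierCoeffOn neg_pi_lt_pi f l‖ ≤ C := by
  induction s with
  | zero =>
    intro f C _ _ hC l _
    simp only [iteratedDeriv_zero] at hC
    simpa using norm_fourierCoeffOn_le hC l
  | succ s ih =>
    intro f C hf hper hC l hl
    have hd : ContDiff ℝ ((⊤ : ℕ∞) : WithTop ℕ∞) (deriv f) := by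
      refine ((contDiff_succ_iff_deriv (n := ((⊤ : ℕ∞) : WithTop ℕ∞))).1 ?_).2.2
      simpa using hf
    have hper' : Function.Periodic (deriv f) (2 * Real.pi) := fun x => by
      rw [← deriv_comp_add_const]
      congr 1
      exact funext hper
    have hC' : ∀ x, ‖iteratedDeriv s (deriv f) x‖ ≤ C := by
      rw [← iteratedDeriv_succ']; exact hC
    have h := ih hd hper' hC' l hl
    have hdiff : Differentiable ℝ f := hf.differentiable (by simp)
    have h2 := fourierCoeffOn_of_hasDerivAt neg_pi_lt_pi (f := f) (f' := deriv f) hl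
      (fun x _ => (hdiff x).hasDerivAt) (hd.continuous.intervalIntegrable _ _)
    have h3 : f Real.pi = f (-Real.pi) := by
      have := hper (-Real.pi)
      rw [← this]; congr 1; ring
    rw [h3, sub_self, mul_zero, zero_sub] at h2
    have hp : (0 : ℝ) < Real.pi := Real.pi_pos
    have hl' : (0 : ℝ) < |(l : ℝ)| := abs_pos.2 (by exact_mod_cast hl)
    have h4 : ‖fourierCoeffOn neg_pi_lt_pi f l‖
        = ‖fourierCoeffOn neg_pi_lt_pi (deriv f) l‖ / |(l : ℝ)| := by
      have e1 : ((Real.pi : ℂ) - ((-Real.pi : ℝ) : ℂ)) = ((2 * Real.pi : ℝ) : ℂ) := by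
        push_cast; ring
      rw [h2, e1]
      simp only [norm_mul, norm_div, norm_neg, norm_one, Complex.norm_real, norm_I,
        Complex.norm_intCast, Real.norm_eq_abs, abs_of_pos hp, Complex.norm_two, abs_two]
      field_simp
    rw [h4, pow_succ]
    calc _ = |(l : ℝ)| ^ s * ‖fourierCoeffOn neg_pi_lt_pi (deriv f) l‖ := by field_simp
      _ ≤ C := h

theorem cosCoef_eq_fourierCoeffOn {f : ℝ → ℂ} (hf : Continuous f) (heven : ∀ x, f (-x) = f x)
    (l : ℕ) : cosCoef f l = fourierCoeffOn neg_pi_lt_pi f l := by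
  rw [fourierCoeffOn_neg_pi_pi, cosCoef]
  have hc : Continuous fun x : ℝ => cexp (-((l : ℤ) * x * I)) * f x := by fun_prop
  have hc' : Continuous fun x : ℝ => cexp ((l : ℤ) * x * I) * f x := by fun_prop
  have h1 : ∫ x in (-Real.pi)..0, cexp (-((l : ℤ) * x * I)) * f x
      = ∫ x in (0 : ℝ)..Real.pi, cexp ((l : ℤ) * x * I) * f x := by
    have := intervalIntegral.integral_comp_neg (a := (0 : ℝ)) (b := Real.pi)
      fun x : ℝ => cexp (-((l : ℤ) * x * I)) * f x
    rw [neg_zero] at this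
    rw [← this]
    refine intervalIntegral.integral_congr fun x _ => ?_
    simp only [heven, ofReal_neg]
    congr 2; ring
  rw [← intervalIntegral.integral_add_adjacent_intervals (hc.intervalIntegrable _ 0)
    (hc.intervalIntegrable 0 _), h1, ← intervalIntegral.integral_add
    (hc'.intervalIntegrable _ _) (hc.intervalIntegrable _ _)]
  have h2 : ∫ x in (0 : ℝ)..Real.pi, (cexp ((l : ℤ) * x * I) * f x
      + cexp (-((l : ℤ) * x * I)) * f x)
      = 2 * ∫ x in (0 : ℝ)..Real.pi, f x * (Real.cos (l * x) : ℂ) := by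
    rw [← intervalIntegral.integral_const_mul]
    refine intervalIntegral.integral_congr fun x _ => ?_
    simp only [ofReal_cos, Complex.cos]
    push_cast
    rw [neg_mul]
    ring
  rw [h2]
  have : (Real.pi : ℂ) ≠ 0 := by exact_mod_cast Real.pi_pos.ne'
  field_simp

theorem one_add_pow_mul_norm_cosCoef_le {f : ℝ → ℂ} (hf : ContDiff ℝ ((⊤ : ℕ∞) : WithTop ℕ∞) f)
    (hper : Function.Periodic f (2 * Real.pi)) (heven : ∀ x, f (-x) = f x) {s : ℕ} {C₀ C : ℝ}
    (hC₀ : ∀ x, ‖f x‖ ≤ C₀) (hC : ∀ x, ‖iteratedDeriv s f x‖ ≤ C) (l : ℕ) :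
    (1 + l : ℝ) ^ s * ‖cosCoef f l‖ ≤ C₀ + 2 ^ s * C := by
  have hC0 : 0 ≤ C := (norm_nonneg _).trans (hC 0)
  have hC₀0 : 0 ≤ C₀ := (norm_nonneg _).trans (hC₀ 0)
  rw [cosCoef_eq_fourierCoeffOn hf.continuous heven]
  rcases Nat.eq_zero_or_pos l with rfl | hl
  · have := norm_fourierCoeffOn_le hC₀ ((0 : ℕ) : ℤ)
    simp only [Nat.cast_zero, add_zero, one_pow, one_mul] at this ⊢
    have : 0 ≤ 2 ^ s * C := by positivity
    linarith
  · have h := pow_mul_norm_fourierCoeffOn_le s hf hper hC (l : ℤ) (by exact_mod_cast hl.ne')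
    have h1 : (1 : ℝ) ≤ l := by exact_mod_cast hl
    have h2 : (1 + l : ℝ) ^ s ≤ 2 ^ s * |((l : ℤ) : ℝ)| ^ s := by
      rw [← mul_pow]
      have : |((l : ℤ) : ℝ)| = l := by rw [abs_of_nonneg] <;> simp
      rw [this]
      gcongr
      linarith
    calc _ ≤ 2 ^ s * |((l : ℤ) : ℝ)| ^ s * ‖fourierCoeffOn neg_pi_lt_pi f l‖ := by gcongr
      _ = 2 ^ s * (|((l : ℤ) : ℝ)| ^ s * ‖fourierCoeffOn neg_pi_lt_pi f l‖) := by ring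
      _ ≤ 2 ^ s * C := by gcongr
      _ ≤ _ := by linarith

/-- Since 2 sin(nx) sin(mx) = cos((m - n)x) - cos((m + n)x), the matrix of a multiplication operator
in the sine basis consists of cosine coefficients. Their decay is governed by the smoothness of the
even extension. -/
theorem sineCoeff_mul_sin {q : ℝ → ℝ} {f : ℝ → ℂ} (hf : Continuous f)
    (hq : ∀ x ∈ Set.Icc 0 Real.pi, (q x : ℂ) = f x) (m n : ℕ+) :
    sineCoeff (fun x => ((q x * Real.sin ((n : ℝ) * x) : ℝ) : ℂ)) m
      = cosCoef f (mdist m n) - cosCoef f (m + n) := by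
  have hc : ∀ l : ℕ, IntervalIntegrable (fun x : ℝ => f x * (Real.cos (l * x) : ℂ)) volume 0
      Real.pi := fun l => (by fun_prop : Continuous _).intervalIntegrable _ _
  unfold sineCoeff cosCoef
  rw [← mul_sub, ← intervalIntegral.integral_sub (hc _) (hc _), ← intervalIntegral.integral_const_mul,
    ← intervalIntegral.integral_const_mul]
  refine intervalIntegral.integral_congr fun x hx => ?_
  rw [Set.uIcc_of_le Real.pi_pos.le] at hx
  have h1 : Real.cos ((mdist m n : ℕ) * x) = Real.cos ((m - n : ℝ) * x) := by
    have : ((mdist m n : ℕ) : ℝ) = |(m : ℝ) - n| := by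
      rw [mdist, Nat.cast_natAbs]; push_cast; rfl
    rw [this]
    rcases abs_cases ((m : ℝ) - n) with h | h
    · rw [h.1]
    · rw [h.1, neg_mul, Real.cos_neg]
  have h2 : Real.sin ((n : ℝ) * x) * Real.sin ((m : ℝ) * x)
      = (Real.cos ((m - n : ℝ) * x) - Real.cos (((m + n : ℕ) : ℝ) * x)) / 2 := by
    push_cast
    rw [sub_mul, add_mul, Real.cos_sub, Real.cos_add]; ring
  simp only
  rw [h1]
  calc _ = 2 / (Real.pi : ℂ) * ((q x : ℂ) * ((Real.sin ((n : ℝ) * x) * Real.sin ((m : ℝ) * x) : ℝ) : ℂ)) := by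
        push_cast; ring
    _ = _ := by rw [h2, hq x hx]; push_cast; ring

end Cosine

/-! ### Fourier coefficients of the potential -/

section Potential

open MeasureTheory Complex

variable {ν : ℕ}

theorem exists_tsum_exp_kabs_le (ν : ℕ) {σ : ℝ} (hσ : 0 < σ) : ∃ K > 0,
    ∑' k : Fin ν → ℤ, ENNReal.ofReal (Real.exp (-(σ * kabs k))) ≤ ENNReal.ofReal K := by
  obtain ⟨K, hK, h⟩ := exists_tsum_kabs_le ν
  set A := (2 * ν).factorial * Real.exp σ / σ ^ (2 * ν) with hA
  refine ⟨A * K, by positivity, ?_⟩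
  rw [ENNReal.ofReal_mul (by positivity)]
  refine le_trans ?_ (mul_le_mul' le_rfl h)
  rw [← ENNReal.tsum_mul_left]
  refine ENNReal.tsum_le_tsum fun k => ?_
  rw [← ENNReal.ofReal_mul (by positivity)]
  refine ENNReal.ofReal_le_ofReal ?_
  have h1 := pow_le_exp (2 * ν) hσ (kabs_nonneg k)
  have h2 := kabs_nonneg k
  rw [mul_one_div, le_div_iff₀ (by positivity), Real.exp_neg]
  rw [← hA] at h1
  calc _ ≤ (Real.exp (σ * kabs k))⁻¹ * (A * Real.exp (σ * kabs k)) := by gcongr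
    _ = A := by field_simp

theorem summable_of_norm_le_exp {f : (Fin ν → ℤ) → ℂ} {σ C : ℝ} (hσ : 0 < σ)
    (h : ∀ k, ‖f k‖ ≤ C * Real.exp (-(σ * kabs k))) : Summable f := by
  obtain ⟨K, -, hK⟩ := exists_tsum_exp_kabs_le ν hσ
  refine Summable.of_norm_bounded (g := fun k => C * Real.exp (-(σ * kabs k)))
    (Summable.mul_left _ ?_) h
  have := ENNReal.summable_toReal (ne_top_of_le_ne_top ENNReal.ofReal_ne_top hK)
  refine this.congr fun k => ?_
  rw [ENNReal.toReal_ofReal (Real.exp_nonneg _)]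

/-- The cosine coefficients of the potential, as functions on `ℝ^ν` of period `1`. -/
def potCos (V : EuclideanSpace ℝ (Fin ν) → ℝ → ℝ) (l : ℕ) (y : Fin ν → ℝ) : ℂ :=
  cosCoef (fun x => (evenExt V (WithLp.toLp 2 ((2 * Real.pi) • y)) x : ℂ)) l

/-- The Fourier coefficients of the potential. -/
def potCoef (V : EuclideanSpace ℝ (Fin ν) → ℝ → ℝ) (k : Fin ν → ℤ) (l : ℕ) : ℂ :=
  fcoef (potCos V l) k

variable {V : EuclideanSpace ℝ (Fin ν) → ℝ → ℝ} {ρ : ℝ}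

theorem arccos_cos_mem (x : ℝ) : Real.arccos (Real.cos x) ∈ Set.Icc 0 Real.pi :=
  ⟨Real.arccos_nonneg _, Real.arccos_le_pi _⟩

theorem evenExt_eq {x : ℝ} (hx : x ∈ Set.Icc 0 Real.pi) (θ : EuclideanSpace ℝ (Fin ν)) :
    evenExt V θ x = V θ x := by
  rw [evenExt, Real.arccos_cos hx.1 hx.2]

theorem evenExt_periodic (hV : CondV1 ρ V) (i : Fin ν) (θ : EuclideanSpace ℝ (Fin ν)) (x : ℝ) :
    evenExt V (θ + EuclideanSpace.single i (2 * Real.pi)) x = evenExt V θ x :=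
  hV.1 i θ _ (arccos_cos_mem x)

theorem continuous_evenExt (hV : CondV1 ρ V) :
    Continuous fun p : (Fin ν → ℝ) × ℝ => evenExt V (WithLp.toLp 2 ((2 * Real.pi) • p.1)) p.2 := by
  have h := hV.2.1.continuous
  refine h.comp (Continuous.prodMk ?_ continuous_snd)
  exact (PiLp.continuous_toLp 2 _).comp
    (by fun_prop : Continuous fun p : (Fin ν → ℝ) × ℝ => (2 * Real.pi) • p.1)

theorem continuous_potCos (hV : CondV1 ρ V) (l : ℕ) : Continuous (potCos V l) := by
  refine continuous_const.mul ?_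
  refine intervalIntegral.continuous_parametric_intervalIntegral_of_continuous' ?_ _ _
  refine (continuous_ofReal.comp (continuous_evenExt hV)).mul ?_
  fun_prop

theorem potCos_periodic (hV : CondV1 ρ V) (l : ℕ) (i : Fin ν) (y : Fin ν → ℝ) :
    potCos V l (y + Pi.single i 1) = potCos V l y := by
  unfold potCos
  congr 1
  funext x
  rw [← evenExt_periodic hV i (WithLp.toLp 2 ((2 * Real.pi) • y))]
  congr 2
  ext j
  by_cases h : j = i
  · subst h; simp; ring
  · simp [h]

theorem conj_potCos (l : ℕ) (y : Fin ν → ℝ) :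
    starRingEnd ℂ (potCos V l y) = potCos V l y := by
  have : potCos V l y = ((1 / Real.pi * ∫ x in (0 : ℝ)..Real.pi,
      evenExt V (WithLp.toLp 2 ((2 * Real.pi) • y)) x * Real.cos (l * x) : ℝ) : ℂ) := by
    unfold potCos cosCoef
    push_cast [← intervalIntegral.integral_ofReal]
    rfl
  rw [this, conj_ofReal]

theorem conj_potCoef (k : Fin ν → ℤ) (l : ℕ) :
    starRingEnd ℂ (potCoef V k l) = potCoef V (-k) l :=
  conj_fcoef (conj_potCos l) k

theorem exists_norm_potCos_le (hρ : 0 < ρ) (hV : CondV1 ρ V) (s : ℕ) : ∃ C > 0, ∀ (l : ℕ) y,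
    (1 + l : ℝ) ^ s * ‖potCos V l y‖ ≤ C := by
  obtain ⟨-, -, W, hW, -, hWs, hWb⟩ := hV
  obtain ⟨C₀, hC₀, h₀⟩ := hWb 0
  obtain ⟨C, hC, h⟩ := hWb s
  refine ⟨C₀ + 2 ^ s * C, by positivity, fun l y => ?_⟩
  set θ : EuclideanSpace ℝ (Fin ν) := WithLp.toLp 2 ((2 * Real.pi) • y) with hθ
  have hmem : (WithLp.toLp 2 fun i => (θ i : ℂ) : EuclideanSpace ℂ (Fin ν)) ∈ strip ν ρ := by
    simp [strip, hρ.le]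
  have e : (fun x => (evenExt V θ x : ℂ)) = W (WithLp.toLp 2 fun i => (θ i : ℂ)) :=
    funext fun x => (hW θ x).symm
  unfold potCos
  rw [← hθ, e]
  refine one_add_pow_mul_norm_cosCoef_le (hWs _ hmem) ?_ ?_ (fun x => ?_) (h _ hmem) l
  · intro x; rw [hW, hW]; simp [evenExt]
  · intro x; rw [hW, hW]; simp [evenExt]
  · simpa using h₀ _ hmem x

/-- Shift the contour in one coordinate only, so that the Euclidean condition defining `strip`
becomes a condition on a single imaginary part. Rescaling the period 2π to 1 turns the width ρ into
ρ/(2π). -/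
theorem exists_norm_potCoef_le (hρ : 0 < ρ) (hV : CondV1 ρ V) : ∃ C > 0, ∀ k l i,
    ‖potCoef V k l‖ ≤ C * Real.exp (-(ρ * |(k i : ℝ)|)) := by
  have hcont := continuous_potCos hV
  have hpp := potCos_periodic hV
  have hce := continuous_evenExt hV
  have hpe := evenExt_periodic hV
  obtain ⟨-, -, W, hW, hWa, -, hWb⟩ := hV
  obtain ⟨C, hC, hb⟩ := hWb 0
  refine ⟨C, hC, fun k l i => norm_fcoef_le (hcont l) (hpp l) k i fun y => ?_⟩
  have hp := Real.pi_pos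
  have hswap : ∫ s in (0 : ℝ)..1, cexp (-(2 * Real.pi * I * k i * s))
        * potCos V l (y + Pi.single i s)
      = (1 / (Real.pi : ℂ)) * ∫ x in (0 : ℝ)..Real.pi, (Real.cos (l * x) : ℂ)
        * ∫ s in (0 : ℝ)..1, cexp (-(2 * Real.pi * I * k i * s))
          * (evenExt V (WithLp.toLp 2 ((2 * Real.pi) • (y + Pi.single i s))) x : ℂ) := by
    have hc : Continuous fun q : ℝ × ℝ => cexp (-(2 * Real.pi * I * k i * q.1))
          * ((evenExt V (WithLp.toLp 2 ((2 * Real.pi) • (y + Pi.single i q.1))) q.2 : ℂ)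
            * (Real.cos (l * q.2) : ℂ)) := by
      have h1 : Continuous fun q : ℝ × ℝ => (y + Pi.single i q.1, q.2) :=
        (continuous_const.add ((continuous_single (A := fun _ : Fin ν => ℝ) i).comp
          continuous_fst)).prodMk continuous_snd
      have h2 := continuous_ofReal.comp (hce.comp h1)
      have h3 : Continuous fun q : ℝ × ℝ => cexp (-(2 * Real.pi * I * k i * q.1)) := by fun_prop
      have h4 : Continuous fun q : ℝ × ℝ => (Real.cos (l * q.2) : ℂ) := by fun_prop
      exact h3.mul (h2.mul h4)
    calc _ = ∫ s in (0 : ℝ)..1, (1 / (Real.pi : ℂ)) * ∫ x in (0 : ℝ)..Real.pi,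
          cexp (-(2 * Real.pi * I * k i * s))
          * ((evenExt V (WithLp.toLp 2 ((2 * Real.pi) • (y + Pi.single i s))) x : ℂ)
            * (Real.cos (l * x) : ℂ)) := by
          refine intervalIntegral.integral_congr fun s _ => ?_
          simp only [potCos, cosCoef]
          rw [intervalIntegral.integral_const_mul]
          ring
      _ = _ := by
          rw [intervalIntegral.integral_const_mul, intervalIntegral_intervalIntegral_swap]
          · congr 1
            refine intervalIntegral.integral_congr fun x _ => ?_
            rw [← intervalIntegral.integral_const_mul]
            refine intervalIntegral.integral_congr fun s _ => ?_
            simp only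
            ring
          · exact (hc.continuousOn.integrableOn_compact
              (isCompact_uIcc.prod isCompact_uIcc)).mono_set
              (Set.prod_mono Set.uIoc_subset_uIcc Set.uIoc_subset_uIcc)
  have hin : ∀ x : ℝ, ‖∫ s in (0 : ℝ)..1, cexp (-(2 * Real.pi * I * k i * s))
          * (evenExt V (WithLp.toLp 2 ((2 * Real.pi) • (y + Pi.single i s))) x : ℂ)‖
      ≤ C * Real.exp (-(ρ * |(k i : ℝ)|)) := by
    intro x
    set c : EuclideanSpace ℂ (Fin ν) := WithLp.toLp 2 fun j => ((2 * Real.pi * y j : ℝ) : ℂ) with hc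
    set v : EuclideanSpace ℂ (Fin ν) := EuclideanSpace.single i (2 * Real.pi : ℂ) with hv
    have hreal : ∀ s : ℝ, W (c + (s : ℂ) • v) x
        = (evenExt V (WithLp.toLp 2 ((2 * Real.pi) • (y + Pi.single i s))) x : ℂ) := by
      intro s
      rw [← hW]
      congr 1
      ext j
      by_cases h : j = i
      · subst h; simp [hc, hv]; ring
      · simp [hc, hv, h]
    have hmem : ∀ z : ℂ, |z.im| ≤ ρ / (2 * Real.pi) → c + z • v ∈ strip ν ρ := by
      intro z hz
      have e : ∀ j, ((c + z • v) j).im = if j = i then 2 * Real.pi * z.im else 0 := by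
        intro j
        by_cases h : j = i
        · subst h; simp [hc, hv]; ring
        · simp [hc, hv, h]
      simp only [strip, Set.mem_ofPred_eq, e]
      rw [Finset.sum_eq_single i (by intro j _ h; simp [h]) (by simp), if_pos rfl, Real.sqrt_sq_eq_abs,
        abs_mul, abs_of_pos (by positivity : 0 < 2 * Real.pi)]
      rw [le_div_iff₀ (by positivity)] at hz
      linarith
    have := norm_integral_exp_mul_le (g := fun z => W (c + z • v) x) (σ := ρ / (2 * Real.pi))
      (C := C) (by positivity) ?_ (fun z hz => by simpa using hb _ (hmem z hz) x) ?_ (k i)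
    · simp only [hreal] at this
      refine this.trans (le_of_eq ?_)
      congr 2
      field_simp
    · refine (hWa x).comp (fun z _ => ?_) fun z hz => hmem z hz
      exact analyticAt_const.add (analyticAt_id.smul analyticAt_const)
    · intro t
      have h1 := hreal (t + 1)
      push_cast at h1
      rw [h1, hreal]
      congr 1
      rw [← hpe i (WithLp.toLp 2 ((2 * Real.pi) • (y + (Pi.single i t : Fin ν → ℝ))))]
      congr 1
      ext j
      by_cases h : j = i
      · subst h; simp; ring
      · simp [h]
  rw [hswap, norm_mul]
  have hb2 := intervalIntegral.norm_integral_le_of_norm_le_const (a := (0 : ℝ)) (b := Real.pi)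
    (f := fun x : ℝ => (Real.cos (l * x) : ℂ) * ∫ s in (0 : ℝ)..1,
      cexp (-(2 * Real.pi * I * k i * s))
          * (evenExt V (WithLp.toLp 2 ((2 * Real.pi) • (y + Pi.single i s))) x : ℂ))
    (C := C * Real.exp (-(ρ * |(k i : ℝ)|))) fun x _ => by
      rw [norm_mul]
      refine (mul_le_of_le_one_left (norm_nonneg _) ?_).trans (hin x)
      rw [Complex.norm_real]
      exact Real.abs_cos_le_one _
  have e : ‖(1 / (Real.pi : ℂ))‖ = 1 / Real.pi := by
    rw [norm_div, norm_one, Complex.norm_real, Real.norm_eq_abs, abs_of_pos hp]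
  rw [e, div_mul_eq_mul_div, one_mul, div_le_iff₀ hp]
  refine hb2.trans (le_of_eq ?_)
  rw [sub_zero, abs_of_pos hp]

end Potential

/-! ### Vanishing time average and joint decay of the coefficients -/

section Potential

open MeasureTheory Complex

variable {ν : ℕ} {V : EuclideanSpace ℝ (Fin ν) → ℝ → ℝ} {ρ : ℝ}

theorem cube_ae_eq : cube (0 : Fin ν → ℝ) =ᵐ[volume] Set.univ.pi fun _ => Set.Ico (0 : ℝ) 1 := by
  have : cube (0 : Fin ν → ℝ) = Set.univ.pi fun _ => Set.Ioc (0 : ℝ) 1 := by ext; simp [cube]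
  rw [this]
  exact (Measure.univ_pi_Ioc_ae_eq_Icc).trans (Measure.univ_pi_Ico_ae_eq_Icc).symm

open scoped Pointwise in
theorem setIntegral_cube_eq_zero (hV : CondV2 V) {x : ℝ} (hx : x ∈ Set.Icc 0 Real.pi) :
    ∫ y in cube (0 : Fin ν → ℝ), V (WithLp.toLp 2 ((2 * Real.pi) • y)) x = 0 := by
  have h2π : (0 : ℝ) < 2 * Real.pi := by positivity
  rw [setIntegral_congr_set cube_ae_eq,
    Measure.setIntegral_comp_smul_of_pos volume (fun y => V (WithLp.toLp 2 y) x) _ h2π]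
  have h1 : (2 * Real.pi) • (Set.univ.pi fun _ : Fin ν => Set.Ico (0 : ℝ) 1)
      = (WithLp.toLp 2) ⁻¹' {θ : EuclideanSpace ℝ (Fin ν) | ∀ i, θ i ∈ Set.Ico (0 : ℝ) (2 * Real.pi)} := by
    ext y
    rw [Set.mem_smul_set_iff_inv_smul_mem₀ h2π.ne']
    simp only [Set.mem_univ_pi, Pi.smul_apply, smul_eq_mul, Set.mem_Ico, Set.mem_preimage,
      Set.mem_ofPred_eq]
    refine forall_congr' fun i => ?_
    rw [← div_eq_inv_mul, div_lt_one h2π, le_div_iff₀ h2π, zero_mul]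
  have h2 := (PiLp.volume_preserving_toLp (Fin ν)).setIntegral_preimage_emb
    (MeasurableEquiv.toLp 2 (Fin ν → ℝ)).measurableEmbedding (fun θ => V θ x)
    {θ : EuclideanSpace ℝ (Fin ν) | ∀ i, θ i ∈ Set.Ico (0 : ℝ) (2 * Real.pi)}
  rw [h1, h2, hV x hx, smul_zero]

theorem potCoef_zero (hV : CondV1 ρ V) (hV2 : CondV2 V) (l : ℕ) : potCoef V 0 l = 0 := by
  have hc : Continuous fun q : (Fin ν → ℝ) × ℝ =>
      (evenExt V (WithLp.toLp 2 ((2 * Real.pi) • q.1)) q.2 : ℂ) * (Real.cos (l * q.2) : ℂ) :=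
    (continuous_ofReal.comp (continuous_evenExt hV)).mul (by fun_prop)
  have h1 : ∫ y in cube (0 : Fin ν → ℝ), ∫ x in (0 : ℝ)..Real.pi,
      (evenExt V (WithLp.toLp 2 ((2 * Real.pi) • y)) x : ℂ) * (Real.cos (l * x) : ℂ)
      = ∫ x in (0 : ℝ)..Real.pi, ∫ y in cube (0 : Fin ν → ℝ),
      (evenExt V (WithLp.toLp 2 ((2 * Real.pi) • y)) x : ℂ) * (Real.cos (l * x) : ℂ) := by
    simp only [intervalIntegral.integral_of_le Real.pi_pos.le]
    refine integral_integral_swap ?_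
    rw [Measure.prod_restrict]
    exact (hc.continuousOn.integrableOn_compact
      ((isCompact_Icc (a := (0 : Fin ν → ℝ)) (b := 0 + 1)).prod
        (isCompact_Icc (a := (0 : ℝ)) (b := Real.pi)))).mono_set
      (Set.prod_mono (cube_subset_Icc 0) Set.Ioc_subset_Icc_self)
  have h2 : ∫ x in (0 : ℝ)..Real.pi, ∫ y in cube (0 : Fin ν → ℝ),
      (evenExt V (WithLp.toLp 2 ((2 * Real.pi) • y)) x : ℂ) * (Real.cos (l * x) : ℂ) = 0 := by
    rw [← intervalIntegral.integral_zero (a := (0 : ℝ)) (b := Real.pi) (μ := volume) (E := ℂ)]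
    refine intervalIntegral.integral_congr fun x hx => ?_
    rw [Set.uIcc_of_le Real.pi_pos.le] at hx
    simp only [evenExt_eq hx]
    rw [integral_mul_const, integral_complex_ofReal, setIntegral_cube_eq_zero hV2 hx]
    simp
  unfold potCoef fcoef potCos cosCoef
  have h3 : ∀ y : Fin ν → ℝ, expChar (-0) y = 1 := fun y => by simp [expChar]
  simp only [h3, one_mul]
  rw [integral_const_mul, h1, h2, mul_zero]

theorem exists_kabs_le (hν : 1 ≤ ν) (k : Fin ν → ℤ) : ∃ i, kabs k ≤ ν * |(k i : ℝ)| := by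
  have : Nonempty (Fin ν) := ⟨⟨0, hν⟩⟩
  obtain ⟨i₀, hi₀⟩ := Finite.exists_max fun i => |(k i : ℝ)|
  refine ⟨i₀, (Finset.sum_le_sum fun i _ => hi₀ i).trans ?_⟩
  rw [Finset.sum_const, Finset.card_univ, Fintype.card_fin, nsmul_eq_mul]

/-- Geometric mean of two bounds: exponential decay in k uniform in l, and decay of order 2s in l
uniform in k. The largest coordinate of k has modulus at least |k|/ν, which gives the rate ρ/ν, and
the mean halves it. -/
theorem exists_norm_potCoef_le_decay (hν : 1 ≤ ν) (hρ : 0 < ρ) (hV : CondV1 ρ V) (s : ℕ) :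
    ∃ C > 0, ∀ k (l : ℕ),
      (1 + l : ℝ) ^ s * ‖potCoef V k l‖ ≤ C * Real.exp (-(ρ / (2 * ν) * kabs k)) := by
  obtain ⟨C₁, hC₁, h₁⟩ := exists_norm_potCoef_le hρ hV
  obtain ⟨C₂, hC₂, h₂⟩ := exists_norm_potCos_le hρ hV (2 * s)
  have hν0 : (0 : ℝ) < ν := by exact_mod_cast hν
  refine ⟨Real.sqrt (C₁ * C₂), by positivity, fun k l => ?_⟩
  have a1 : ‖potCoef V k l‖ ≤ C₁ * Real.exp (-(ρ / ν * kabs k)) := by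
    obtain ⟨i, hi⟩ := exists_kabs_le hν k
    refine (h₁ k l i).trans ?_
    refine mul_le_mul_of_nonneg_left (Real.exp_le_exp.2 (neg_le_neg ?_)) hC₁.le
    rw [div_mul_eq_mul_div, div_le_iff₀ hν0]
    nlinarith
  have a2 : ‖potCoef V k l‖ ≤ C₂ / (1 + l : ℝ) ^ (2 * s) := by
    refine norm_fcoef_le_of_bound (fun y => ?_) k
    rw [le_div_iff₀ (by positivity), mul_comm]
    exact h₂ l y
  rw [le_div_iff₀ (by positivity)] at a2
  have a3 : ((1 + l : ℝ) ^ s * ‖potCoef V k l‖) ^ 2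
      ≤ (Real.sqrt (C₁ * C₂) * Real.exp (-(ρ / (2 * ν) * kabs k))) ^ 2 := by
    rw [mul_pow (Real.sqrt _), Real.sq_sqrt (by positivity), ← Real.exp_nat_mul]
    have e : ((2 : ℕ) : ℝ) * -(ρ / (2 * ν) * kabs k) = -(ρ / ν * kabs k) := by
      push_cast; field_simp
    rw [e]
    calc _ = ‖potCoef V k l‖ * (‖potCoef V k l‖ * (1 + l : ℝ) ^ (2 * s)) := by ring
      _ ≤ (C₁ * Real.exp (-(ρ / ν * kabs k))) * C₂ := by gcongr
      _ = _ := by ring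
  exact le_of_sq_le_sq a3 (by positivity)

theorem hasSum_potCoef (hν : 1 ≤ ν) (hρ : 0 < ρ) (hV : CondV1 ρ V)
    (θ : EuclideanSpace ℝ (Fin ν)) (l : ℕ) :
    HasSum (fun k => potCoef V k l * cexp (I * dotk θ k))
      (cosCoef (fun x => (evenExt V θ x : ℂ)) l) := by
  obtain ⟨C, -, hC⟩ := exists_norm_potCoef_le_decay hν hρ hV 0
  have hν0 : (0 : ℝ) < ν := by exact_mod_cast hν
  have hs : Summable (fcoef (potCos V l)) :=
    summable_of_norm_le_exp (σ := ρ / (2 * ν)) (C := C) (by positivity) fun k => by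
      simpa [potCoef] using hC k l
  have h := hasSum_fcoef (continuous_potCos hV l) (potCos_periodic hV l) hs
    ((2 * Real.pi)⁻¹ • θ.ofLp)
  have hp : (2 * Real.pi : ℝ) ≠ 0 := by positivity
  have e1 : potCos V l ((2 * Real.pi)⁻¹ • θ.ofLp) = cosCoef (fun x => (evenExt V θ x : ℂ)) l := by
    unfold potCos
    rw [smul_smul, mul_inv_cancel₀ hp, one_smul]
  rw [e1] at h
  refine h.congr_fun fun k => ?_
  rw [potCoef]
  congr 1
  have hp' : (Real.pi : ℂ) ≠ 0 := by exact_mod_cast Real.pi_pos.ne'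
  have e : ((dotk θ k : ℝ) : ℂ)
      = 2 * Real.pi * ∑ i, (k i : ℂ) * (((2 * Real.pi)⁻¹ • θ.ofLp) i : ℝ) := by
    unfold dotk
    rw [ofReal_sum, Finset.mul_sum]
    refine Finset.sum_congr rfl fun i _ => ?_
    push_cast [Pi.smul_apply, smul_eq_mul]
    field_simp
  rw [expChar, e]
  congr 1
  ring

theorem hasSum_sineCoeff (hν : 1 ≤ ν) (hρ : 0 < ρ) (hV : CondV1 ρ V)
    (θ : EuclideanSpace ℝ (Fin ν)) (m n : ℕ+) :
    HasSum (fun k => (potCoef V k (mdist m n) - potCoef V k (m + n)) * cexp (I * dotk θ k))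
      (sineCoeff (fun x => ((V θ x * Real.sin ((n : ℝ) * x) : ℝ) : ℂ)) m) := by
  have hc : Continuous fun x => (evenExt V θ x : ℂ) :=
    continuous_ofReal.comp (hV.2.1.continuous.comp (continuous_const.prodMk continuous_id))
  rw [sineCoeff_mul_sin hc fun x hx => by rw [evenExt_eq hx]]
  simp only [sub_mul]
  exact (hasSum_potCoef hν hρ hV θ _).sub (hasSum_potCoef hν hρ hV θ _)

end Potential

/-! ### The weight adapted to the potential -/

section Weight

/-- The finite products whose supremum is the weight. -/
def weightProd (T : ℕ → ℝ) (q l : ℕ) : ℝ := ∏ s ∈ Finset.range q, (1 + l / T s)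

theorem one_le_weightProd {T : ℕ → ℝ} (hT : ∀ s, 1 ≤ T s) (q l : ℕ) : 1 ≤ weightProd T q l := by
  unfold weightProd
  refine Finset.prod_induction _ (fun x => 1 ≤ x) (fun a b => one_le_mul_of_one_le_of_one_le) le_rfl
    fun s _ => ?_
  have := hT s
  have : (0 : ℝ) ≤ l / T s := by positivity
  linarith

theorem weightProd_le_pow {T : ℕ → ℝ} (hT : ∀ s, 1 ≤ T s) (q l : ℕ) :
    weightProd T q l ≤ (1 + l) ^ q := by
  unfold weightProd
  refine (Finset.prod_le_prod (fun s _ => ?_) (fun s _ => ?_)).trans_eq (by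
    rw [Finset.prod_const, Finset.card_range])
  · have := hT s; positivity
  · have := hT s
    gcongr
    exact div_le_self (Nat.cast_nonneg _) this

/-- Take w as the supremum over q of the products of 1 + l/T_s, s < q. Each factor is increasing and
submultiplicative, and q factors dominate (1 + l)^q up to the constant ∏ T_s. With T_q equal to 2^q
times one plus the moment of b of order q + 2, one more factor raises the sum against (1 + l) b by
at most 2^{-q}. The sums therefore stay bounded, and so does that of the supremum by monotone
convergence. -/
theorem exists_weight {b : ℕ → ℝ} (hb : ∀ l, 0 ≤ b l)
    (hs : ∀ s : ℕ, Summable fun l : ℕ => (1 + l : ℝ) ^ s * b l) :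
    ∃ w, IsNatWeight w ∧
      (∀ q : ℕ, ∃ c > 0, ∀ l : ℕ, ENNReal.ofReal ((1 + l : ℝ) ^ q) ≤ ENNReal.ofReal c * w l) ∧
      ∃ A > 0, ∑' l : ℕ, w l * ENNReal.ofReal ((1 + l) * b l) ≤ ENNReal.ofReal A := by
  set T : ℕ → ℝ := fun q => 2 ^ q * (1 + ∑' l : ℕ, (1 + l : ℝ) ^ (q + 2) * b l) with hTd
  have hsum0 : ∀ s : ℕ, 0 ≤ ∑' l : ℕ, (1 + l : ℝ) ^ s * b l := fun s =>
    tsum_nonneg fun l => mul_nonneg (by positivity) (hb l)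
  have hT : ∀ q, 1 ≤ T q := fun q =>
    one_le_mul_of_one_le_of_one_le (one_le_pow₀ one_le_two) (by linarith [hsum0 (q + 2)])
  have hT0 : ∀ q, 0 < T q := fun q => zero_lt_one.trans_le (hT q)
  have hsucc : ∀ q l, weightProd T (q + 1) l = weightProd T q l * (1 + l / T q) := fun q l =>
    Finset.prod_range_succ _ _
  have hmonoq : ∀ l, Monotone fun q => weightProd T q l := fun l => monotone_nat_of_le_succ fun q => by
    rw [hsucc]
    refine le_mul_of_one_le_right (by linarith [one_le_weightProd hT q l]) ?_
    have := hT0 q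
    have : (0 : ℝ) ≤ l / T q := by positivity
    linarith
  refine ⟨fun l => ⨆ q, ENNReal.ofReal (weightProd T q l), ⟨fun n => ?_, fun m n h => ?_,
    fun m n => ?_⟩, fun q => ?_, ?_⟩
  · refine le_iSup_of_le 0 ?_
    simp [weightProd]
  · refine iSup_mono fun q => ENNReal.ofReal_le_ofReal ?_
    refine Finset.prod_le_prod (fun s _ => by have := hT0 s; positivity) fun s _ => ?_
    have := hT0 s
    gcongr
  · refine iSup_le fun q => ?_
    refine le_trans ?_ (mul_le_mul' (le_iSup _ q) (le_iSup _ q))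
    rw [← ENNReal.ofReal_mul (by linarith [one_le_weightProd hT q m])]
    refine ENNReal.ofReal_le_ofReal ?_
    unfold weightProd
    rw [← Finset.prod_mul_distrib]
    refine Finset.prod_le_prod (fun s _ => by have := hT0 s; positivity) fun s _ => ?_
    have h1 := hT0 s
    have h2 : (0 : ℝ) ≤ m / T s * (n / T s) := by positivity
    push_cast
    rw [add_div]
    nlinarith
  · set c : ℝ := ∏ s ∈ Finset.range q, T s with hc
    have hc0 : 0 < c := Finset.prod_pos fun s _ => hT0 s
    refine ⟨c, hc0, fun l => ?_⟩
    refine le_trans ?_ (mul_le_mul' le_rfl (le_iSup _ q))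
    rw [← ENNReal.ofReal_mul hc0.le]
    refine ENNReal.ofReal_le_ofReal ?_
    rw [hc]
    unfold weightProd
    rw [← Finset.prod_mul_distrib]
    calc (1 + l : ℝ) ^ q = ∏ s ∈ Finset.range q, (1 + l : ℝ) := by
          rw [Finset.prod_const, Finset.card_range]
      _ ≤ _ := by
          refine Finset.prod_le_prod (fun s _ => by positivity) fun s _ => ?_
          have h1 := hT0 s
          rw [mul_add, mul_one, mul_div_cancel₀ _ h1.ne']
          linarith [hT s]
  · set B : ℕ → ℝ := fun q => ∑' l : ℕ, weightProd T q l * ((1 + l) * b l) with hB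
    have hBs : ∀ q, Summable fun l : ℕ => weightProd T q l * ((1 + l) * b l) := fun q => by
      refine Summable.of_nonneg_of_le (fun l => ?_) (fun l => ?_) (hs (q + 1))
      · have := one_le_weightProd hT q l
        have := hb l
        positivity
      · rw [pow_succ, mul_assoc]
        refine mul_le_mul_of_nonneg_right (weightProd_le_pow hT q l) ?_
        have := hb l
        positivity
    have hstep : ∀ q, B (q + 1) ≤ B q + (1 / 2) ^ q := fun q => by
      have h1 : Summable fun l : ℕ => (T q)⁻¹ * ((1 + l : ℝ) ^ (q + 2) * b l) :=
        (hs (q + 2)).mul_left _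
      have h2 : B (q + 1) ≤ B q + ∑' l : ℕ, (T q)⁻¹ * ((1 + l : ℝ) ^ (q + 2) * b l) := by
        rw [hB, ← (hBs q).tsum_add h1]
        refine (hBs (q + 1)).tsum_le_tsum (fun l => ?_) ((hBs q).add h1)
        rw [hsucc, mul_add, mul_one, add_mul]
        have h3 := weightProd_le_pow hT q l
        have h4 := hT0 q
        have h5 := hb l
        refine add_le_add le_rfl ?_
        calc _ ≤ (1 + l : ℝ) ^ q * ((1 + l) / T q) * ((1 + l) * b l) := by
              gcongr
              linarith
          _ = _ := by rw [pow_add]; field_simp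
      refine h2.trans (add_le_add le_rfl ?_)
      rw [tsum_mul_left, one_div, inv_pow, hTd]
      simp only
      rw [mul_inv, mul_assoc]
      refine mul_le_of_le_one_right (by positivity) ?_
      rw [← div_eq_inv_mul, div_le_one (by linarith [hsum0 (q + 2)])]
      linarith
    have hBq : ∀ q, B q ≤ B 0 + 2 - 2 * (1 / 2) ^ q := fun q => by
      induction q with
      | zero => simp
      | succ q ih => have := hstep q; rw [pow_succ]; linarith
    have hB0 : 0 ≤ B 0 := tsum_nonneg fun l => by
      have := one_le_weightProd hT 0 l
      have := hb l
      positivity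
    refine ⟨B 0 + 2, by positivity, ?_⟩
    refine ENNReal.tsum_le_of_sum_range_le fun n => ?_
    simp_rw [ENNReal.iSup_mul]
    rw [ENNReal.finsetSum_iSup_of_monotone fun l i j hij => by
      gcongr; exact hmonoq l hij]
    refine iSup_le fun q => (ENNReal.sum_le_tsum _).trans ?_
    have h0 : ∀ l : ℕ, 0 ≤ weightProd T q l * ((1 + l) * b l) := fun l => by
      have := one_le_weightProd hT q l
      have := hb l
      positivity
    have e : ∀ l : ℕ, ENNReal.ofReal (weightProd T q l) * ENNReal.ofReal ((1 + l) * b l)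
        = ENNReal.ofReal (weightProd T q l * ((1 + l) * b l)) := fun l =>
      (ENNReal.ofReal_mul (by linarith [one_le_weightProd hT q l])).symm
    simp_rw [e]
    rw [← ENNReal.ofReal_tsum_of_nonneg h0 (hBs q)]
    refine ENNReal.ofReal_le_ofReal ((hBq q).trans ?_)
    have : (0 : ℝ) ≤ 2 * (1 / 2) ^ q := by positivity
    linarith

theorem tsum_mdist_le (F : ℕ → ℝ≥0∞) (n : ℕ+) : ∑' m : ℕ+, F (mdist m n) ≤ 2 * ∑' l, F l := by
  have h1 : ∑' m : ℕ+, F (mdist m n) ≤ ∑' j : ℤ, F j.natAbs :=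
    ENNReal.tsum_comp_le_tsum_of_injective (f := fun m : ℕ+ => (m : ℤ) - n)
      (fun a b h => by
        have h : (a : ℤ) - n = b - n := h
        exact PNat.coe_injective (by omega)) fun j : ℤ => F j.natAbs
  have h2 : HasSum (fun j : ℤ => F j.natAbs) (∑' l, F l + ∑' l, F (l + 1)) := by
    refine HasSum.of_nat_of_neg_add_one ?_ ?_
    · simpa using ENNReal.summable.hasSum (f := F)
    · have : ∀ n : ℕ, (-((n : ℤ) + 1)).natAbs = n + 1 := fun n => by omega
      simp only [this]
      exact ENNReal.summable.hasSum
  refine h1.trans ?_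
  rw [h2.tsum_eq, two_mul]
  refine add_le_add le_rfl ?_
  exact ENNReal.tsum_comp_le_tsum_of_injective (add_left_injective 1) F

theorem tsum_add_le (F : ℕ → ℝ≥0∞) (n : ℕ+) : ∑' m : ℕ+, F (m + n) ≤ ∑' l, F l :=
  ENNReal.tsum_comp_le_tsum_of_injective (f := fun m : ℕ+ => (m : ℕ) + n)
    (fun a b h => PNat.coe_injective (by simpa using h)) F

end Weight

/-! ### The Floquet operator of the potential -/

section Floquet

open MeasureTheory Complex

variable {ν : ℕ} {V : EuclideanSpace ℝ (Fin ν) → ℝ → ℝ} {ρ : ℝ}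

/-- The matrix of the perturbation at the point `θ` of the torus. -/
def pertMat (mass : ℝ) (V : EuclideanSpace ℝ (Fin ν) → ℝ → ℝ) (θ : EuclideanSpace ℝ (Fin ν))
    (i j : Bool × ℕ+) : ℂ :=
  (1 / 2 * sg i.1 * eigB mass i.2 ^ (-(1 / 2) : ℝ) * eigB mass j.2 ^ (-(1 / 2) : ℝ) : ℝ)
    * sineCoeff (fun x => ((V θ x * Real.sin ((j.2 : ℝ) * x) : ℝ) : ℂ)) i.2

/-- The matrix of the perturbation in the Fourier variables. -/
def pertCoef (mass : ℝ) (V : EuclideanSpace ℝ (Fin ν) → ℝ → ℝ) (x y : Idx ν) : ℂ :=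
  (1 / 2 * sg x.2.1 * eigB mass x.2.2 ^ (-(1 / 2) : ℝ) * eigB mass y.2.2 ^ (-(1 / 2) : ℝ) : ℝ)
    * (potCoef V (x.1 - y.1) (mdist x.2.2 y.2.2) - potCoef V (x.1 - y.1) (x.2.2 + y.2.2))

theorem kabs_neg (k : Fin ν → ℤ) : kabs (-k) = kabs k := by simp [kabs]

theorem kabs_sub_comm (k l : Fin ν → ℤ) : kabs (k - l) = kabs (l - k) := by
  rw [← kabs_neg, neg_sub]

theorem sqrt_mul_eigB_rpow_le {mass : ℝ} (m : ℕ+) :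
    Real.sqrt m * eigB mass m ^ (-(1 / 2) : ℝ) ≤ 1 := by
  have h1 := le_eigB mass m
  have h2 := one_le_pnat m
  have h3 : 0 < eigB mass m := by linarith
  rw [Real.rpow_neg h3.le, ← Real.sqrt_eq_rpow, ← div_eq_mul_inv, div_le_one (by positivity)]
  exact Real.sqrt_le_sqrt h1

/-- The two factors λ^{-1/2} pay for √m and √n: the first is the row factor kept throughout the
iteration, the second is spent on M^{-1/2} in the first step. -/
theorem norm_pertCoef_le {mass : ℝ} (x y : Idx ν) {B : ℝ}
    (hB : ‖potCoef V (x.1 - y.1) (mdist x.2.2 y.2.2)‖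
      + ‖potCoef V (x.1 - y.1) (x.2.2 + y.2.2)‖ ≤ B) :
    Real.sqrt x.2.2 * Real.sqrt y.2.2 * ‖pertCoef mass V x y‖ ≤ B := by
  have h1 := sqrt_mul_eigB_rpow_le (mass := mass) x.2.2
  have h2 := sqrt_mul_eigB_rpow_le (mass := mass) y.2.2
  have p1 : 0 ≤ eigB mass x.2.2 ^ (-(1 / 2) : ℝ) := Real.rpow_nonneg (eigB_nonneg _ _) _
  have p2 : 0 ≤ eigB mass y.2.2 ^ (-(1 / 2) : ℝ) := Real.rpow_nonneg (eigB_nonneg _ _) _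
  have hB0 : 0 ≤ B := le_trans (by positivity) hB
  rw [pertCoef, norm_mul, Complex.norm_real, Real.norm_eq_abs, abs_mul, abs_mul, abs_mul, abs_sg,
    abs_of_nonneg p1, abs_of_nonneg p2]
  have h3 := (norm_sub_le (potCoef V (x.1 - y.1) (mdist x.2.2 y.2.2))
    (potCoef V (x.1 - y.1) (x.2.2 + y.2.2))).trans hB
  calc _ = |(1 / 2 : ℝ)| * ((Real.sqrt x.2.2 * eigB mass x.2.2 ^ (-(1 / 2) : ℝ))
        * (Real.sqrt y.2.2 * eigB mass y.2.2 ^ (-(1 / 2) : ℝ))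
        * ‖potCoef V (x.1 - y.1) (mdist x.2.2 y.2.2) - potCoef V (x.1 - y.1) (x.2.2 + y.2.2)‖) := by
        ring
    _ ≤ 1 * (1 * 1 * B) := by
        gcongr
        rw [abs_of_nonneg] <;> norm_num
    _ = B := by ring

/-- A supremum over k of the exponentially weighted coefficients gives one sequence b with all
moments finite, as `exists_weight` requires. -/
theorem exists_potCoef_bound (hν : 1 ≤ ν) (hρ : 0 < ρ) (hV : CondV1 ρ V) : ∃ b : ℕ → ℝ,
    (∀ l, 0 ≤ b l) ∧ (∀ s : ℕ, Summable fun l : ℕ => (1 + l : ℝ) ^ s * b l) ∧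
    ∀ k l, ‖potCoef V k l‖ ≤ b l * Real.exp (-(ρ / (2 * ν) * kabs k)) := by
  set σ := ρ / (2 * ν) with hσ
  have hdec := exists_norm_potCoef_le_decay hν hρ hV
  rw [← hσ] at hdec
  have hk : ∀ (s : ℕ) (C : ℝ), (∀ k (l : ℕ),
      (1 + l : ℝ) ^ s * ‖potCoef V k l‖ ≤ C * Real.exp (-(σ * kabs k))) → ∀ k (l : ℕ),
      ‖potCoef V k l‖ * Real.exp (σ * kabs k) ≤ C / (1 + l : ℝ) ^ s := by
    intro s C h k l
    rw [le_div_iff₀ (by positivity)]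
    calc _ = ((1 + l : ℝ) ^ s * ‖potCoef V k l‖) * Real.exp (σ * kabs k) := by ring
      _ ≤ (C * Real.exp (-(σ * kabs k))) * Real.exp (σ * kabs k) := by
          exact mul_le_mul_of_nonneg_right (h k l) (Real.exp_nonneg _)
      _ = C := by rw [mul_assoc, ← Real.exp_add]; simp
  set b : ℕ → ℝ := fun l => ⨆ k, ‖potCoef V k l‖ * Real.exp (σ * kabs k) with hb
  have hb0 : ∀ l, 0 ≤ b l := fun l => Real.iSup_nonneg fun k => by positivity
  have hbs : ∀ s : ℕ, ∃ C, ∀ l : ℕ, b l ≤ C / (1 + l : ℝ) ^ s := fun s => by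
    obtain ⟨C, -, h⟩ := hdec s
    exact ⟨C, fun l => ciSup_le fun k => hk s C h k l⟩
  refine ⟨b, hb0, fun s => ?_, fun k l => ?_⟩
  · obtain ⟨C, hC⟩ := hbs (s + 2)
    refine Summable.of_nonneg_of_le (fun l => mul_nonneg (by positivity) (hb0 l)) (fun l => ?_)
      (((summable_nat_add_iff 1).2 (Real.summable_one_div_nat_pow (p := 2).2 one_lt_two)).mul_left C)
    calc _ ≤ (1 + l : ℝ) ^ s * (C / (1 + l : ℝ) ^ (s + 2)) := by gcongr; exact hC l
      _ = _ := by push_cast; rw [pow_add, add_comm (l : ℝ)]; field_simp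
  · obtain ⟨C, -, h⟩ := hdec 0
    have h1 : ‖potCoef V k l‖ * Real.exp (σ * kabs k) ≤ b l :=
      le_ciSup (f := fun k => ‖potCoef V k l‖ * Real.exp (σ * kabs k))
        ⟨_, by rintro _ ⟨k, rfl⟩; exact hk 0 C h k l⟩ k
    rw [Real.exp_neg, ← div_eq_mul_inv, le_div_iff₀ (Real.exp_pos _)]
    exact h1

theorem exists_floquet_operator (hν : 1 ≤ ν) (hρ : 0 < ρ) (hV : CondV1 ρ V) (hV2 : CondV2 V)
    (mass : ℝ) : ∃ w : ℕ → ℝ≥0∞, IsNatWeight w ∧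
      (∀ q : ℕ, ∃ c > 0, ∀ l : ℕ, ENNReal.ofReal ((1 + l : ℝ) ^ q) ≤ ENNReal.ofReal c * w l) ∧
      ∃ σ > 0, ∃ p > 0, ∃ P₀ : Op (Idx ν), wnorm (wtBig w σ) P₀ ≤ ENNReal.ofReal p ∧
        (∀ x y : Idx ν, x.1 = y.1 → entry P₀ x y = 0) ∧ (∀ κ, Inv (shift κ) P₀) ∧
        (∀ x y : Idx ν, (sg x.2.1 : ℂ) * entry P₀ x y = sg y.2.1 * starRingEnd ℂ (entry P₀ y x)) ∧
        ∀ θ i j, HasSum (fun k : Fin ν → ℤ => entry P₀ (k, i) (0, j) * cexp (I * dotk θ k))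
          (pertMat mass V θ i j) := by
  obtain ⟨b, hb0, hbs, hb⟩ := exists_potCoef_bound hν hρ hV
  obtain ⟨w, hw, hwq, A, hA, hwA⟩ := exists_weight hb0 hbs
  have hν0 : (0 : ℝ) < ν := by exact_mod_cast hν
  -- The coefficients decay at rate 4σ: half of it compensates the exponential in `wtBig w σ`, the
  -- other half makes the sum over k converge.
  set σ : ℝ := ρ / (8 * ν) with hσ
  have hσ0 : 0 < σ := by positivity
  have hσ4 : ρ / (2 * ν) = 4 * σ := by rw [hσ]; field_simp; norm_num
  rw [hσ4] at hb
  obtain ⟨K, hK, hKs⟩ := exists_tsum_exp_kabs_le ν (σ := 2 * σ) (by positivity)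
  set F : ℕ → ℝ≥0∞ := fun l => w l * ENNReal.ofReal ((1 + l) * b l) with hF
  set E : (Fin ν → ℤ) → ℝ≥0∞ := fun k => ENNReal.ofReal (Real.exp (-(2 * σ * kabs k))) with hE
  set G : Idx ν → Idx ν → ℝ≥0∞ := fun x y =>
    E (x.1 - y.1) * (F (mdist x.2.2 y.2.2) + F (x.2.2 + y.2.2)) with hG
  have hGsymm : ∀ x y, G x y = G y x := fun x y => by
    simp only [hG, hE]
    rw [kabs_sub_comm, mdist_comm, add_comm (x.2.2 : ℕ)]
  have hGcol : ∀ y, ∑' x, G x y ≤ ENNReal.ofReal (K * (2 * (3 * A))) := fun y => by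
    rw [ENNReal.tsum_prod']
    have h1 : ∀ k : Fin ν → ℤ, ∑' i : Bool × ℕ+, G (k, i) y
        ≤ E (k - y.1) * ENNReal.ofReal (2 * (3 * A)) := fun k => by
      simp only [hG]
      rw [ENNReal.tsum_mul_left]
      gcongr
      rw [ENNReal.tsum_prod', tsum_fintype, Fintype.sum_bool]
      simp only
      rw [ENNReal.tsum_add, ← two_mul, ENNReal.ofReal_mul two_pos.le, ENNReal.ofReal_ofNat,
        ENNReal.ofReal_mul (by norm_num : (0 : ℝ) ≤ 3), ENNReal.ofReal_ofNat]
      gcongr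
      calc _ ≤ 2 * ∑' l, F l + ∑' l, F l :=
            add_le_add (tsum_mdist_le F y.2.2) (tsum_add_le F y.2.2)
        _ = 3 * ∑' l, F l := by ring
        _ ≤ _ := by gcongr
    refine (ENNReal.tsum_le_tsum h1).trans ?_
    have h2 : ∑' k, E (k - y.1) = ∑' k, E k := (Equiv.subRight y.1).tsum_eq E
    rw [ENNReal.tsum_mul_right, h2, ENNReal.ofReal_mul hK.le]
    gcongr
  have hschur : schur G ≤ ENNReal.ofReal (K * (2 * (3 * A))) :=
    schur_le_iff.2 ⟨hGcol, fun x => by simp_rw [hGsymm x]; exact hGcol x⟩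
  have hentry : ∀ x y, wtBig w σ x y * ‖pertCoef mass V x y‖ₑ ≤ G x y := fun x y => by
    have h1 := norm_pertCoef_le (mass := mass) x y
      (add_le_add (hb (x.1 - y.1) (mdist x.2.2 y.2.2)) (hb (x.1 - y.1) (x.2.2 + y.2.2)))
    rw [← add_mul] at h1
    set L : ℕ := mdist x.2.2 y.2.2 with hL
    set N : ℕ := x.2.2 + y.2.2 with hN
    have hLN : L ≤ N := by simp only [hL, hN, mdist]; omega
    have h2 : Real.exp (2 * σ * kabs (x.1 - y.1)) * Real.sqrt x.2.2
        * ((1 + L) * Real.sqrt y.2.2) * ‖pertCoef mass V x y‖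
        ≤ Real.exp (-(2 * σ * kabs (x.1 - y.1))) * ((1 + L) * b L + (1 + N) * b N) := by
      calc _ = Real.exp (2 * σ * kabs (x.1 - y.1)) * (1 + L)
            * (Real.sqrt x.2.2 * Real.sqrt y.2.2 * ‖pertCoef mass V x y‖) := by ring
        _ ≤ Real.exp (2 * σ * kabs (x.1 - y.1)) * (1 + L)
            * ((b L + b N) * Real.exp (-(4 * σ * kabs (x.1 - y.1)))) := by gcongr
        _ = (Real.exp (2 * σ * kabs (x.1 - y.1)) * Real.exp (-(4 * σ * kabs (x.1 - y.1))))
            * ((1 + L) * b L + (1 + L) * b N) := by ring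
        _ ≤ _ := by
            have e : Real.exp (2 * σ * kabs (x.1 - y.1)) * Real.exp (-(4 * σ * kabs (x.1 - y.1)))
                = Real.exp (-(2 * σ * kabs (x.1 - y.1))) := by
              rw [← Real.exp_add]; congr 1; ring
            rw [e]
            have : (L : ℝ) ≤ N := by exact_mod_cast hLN
            have := hb0 N
            gcongr
    have h3 := ENNReal.ofReal_le_ofReal h2
    have p1 : (0 : ℝ) ≤ (1 + L) * b L := mul_nonneg (by positivity) (hb0 L)
    have p2 : (0 : ℝ) ≤ (1 + N) * b N := mul_nonneg (by positivity) (hb0 N)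
    rw [ENNReal.ofReal_mul (by positivity), ENNReal.ofReal_mul (by positivity),
      ENNReal.ofReal_mul (by positivity), ofReal_norm, ENNReal.ofReal_mul (Real.exp_nonneg _),
      ENNReal.ofReal_add p1 p2] at h3
    calc _ = w L * (ENNReal.ofReal (Real.exp (2 * σ * kabs (x.1 - y.1)))
          * ENNReal.ofReal (Real.sqrt x.2.2) * ENNReal.ofReal ((1 + L) * Real.sqrt y.2.2)
          * ‖pertCoef mass V x y‖ₑ) := by unfold wtBig; ring
      _ ≤ w L * (E (x.1 - y.1) * (ENNReal.ofReal ((1 + L) * b L)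
          + ENNReal.ofReal ((1 + N) * b N))) := by gcongr
      _ = E (x.1 - y.1) * (w L * ENNReal.ofReal ((1 + L) * b L)
          + w L * ENNReal.ofReal ((1 + N) * b N)) := by ring
      _ ≤ G x y := by
          simp only [hG, hF]
          gcongr
          exact hw.mono hLN
  have hwt : schur (fun x y => wtBig w σ x y * ‖pertCoef mass V x y‖ₑ)
      ≤ ENNReal.ofReal (K * (2 * (3 * A))) := (schur_mono hentry).trans hschur
  have hE : ∀ x y, entry (ofMat (pertCoef mass V)) x y = pertCoef mass V x y := by
    refine entry_ofMat_of_schur (ne_top_of_le_ne_top ENNReal.ofReal_ne_top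
      (le_trans (schur_mono fun x y => ?_) hwt))
    exact le_mul_of_one_le_left' (((isWeight_wt hw hσ0.le).one_le x y).trans
      (wt_le_wtBig w hσ0.le x y))
  refine ⟨w, hw, hwq, σ, hσ0, K * (2 * (3 * A)), by positivity, ofMat (pertCoef mass V), ?_, ?_,
    ?_, ?_, ?_⟩
  · unfold wnorm
    simp only [hE]
    exact hwt
  · intro x y hxy
    rw [hE, pertCoef, hxy, sub_self, potCoef_zero hV hV2, potCoef_zero hV hV2, sub_self, mul_zero]
  · intro κ x y
    rw [hE, hE]
    simp [pertCoef, shift_apply]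
  · intro x y
    have h : ∀ b : Bool, (sg b : ℂ) * sg b = 1 := fun b => by cases b <;> simp [sg]
    rw [hE, hE, pertCoef, pertCoef, map_mul, conj_ofReal, map_sub, conj_potCoef, conj_potCoef,
      neg_sub, mdist_comm, add_comm (x.2.2 : ℕ)]
    push_cast
    linear_combination (1 / 2 * ((eigB mass x.2.2 ^ (-(1 / 2) : ℝ) : ℝ) : ℂ)
      * ((eigB mass y.2.2 ^ (-(1 / 2) : ℝ) : ℝ) : ℂ)
      * (potCoef V (x.1 - y.1) (mdist y.2.2 x.2.2) - potCoef V (x.1 - y.1) (y.2.2 + x.2.2)))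
        * (h x.2.1 - h y.2.1)
  · intro θ i j
    have := (hasSum_sineCoeff hν hρ hV θ i.2 j.2).mul_left
      (((1 / 2 * sg i.1 * eigB mass i.2 ^ (-(1 / 2) : ℝ) * eigB mass j.2 ^ (-(1 / 2) : ℝ) : ℝ) : ℂ))
    refine this.congr_fun fun k => ?_
    rw [hE, pertCoef]
    simp only [sub_zero]
    ring

end Floquet

/-! ### Coordinates on the phase space -/

section PhaseSpace

/-- Indices of a component and of a sine mode. -/
abbrev Mode := Bool × ℕ+

variable {r : ℝ}

/-- The coordinates of a point of the phase space. -/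
def coord (φ : Phase r) (i : Mode) : ℂ := if i.1 then φ.snd.coeff i.2 else φ.fst.coeff i.2

theorem coord_add (φ ψ : Phase r) (i : Mode) : coord (φ + ψ) i = coord φ i + coord ψ i := by
  unfold coord; split_ifs <;> rfl

theorem coord_smul (c : ℂ) (φ : Phase r) (i : Mode) : coord (c • φ) i = c * coord φ i := by
  unfold coord; split_ifs <;> rfl

/-- The weight `⟨m⟩ ^ r` of a mode. -/
def jw (r : ℝ) (i : Mode) : ℝ := jb i.2 ^ r

theorem jw_pos (r : ℝ) (i : Mode) : 0 < jw r i := Real.rpow_pos_of_pos (jb_pos _) _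

theorem one_le_jw (hr : 0 ≤ r) (i : Mode) : 1 ≤ jw r i := by
  refine Real.one_le_rpow ?_ hr
  unfold jb
  rw [Real.one_le_sqrt]
  nlinarith [sq_nonneg ((i.2 : ℕ+) : ℝ)]

theorem hasSum_norm_sq (a : SineSobolev r) :
    HasSum (fun m => ‖((jb m ^ r : ℝ) : ℂ) * a.coeff m‖ ^ 2) (‖a‖ ^ 2) := by
  have h := lp.hasSum_norm (p := 2) (by norm_num) (SineSobolev.toL2 r a)
  simp only [ENNReal.toReal_ofNat, Real.rpow_two] at h
  exact h

theorem hasSum_norm_sq_coord (φ : Phase r) :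
    HasSum (fun i => ‖(jw r i : ℂ) * coord φ i‖ ^ 2) (‖φ‖ ^ 2) := by
  rw [WithLp.prod_norm_sq_eq_of_L2]
  have e : ((Equiv.boolProdEquivSum ℕ+).symm : _ → _) = fun x => x.elim (Prod.mk false)
    (Prod.mk true) := by ext x <;> cases x <;> rfl
  rw [← (Equiv.boolProdEquivSum ℕ+).symm.hasSum_iff, e]
  exact HasSum.sum (hasSum_norm_sq φ.fst) (hasSum_norm_sq φ.snd)

/-- The coordinates, multiplied by the weights, form a sequence in `ℓ²`. -/
def toSeq (r : ℝ) : Phase r →ₗᵢ[ℂ] lp (fun _ : Mode => ℂ) 2 where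
  toFun φ := ⟨fun i => (jw r i : ℂ) * coord φ i, memℓp_gen (by
    simpa only [ENNReal.toReal_ofNat, Real.rpow_two] using (hasSum_norm_sq_coord φ).summable)⟩
  map_add' φ ψ := by
    apply lp.ext; funext i
    change (jw r i : ℂ) * coord (φ + ψ) i = jw r i * coord φ i + jw r i * coord ψ i
    rw [coord_add, mul_add]
  map_smul' c φ := by
    apply lp.ext; funext i
    change (jw r i : ℂ) * coord (c • φ) i = c * (jw r i * coord φ i)
    rw [coord_smul]; ring
  norm_map' φ := by
    have h := lp.hasSum_norm (p := 2) (by norm_num) (⟨fun i => (jw r i : ℂ) * coord φ i,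
      memℓp_gen (by simpa only [ENNReal.toReal_ofNat, Real.rpow_two]
        using (hasSum_norm_sq_coord φ).summable)⟩ : lp (fun _ : Mode => ℂ) 2)
    simp only [ENNReal.toReal_ofNat, Real.rpow_two] at h
    exact (pow_left_inj₀ (norm_nonneg _) (norm_nonneg _) two_ne_zero).1
      (h.unique (hasSum_norm_sq_coord φ))

theorem toSeq_apply (φ : Phase r) (i : Mode) : toSeq r φ i = (jw r i : ℂ) * coord φ i := rfl

theorem exists_coord_eq (f : Mode → ℂ) (hf : Memℓp (fun i => (jw r i : ℂ) * f i) 2) :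
    ∃ φ : Phase r, ∀ i, coord φ i = f i := by
  have h := hf.summable (by norm_num)
  have hb : ∀ b : Bool, Memℓp (fun m => ((jb m ^ r : ℝ) : ℂ) * f (b, m)) 2 := fun b => by
    refine memℓp_gen ?_
    have h2 := h.comp_injective (Prod.mk_right_injective (β := ℕ+) b)
    exact h2
  let u : Bool → SineSobolev r := fun b => ⟨fun m => f (b, m), hb b⟩
  have hu : ∀ b m, (u b).coeff m = f (b, m) := fun b m => rfl
  refine ⟨WithLp.toLp 2 (u false, u true), fun i => ?_⟩
  obtain ⟨b, m⟩ := i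
  unfold coord
  cases b
  · exact hu false m
  · exact hu true m

/-- The phase space in weighted coordinates. -/
def phaseEquiv (r : ℝ) : Phase r ≃ₗᵢ[ℂ] lp (fun _ : Mode => ℂ) 2 :=
  LinearIsometryEquiv.ofSurjective (toSeq r) fun f => by
    have e : (fun i => (jw r i : ℂ) * ((jw r i : ℂ)⁻¹ * f i)) = f := by
      funext i
      rw [mul_inv_cancel_left₀]
      exact_mod_cast (jw_pos r i).ne'
    obtain ⟨φ, hφ⟩ := exists_coord_eq (r := r) (fun i => (jw r i : ℂ)⁻¹ * f i)
      (by rw [e]; exact lp.memℓp f)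
    refine ⟨φ, lp.ext (funext fun i => ?_)⟩
    rw [toSeq_apply, hφ]
    exact congrFun e i

theorem phaseEquiv_apply (φ : Phase r) (i : Mode) :
    phaseEquiv r φ i = (jw r i : ℂ) * coord φ i := rfl

theorem coord_eq (φ : Phase r) (i : Mode) : coord φ i = (jw r i : ℂ)⁻¹ * phaseEquiv r φ i := by
  rw [phaseEquiv_apply, inv_mul_cancel_left₀]
  exact_mod_cast (jw_pos r i).ne'

theorem phase_ext {φ ψ : Phase r} (h : ∀ i, coord φ i = coord ψ i) : φ = ψ :=
  (phaseEquiv r).injective (lp.ext (funext fun i => by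
    rw [phaseEquiv_apply, phaseEquiv_apply, h]))

theorem norm_coord_le (hr : 0 ≤ r) (φ : Phase r) (i : Mode) : ‖coord φ i‖ ≤ ‖φ‖ := by
  have h := lp.norm_apply_le_norm two_ne_zero (phaseEquiv r φ) i
  rw [LinearIsometryEquiv.norm_map, phaseEquiv_apply, norm_mul, Complex.norm_real,
    Real.norm_of_nonneg (jw_pos r i).le] at h
  nlinarith [one_le_jw hr i, norm_nonneg (coord φ i)]

/-- A coordinate as a continuous linear functional. -/
def coordCLM (r : ℝ) (i : Mode) : Phase r →L[ℂ] ℂ :=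
  LinearMap.mkContinuous { toFun := fun φ => coord φ i, map_add' := fun _ _ => coord_add _ _ _,
                           map_smul' := fun _ _ => coord_smul _ _ _ } (jw r i)⁻¹ fun φ => by
    have h := lp.norm_apply_le_norm two_ne_zero (phaseEquiv r φ) i
    rw [LinearIsometryEquiv.norm_map] at h
    change ‖coord φ i‖ ≤ _
    rw [coord_eq, norm_mul, norm_inv, Complex.norm_real, Real.norm_of_nonneg (jw_pos r i).le]
    have := jw_pos r i
    gcongr

/-- The basis of the phase space. -/
def bas (r : ℝ) (j : Mode) : Phase r := (phaseEquiv r).symm (lp.single 2 j (jw r j : ℂ))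

theorem coord_bas (i j : Mode) : coord (bas r j) i = if i = j then 1 else 0 := by
  rw [coord_eq, bas, LinearIsometryEquiv.apply_symm_apply, lp.single_apply, Pi.single_apply]
  split_ifs with h
  · subst h
    rw [inv_mul_cancel₀]
    exact_mod_cast (jw_pos r i).ne'
  · rw [mul_zero]

theorem hasSum_bas (φ : Phase r) : HasSum (fun j => coord φ j • bas r j) φ := by
  have h := (lp.hasSum_single (p := 2) (by norm_num) (phaseEquiv r φ)).mapL
    ((phaseEquiv r).symm.toContinuousLinearEquiv : _ →L[ℂ] Phase r)
  simp only [ContinuousLinearEquiv.coe_coe, LinearIsometryEquiv.coe_toContinuousLinearEquiv,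
    LinearIsometryEquiv.symm_apply_apply] at h
  refine h.congr_fun fun j => ?_
  rw [bas, ← map_smul, ← lp.single_smul, phaseEquiv_apply, smul_eq_mul, mul_comm]

/-- The matrix of an operator on the phase space. -/
def mat (T : Phase r →L[ℂ] Phase r) (i j : Mode) : ℂ := coord (T (bas r j)) i

theorem hasSum_mat (T : Phase r →L[ℂ] Phase r) (φ : Phase r) (i : Mode) :
    HasSum (fun j => mat T i j * coord φ j) (coord (T φ) i) := by
  have h := ((hasSum_bas φ).mapL T).mapL (coordCLM r i)
  refine h.congr_fun fun j => ?_
  rw [map_smul, map_smul, smul_eq_mul, mul_comm]; rfl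

theorem mat_ext {T S : Phase r →L[ℂ] Phase r} (h : ∀ i j, mat T i j = mat S i j) : T = S := by
  ext1 φ
  refine phase_ext fun i => (hasSum_mat T φ i).unique ?_
  simpa only [h] using hasSum_mat S φ i

theorem hasSum_mat_comp (T S : Phase r →L[ℂ] Phase r) (i j : Mode) :
    HasSum (fun l => mat T i l * mat S l j) (mat (T * S) i j) :=
  hasSum_mat T (S (bas r j)) i

theorem mat_one (i j : Mode) : mat (1 : Phase r →L[ℂ] Phase r) i j = if i = j then 1 else 0 :=
  coord_bas i j

theorem mat_add (T S : Phase r →L[ℂ] Phase r) (i j : Mode) :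
    mat (T + S) i j = mat T i j + mat S i j := coord_add _ _ _

end PhaseSpace

/-! ### Schur's test -/

section SchurTest

variable {J : Type*}

/-- Cauchy–Schwarz for the measure a: expand the square as a double sum, use 2xy ≤ x² + y² and
symmetrise. -/
theorem sq_tsum_mul_le (a f : J → ℝ≥0∞) :
    (∑' j, a j * f j) ^ 2 ≤ (∑' j, a j) * ∑' j, a j * f j ^ 2 := by
  have h : ∀ x y : ℝ≥0∞, 2 * (x * y) ≤ x ^ 2 + y ^ 2 := fun x y => by
    rcases eq_or_ne x ∞ with rfl | hx
    · simp
    rcases eq_or_ne y ∞ with rfl | hy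
    · simp
    lift x to ℝ≥0 using hx
    lift y to ℝ≥0 using hy
    norm_cast
    rw [← mul_assoc]
    exact two_mul_le_add_sq x y
  have e : ∀ u v : J → ℝ≥0∞, (∑' j, u j) * ∑' l, v l = ∑' j, ∑' l, u j * v l := fun u v => by
    rw [← ENNReal.tsum_mul_right]; simp only [ENNReal.tsum_mul_left]
  have h2 : 2 * (∑' j, a j * f j) ^ 2 ≤ 2 * ((∑' j, a j) * ∑' j, a j * f j ^ 2) := by
    calc 2 * (∑' j, a j * f j) ^ 2 = ∑' j, ∑' l, a j * a l * (2 * (f j * f l)) := by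
          rw [sq, e, ← ENNReal.tsum_mul_left]
          refine tsum_congr fun j => ?_
          rw [← ENNReal.tsum_mul_left]
          exact tsum_congr fun l => by ring
      _ ≤ ∑' j, ∑' l, a j * a l * (f j ^ 2 + f l ^ 2) := by gcongr; exact h _ _
      _ = (∑' j, a j * f j ^ 2) * (∑' l, a l) + (∑' j, a j) * ∑' l, a l * f l ^ 2 := by
          rw [e, e, ← ENNReal.tsum_add]
          refine tsum_congr fun j => ?_
          rw [← ENNReal.tsum_add]
          exact tsum_congr fun l => by ring
      _ = _ := by rw [mul_comm (∑' j, a j * f j ^ 2), two_mul]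
  exact (ENNReal.mul_le_mul_iff_right two_ne_zero ENNReal.ofNat_ne_top).1 h2

theorem tsum_sq_tsum_mul_le {A : J → J → ℝ≥0∞} {C : ℝ≥0∞} (hA : schur A ≤ C) (f : J → ℝ≥0∞) :
    ∑' i, (∑' j, A i j * f j) ^ 2 ≤ C ^ 2 * ∑' j, f j ^ 2 := by
  obtain ⟨h1, h2⟩ := schur_le_iff.1 hA
  calc ∑' i, (∑' j, A i j * f j) ^ 2 ≤ ∑' i, C * ∑' j, A i j * f j ^ 2 :=
        ENNReal.tsum_le_tsum fun i => (sq_tsum_mul_le _ _).trans (by gcongr; exact h2 i)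
    _ = C * ∑' j, (∑' i, A i j) * f j ^ 2 := by
        rw [ENNReal.tsum_mul_left, ENNReal.tsum_comm]
        simp only [ENNReal.tsum_mul_right]
    _ ≤ C * ∑' j, C * f j ^ 2 := by gcongr; exact h1 _
    _ = _ := by rw [ENNReal.tsum_mul_left]; ring

theorem l2_enorm_sq_eq (f : lp (fun _ : J => ℂ) 2) : ‖f‖ₑ ^ 2 = ∑' x, ‖f x‖ₑ ^ 2 := by
  have h := lp.hasSum_norm (p := 2) (by norm_num) f
  simp only [ENNReal.toReal_ofNat, Real.rpow_two] at h
  rw [← ofReal_norm, ← ENNReal.ofReal_pow (norm_nonneg _), ← h.tsum_eq,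
    ENNReal.ofReal_tsum_of_nonneg (fun _ => by positivity) h.summable]
  simp only [ENNReal.ofReal_pow (norm_nonneg _), ofReal_norm]

theorem exists_clm_of_schur {A : J → J → ℂ} {C : ℝ≥0} (hA : schur (fun i j => ‖A i j‖ₑ) ≤ C) :
    ∃ T : lp (fun _ : J => ℂ) 2 →L[ℂ] lp (fun _ : J => ℂ) 2, ‖T‖ ≤ C ∧
      ∀ f i, T f i = ∑' j, A i j * f j := by
  have hb : ∀ f : lp (fun _ : J => ℂ) 2,
      ∑' i, (∑' j, ‖A i j‖ₑ * ‖f j‖ₑ) ^ 2 ≤ (C * ‖f‖ₑ) ^ 2 := fun f => by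
    rw [mul_pow, l2_enorm_sq_eq]
    exact tsum_sq_tsum_mul_le hA fun j => ‖f j‖ₑ
  have htop : ∀ f : lp (fun _ : J => ℂ) 2, (C * ‖f‖ₑ) ^ 2 ≠ ∞ := fun f =>
    ENNReal.pow_ne_top (ENNReal.mul_ne_top ENNReal.coe_ne_top (by simp))
  have hs : ∀ (f : lp (fun _ : J => ℂ) 2) i, Summable fun j => A i j * f j := fun f i => by
    have h1 := ((ENNReal.le_tsum i).trans (hb f)).trans_lt (htop f).lt_top
    have h2 : ∑' j, ‖A i j * f j‖ₑ ≠ ∞ := by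
      simp only [enorm_mul]
      intro h
      rw [h] at h1; simp at h1
    exact Summable.of_norm ((ENNReal.summable_toReal h2).congr fun j => toReal_enorm _)
  have hn : ∀ f : lp (fun _ : J => ℂ) 2, ∑' i, ‖∑' j, A i j * f j‖ₑ ^ 2 ≤ (C * ‖f‖ₑ) ^ 2 :=
    fun f => (ENNReal.tsum_le_tsum fun i => by
      gcongr
      refine (enorm_tsum_le_tsum_enorm).trans ?_
      simp only [enorm_mul, le_refl]).trans (hb f)
  have hmem : ∀ f : lp (fun _ : J => ℂ) 2, Memℓp (fun i => ∑' j, A i j * f j) 2 := fun f => by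
    refine memℓp_gen ?_
    simp only [ENNReal.toReal_ofNat, Real.rpow_two]
    have h := ((hn f).trans_lt (htop f).lt_top).ne
    exact (ENNReal.summable_toReal h).congr fun i => by rw [ENNReal.toReal_pow, toReal_enorm]
  let T₀ : lp (fun _ : J => ℂ) 2 →ₗ[ℂ] lp (fun _ : J => ℂ) 2 :=
    { toFun := fun f => ⟨fun i => ∑' j, A i j * f j, hmem f⟩
      map_add' := fun f g => lp.ext (funext fun i => by
        change ∑' j, A i j * (f j + g j) = _ + _
        simp only [mul_add]
        exact (hs f i).tsum_add (hs g i))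
      map_smul' := fun c f => lp.ext (funext fun i => by
        change ∑' j, A i j * (c * f j) = c * _
        rw [← tsum_mul_left]
        exact tsum_congr fun j => by ring) }
  have hT : ∀ f, ‖T₀ f‖ ≤ C * ‖f‖ := fun f => by
    have h : ‖T₀ f‖ₑ ^ 2 ≤ (C * ‖f‖ₑ) ^ 2 := by
      rw [l2_enorm_sq_eq]; exact hn f
    have h2 := (ENNReal.pow_le_pow_left_iff two_ne_zero).1 h
    rw [← ofReal_norm, ← ofReal_norm, ← ENNReal.ofReal_coe_nnreal,
      ← ENNReal.ofReal_mul C.coe_nonneg] at h2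
    exact (ENNReal.ofReal_le_ofReal_iff (by positivity)).1 h2
  exact ⟨T₀.mkContinuous C hT, LinearMap.mkContinuous_norm_le _ C.coe_nonneg _,
    fun f i => rfl⟩

theorem exists_mat_eq {r : ℝ} {A : Mode → Mode → ℂ} {C : ℝ} (hC : 0 ≤ C)
    (hA : schur (fun i j => ENNReal.ofReal (jw r i / jw r j) * ‖A i j‖ₑ) ≤ ENNReal.ofReal C) :
    ∃ T : Phase r →L[ℂ] Phase r, ‖T‖ ≤ C ∧ ∀ i j, mat T i j = A i j := by
  lift C to ℝ≥0 using hC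
  rw [ENNReal.ofReal_coe_nnreal] at hA
  obtain ⟨T, hT, h⟩ := exists_clm_of_schur
    (A := fun i j => (jw r i / jw r j : ℝ) * A i j) (C := C) (by
      refine (schur_mono fun i j => le_of_eq ?_).trans hA
      rw [enorm_mul, ← ofReal_norm (((jw r i / jw r j : ℝ) : ℂ)), Complex.norm_real,
        Real.norm_of_nonneg (div_nonneg (jw_pos r i).le (jw_pos r j).le)])
  let e := phaseEquiv r
  refine ⟨(e.symm.toContinuousLinearEquiv : _ →L[ℂ] Phase r) ∘L T ∘L
    (e.toContinuousLinearEquiv : Phase r →L[ℂ] _), ?_, fun i j => ?_⟩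
  · refine ContinuousLinearMap.opNorm_le_bound _ C.coe_nonneg fun φ => ?_
    simp only [ContinuousLinearMap.coe_comp, Function.comp_apply, ContinuousLinearEquiv.coe_coe,
      LinearIsometryEquiv.coe_toContinuousLinearEquiv, LinearIsometryEquiv.norm_map]
    refine (T.le_opNorm _).trans ?_
    rw [LinearIsometryEquiv.norm_map]
    gcongr
  · unfold mat
    simp only [ContinuousLinearMap.coe_comp, Function.comp_apply, ContinuousLinearEquiv.coe_coe,
      LinearIsometryEquiv.coe_toContinuousLinearEquiv]
    have hi : (jw r i : ℂ) ≠ 0 := by exact_mod_cast (jw_pos r i).ne'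
    have hj : (jw r j : ℂ) ≠ 0 := by exact_mod_cast (jw_pos r j).ne'
    rw [coord_eq, LinearIsometryEquiv.apply_symm_apply, h, bas,
      LinearIsometryEquiv.apply_symm_apply, tsum_eq_single j]
    · rw [lp.single_apply_self]
      push_cast
      field_simp
    · intro l hl
      rw [lp.single_apply_ne _ _ _ hl, mul_zero]

end SchurTest


/-! ### Symbols of Toeplitz operators -/

section Symbols

variable {ν : ℕ}

/-- The character `e ^ (i θ · k)`. -/
def ex (θ : EuclideanSpace ℝ (Fin ν)) (k : Fin ν → ℤ) : ℂ := Complex.exp (Complex.I * dotk θ k)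

theorem norm_ex (θ : EuclideanSpace ℝ (Fin ν)) (k : Fin ν → ℤ) : ‖ex θ k‖ = 1 := by
  rw [ex, mul_comm]; exact Complex.norm_exp_ofReal_mul_I _

theorem ex_zero (θ : EuclideanSpace ℝ (Fin ν)) : ex θ 0 = 1 := by simp [ex, dotk]

theorem ex_add (θ : EuclideanSpace ℝ (Fin ν)) (k l : Fin ν → ℤ) :
    ex θ (k + l) = ex θ k * ex θ l := by
  rw [ex, ex, ex, ← Complex.exp_add, dotk_add_right]; push_cast; rw [mul_add]

theorem norm_ex_sub_le (θ θ' : EuclideanSpace ℝ (Fin ν)) (k : Fin ν → ℤ) :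
    ‖ex θ k - ex θ' k‖ ≤ ‖θ - θ'‖ * kabs k := by
  have h : ex θ k - ex θ' k = ex θ' k * (Complex.exp (Complex.I * dotk (θ - θ') k) - 1) := by
    rw [mul_sub, mul_one, ex, ex, ← Complex.exp_add, ← mul_add, dotk_sub_left]
    push_cast
    rw [add_sub_cancel]
  rw [h, norm_mul, norm_ex, one_mul]
  exact (Real.norm_exp_I_mul_ofReal_sub_one_le).trans (abs_dotk_le _ _)

theorem summable_evalSym (θ : EuclideanSpace ℝ (Fin ν)) (i : Mode)
    (f : lp (fun _ : Idx ν => ℂ) 1) : Summable fun k => f (k, i) * ex θ k := by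
  have h := lp.hasSum_norm (p := 1) (by norm_num) f
  simp only [ENNReal.toReal_one, Real.rpow_one] at h
  refine Summable.of_norm ?_
  simp only [norm_mul, norm_ex, mul_one]
  exact h.summable.comp_injective (Prod.mk_left_injective i)

/-- The functional `f ↦ ∑ f (k, i) e ^ (i θ · k)`. -/
def evalSym (θ : EuclideanSpace ℝ (Fin ν)) (i : Mode) : lp (fun _ : Idx ν => ℂ) 1 →L[ℂ] ℂ :=
  LinearMap.mkContinuous
    { toFun := fun f => ∑' k, f (k, i) * ex θ k
      map_add' := fun f g => by
        rw [← (summable_evalSym θ i f).tsum_add (summable_evalSym θ i g)]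
        exact tsum_congr fun k => add_mul (f (k, i)) (g (k, i)) (ex θ k)
      map_smul' := fun c f => by
        rw [smul_eq_mul, RingHom.id_apply, ← tsum_mul_left]
        exact tsum_congr fun k => mul_assoc c (f (k, i)) (ex θ k) } 1 fun f => by
    have h := lp.hasSum_norm (p := 1) (by norm_num) f
    simp only [ENNReal.toReal_one, Real.rpow_one] at h
    have hinj := Prod.mk_left_injective (α := Fin ν → ℤ) i
    have h2 : Summable fun k => ‖f (k, i)‖ := h.summable.comp_injective hinj
    rw [one_mul, ← h.tsum_eq]
    refine (tsum_of_norm_bounded h2.hasSum fun k => ?_).trans ?_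
    · rw [norm_mul, norm_ex, mul_one]
    · exact h2.tsum_le_tsum_of_inj _ hinj (fun _ _ => norm_nonneg _) (fun _ => le_rfl) h.summable

theorem hasSum_evalSym (θ : EuclideanSpace ℝ (Fin ν)) (i : Mode)
    (f : lp (fun _ : Idx ν => ℂ) 1) : HasSum (fun k => f (k, i) * ex θ k) (evalSym θ i f) :=
  (summable_evalSym θ i f).hasSum

/-- The symbol of an operator that commutes with the shifts. -/
def sym (a : Op (Idx ν)) (θ : EuclideanSpace ℝ (Fin ν)) (i j : Mode) : ℂ :=
  evalSym θ i (a (lp.single 1 (0, j) (1 : ℂ)))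

theorem hasSum_sym (a : Op (Idx ν)) (θ : EuclideanSpace ℝ (Fin ν)) (i j : Mode) :
    HasSum (fun k => entry a (k, i) (0, j) * ex θ k) (sym a θ i j) :=
  hasSum_evalSym θ i _

theorem sym_one (θ : EuclideanSpace ℝ (Fin ν)) (i j : Mode) :
    sym 1 θ i j = if i = j then 1 else 0 := by
  refine (hasSum_sym 1 θ i j).unique ?_
  have : (fun k : Fin ν → ℤ => entry 1 (k, i) (0, j) * ex θ k)
      = fun k => if k = 0 then (if i = j then 1 else 0) else 0 := by
    funext k
    simp only [entry_one, Prod.mk.injEq]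
    by_cases hk : k = 0
    · subst hk
      simp [ex_zero]
    · simp [hk]
  rw [this]
  exact hasSum_ite_eq 0 _

theorem sym_add (a b : Op (Idx ν)) (θ : EuclideanSpace ℝ (Fin ν)) (i j : Mode) :
    sym (a + b) θ i j = sym a θ i j + sym b θ i j :=
  map_add (evalSym θ i) _ _

theorem evalSym_single {a : Op (Idx ν)} (ha : ∀ κ, Inv (shift κ) a)
    (θ : EuclideanSpace ℝ (Fin ν)) (i : Mode) (k : Fin ν → ℤ) (l : Mode) :
    evalSym θ i (a (lp.single 1 (k, l) (1 : ℂ))) = ex θ k * sym a θ i l := by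
  have h1 := (hasSum_sym a θ i l).mul_left (ex θ k)
  have h2 := hasSum_evalSym θ i (a (lp.single 1 (k, l) (1 : ℂ)))
  rw [← (Equiv.addRight k).hasSum_iff] at h2
  have e : (fun k' => ex θ k * (entry a (k', i) (0, l) * ex θ k'))
      = (fun k' => (a (lp.single 1 (k, l) (1 : ℂ))) (k', i) * ex θ k') ∘ Equiv.addRight k := by
    funext k'
    rw [Function.comp_apply, Equiv.coe_addRight]
    have h := ha k (k', i) (0, l)
    rw [shift_apply, shift_apply, zero_add] at h
    rw [← h, ← mul_assoc, mul_comm (ex θ k), mul_assoc, mul_comm (ex θ k), ← ex_add]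
    rfl
  rw [e] at h1
  exact h2.unique h1

/-- A Toeplitz matrix acts by convolution in k, which evaluation at θ turns into multiplication by
the symbol. Only the factor on the left has to be Toeplitz. -/
theorem hasSum_sym_mul_evalSym {a : Op (Idx ν)} (ha : ∀ κ, Inv (shift κ) a)
    (θ : EuclideanSpace ℝ (Fin ν)) (i : Mode) (f : lp (fun _ : Idx ν => ℂ) 1) :
    HasSum (fun l => sym a θ i l * evalSym θ l f) (evalSym θ i (a f)) := by
  have h2 := (hasSum_apply a f).mapL (evalSym θ i)
  have e : (fun y : Idx ν => evalSym θ i (f y • a (lp.single 1 y (1 : ℂ))))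
      = (fun y : Mode × (Fin ν → ℤ) => sym a θ i y.1 * (f (y.2, y.1) * ex θ y.2))
        ∘ Equiv.prodComm _ _ := by
    funext y
    obtain ⟨k, l⟩ := y
    rw [map_smul, evalSym_single ha, smul_eq_mul, Function.comp_apply, Equiv.prodComm_apply,
      Prod.swap_prod_mk, mul_left_comm, mul_left_comm (sym a θ i l), mul_comm (sym a θ i l)]
    exact mul_left_comm _ _ _
  have h3 : HasSum (fun y : Mode × (Fin ν → ℤ) => sym a θ i y.1 * (f (y.2, y.1) * ex θ y.2))
      (evalSym θ i (a f)) := by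
    rw [← (Equiv.prodComm (Fin ν → ℤ) Mode).hasSum_iff, ← e]
    exact h2
  have h4 : ∀ l, HasSum (fun k => sym a θ i l * (f (k, l) * ex θ k)) (sym a θ i l * evalSym θ l f) :=
    fun l => (hasSum_evalSym θ l f).mul_left _
  exact h3.prod_fiberwise h4

theorem hasSum_sym_mul {a : Op (Idx ν)} (ha : ∀ κ, Inv (shift κ) a) (b : Op (Idx ν))
    (θ : EuclideanSpace ℝ (Fin ν)) (i j : Mode) :
    HasSum (fun l => sym a θ i l * sym b θ l j) (sym (a * b) θ i j) := by
  exact hasSum_sym_mul_evalSym ha θ i (b (lp.single 1 (0, j) (1 : ℂ)))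

theorem tsum_row_le (F : Idx ν → Idx ν → ℝ≥0∞)
    (hF : ∀ κ x y, F (shift κ x) (shift κ y) = F x y) (i : Mode) :
    ∑' y : Idx ν, F (y.1, i) (0, y.2) ≤ schur F := by
  refine le_trans (le_of_eq ?_) (row_le_schur F (0, i))
  rw [← ((Equiv.neg _).prodCongr (Equiv.refl _)).tsum_eq]
  refine tsum_congr fun y => ?_
  have h := hF y.1 (-y.1, i) (0, y.2)
  simp only [shift_apply, neg_add_cancel, zero_add] at h
  exact h.symm

theorem schur_sym_le (F : Idx ν → Idx ν → ℝ≥0∞)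
    (hF : ∀ κ x y, F (shift κ x) (shift κ y) = F x y) :
    schur (fun i j : Mode => ∑' k, F (k, i) (0, j)) ≤ schur F := by
  refine schur_le_iff.2 ⟨fun j => ?_, fun i => ?_⟩
  · refine le_trans (le_of_eq ?_) (col_le_schur F (0, j))
    rw [ENNReal.tsum_comm, ← ENNReal.tsum_prod (f := fun k i => F (k, i) (0, j))]
  · refine le_trans (le_of_eq ?_) (tsum_row_le F hF i)
    rw [ENNReal.tsum_comm, ← ENNReal.tsum_prod (f := fun k j => F (k, i) (0, j))]

theorem jb_le_mul (m n : ℕ+) : jb m ≤ jb n * (1 + mdist m n) := by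
  unfold jb
  refine Real.sqrt_le_iff.2 ⟨by positivity, ?_⟩
  rw [mul_pow, Real.sq_sqrt (by positivity)]
  have h : (m : ℝ) ≤ n + mdist m n := by
    have : (m : ℕ) ≤ n + mdist m n := by unfold mdist; omega
    exact_mod_cast this
  have h1 := one_le_pnat m
  have h2 := one_le_pnat n
  have h3 : (0 : ℝ) ≤ mdist m n := Nat.cast_nonneg _
  have h4 : ((m : ℕ) : ℝ) ^ 2 ≤ ((n : ℕ) + (mdist m n : ℝ)) ^ 2 := by gcongr
  nlinarith [mul_nonneg h3 (sq_nonneg ((n : ℝ) - 1)), sq_nonneg ((n : ℝ) * mdist m n)]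

theorem jw_div_le {r : ℝ} (hr : 0 ≤ r) (i j : Mode) :
    jw r i / jw r j ≤ (1 + mdist i.2 j.2 : ℝ) ^ ⌈r⌉₊ := by
  have h0 : (1 : ℝ) ≤ 1 + mdist i.2 j.2 := by simp
  rw [div_le_iff₀ (jw_pos r j)]
  calc jw r i ≤ (jb j.2 * (1 + mdist i.2 j.2)) ^ r :=
        Real.rpow_le_rpow (jb_pos _).le (jb_le_mul _ _) hr
    _ = (1 + mdist i.2 j.2 : ℝ) ^ r * jw r j := by
        rw [Real.mul_rpow (jb_pos _).le (by positivity), mul_comm]; rfl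
    _ ≤ _ := by
        gcongr
        · exact (jw_pos r j).le
        rw [← Real.rpow_natCast]
        exact Real.rpow_le_rpow_of_exponent_le h0 (Nat.le_ceil r)

/-- Passing to weighted coordinates multiplies an entry by ⟨m⟩^r/⟨n⟩^r ≤ (1 + |m - n|)^{⌈r⌉}, which
w absorbs up to a constant depending on r; the exponential weight absorbs the multiplier in k.
Characters are used for the bound, and their differences for continuity in θ. -/
theorem exists_mat_eq_tsum {w : ℕ → ℝ≥0∞} {r c σ : ℝ} (hr : 0 ≤ r) (hc : 0 ≤ c)
    (hw : ∀ l : ℕ, ENNReal.ofReal ((1 + l : ℝ) ^ ⌈r⌉₊) ≤ ENNReal.ofReal c * w l)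
    {a : Op (Idx ν)} (ha : ∀ κ, Inv (shift κ) a) {K : ℝ} (hK : 0 ≤ K)
    (haK : wnorm (wt w σ) a ≤ ENNReal.ofReal K) {m : (Fin ν → ℤ) → ℂ} {B : ℝ} (hB : 0 ≤ B)
    (hm : ∀ k, ‖m k‖ ≤ B * Real.exp (σ * kabs k)) :
    ∃ T : Phase r →L[ℂ] Phase r, ‖T‖ ≤ c * B * K ∧
      ∀ i j, mat T i j = ∑' k, entry a (k, i) (0, j) * m k := by
  refine exists_mat_eq (by positivity) ?_
  rw [ENNReal.ofReal_mul (by positivity)]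
  refine le_trans ?_ (mul_le_mul_right haK _)
  refine le_trans (schur_mono fun i j => ?_) ((schur_const_mul_le _ _).trans
    (mul_le_mul_right (schur_sym_le (fun x y => wt w σ x y * ‖entry a x y‖ₑ) fun κ x y => ?_) _))
  · refine (mul_le_mul_right (enorm_tsum_le_tsum_enorm) _).trans ?_
    rw [← ENNReal.tsum_mul_left, ← ENNReal.tsum_mul_left]
    refine ENNReal.tsum_le_tsum fun k => ?_
    have h1 : ENNReal.ofReal (jw r i / jw r j) ≤ ENNReal.ofReal c * w (mdist i.2 j.2) :=
      (ENNReal.ofReal_le_ofReal (jw_div_le hr i j)).trans (hw _)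
    have h2 : ‖m k‖ₑ ≤ ENNReal.ofReal B * ENNReal.ofReal (Real.exp (σ * kabs k)) := by
      rw [← ENNReal.ofReal_mul hB, ← ofReal_norm]
      exact ENNReal.ofReal_le_ofReal (hm k)
    have h3 : (1 : ℝ≥0∞) ≤ ENNReal.ofReal (Real.sqrt i.2) := by
      rw [← ENNReal.ofReal_one]; exact ENNReal.ofReal_le_ofReal (one_le_sqrt_pnat _)
    rw [enorm_mul, ENNReal.ofReal_mul hc]
    calc ENNReal.ofReal (jw r i / jw r j) * (‖entry a (k, i) (0, j)‖ₑ * ‖m k‖ₑ)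
        ≤ (ENNReal.ofReal c * w (mdist i.2 j.2)) * (‖entry a (k, i) (0, j)‖ₑ *
          (ENNReal.ofReal B * ENNReal.ofReal (Real.exp (σ * kabs k)))) := by gcongr
      _ = ENNReal.ofReal c * ENNReal.ofReal B * (ENNReal.ofReal (Real.exp (σ * kabs k))
          * w (mdist i.2 j.2) * 1 * ‖entry a (k, i) (0, j)‖ₑ) := by ring
      _ ≤ ENNReal.ofReal c * ENNReal.ofReal B * (ENNReal.ofReal (Real.exp (σ * kabs k))
          * w (mdist i.2 j.2) * ENNReal.ofReal (Real.sqrt i.2) * ‖entry a (k, i) (0, j)‖ₑ) := by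
          gcongr
      _ = _ := by simp only [wt, sub_zero]
  · rw [ha κ x y]
    simp only [wt, shift_apply, add_sub_add_right_eq_sub]

/-- `T` is the operator on the phase space whose matrix is the symbol of `a` at `θ`. -/
def IsSym {r : ℝ} (a : Op (Idx ν)) (θ : EuclideanSpace ℝ (Fin ν)) (T : Phase r →L[ℂ] Phase r) :
    Prop := ∀ i j, mat T i j = sym a θ i j

variable {r : ℝ} {θ : EuclideanSpace ℝ (Fin ν)}

theorem IsSym.unique {a : Op (Idx ν)} {T S : Phase r →L[ℂ] Phase r} (hT : IsSym a θ T)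
    (hS : IsSym a θ S) : T = S := mat_ext fun i j => (hT i j).trans (hS i j).symm

theorem IsSym.one : IsSym (1 : Op (Idx ν)) θ (1 : Phase r →L[ℂ] Phase r) := fun i j => by
  rw [mat_one, sym_one]

theorem IsSym.add {a b : Op (Idx ν)} {T S : Phase r →L[ℂ] Phase r} (hT : IsSym a θ T)
    (hS : IsSym b θ S) : IsSym (a + b) θ (T + S) := fun i j => by
  rw [mat_add, sym_add, hT, hS]

theorem IsSym.mul {a b : Op (Idx ν)} {T S : Phase r →L[ℂ] Phase r} (ha : ∀ κ, Inv (shift κ) a)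
    (hT : IsSym a θ T) (hS : IsSym b θ S) : IsSym (a * b) θ (T * S) := fun i j => by
  refine (hasSum_mat_comp T S i j).unique ?_
  simpa only [hT i, hS _ j] using hasSum_sym_mul ha b θ i j

/-- Operators with the given symbols exist, and depend continuously on the angles. -/
theorem exists_isSym {w : ℕ → ℝ≥0∞} {r c σ : ℝ} (hr : 0 ≤ r) (hc : 0 ≤ c) (hσ : 0 < σ)
    (hw : ∀ l : ℕ, ENNReal.ofReal ((1 + l : ℝ) ^ ⌈r⌉₊) ≤ ENNReal.ofReal c * w l)
    {a : Op (Idx ν)} (ha : ∀ κ, Inv (shift κ) a) {K : ℝ} (hK : 0 ≤ K)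
    (haK : wnorm (wt w σ) a ≤ ENNReal.ofReal K) :
    ∃ T : EuclideanSpace ℝ (Fin ν) → Phase r →L[ℂ] Phase r, Continuous T ∧
      ∀ θ, ‖T θ‖ ≤ c * K ∧ IsSym a θ (T θ) := by
  have h1 : ∀ θ : EuclideanSpace ℝ (Fin ν), ∃ T : Phase r →L[ℂ] Phase r, ‖T‖ ≤ c * K ∧
      IsSym a θ T := fun θ => by
    obtain ⟨T, hT, h⟩ := exists_mat_eq_tsum hr hc hw ha hK haK zero_le_one (m := ex θ)
      fun k => by
        rw [norm_ex, one_mul]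
        exact Real.one_le_exp (mul_nonneg hσ.le (kabs_nonneg k))
    rw [mul_one] at hT
    exact ⟨T, hT, fun i j => (h i j).trans (hasSum_sym a θ i j).tsum_eq⟩
  choose T hT hTs using h1
  refine ⟨T, ?_, fun θ => ⟨hT θ, hTs θ⟩⟩
  refine (LipschitzWith.of_dist_le_mul (K := ⟨c * σ⁻¹ * K, by positivity⟩) fun θ θ' => ?_).continuous
  obtain ⟨S, hS, h⟩ := exists_mat_eq_tsum hr hc hw ha hK haK
    (B := ‖θ - θ'‖ * σ⁻¹) (by positivity) (m := fun k => ex θ k - ex θ' k) fun k => by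
      refine (norm_ex_sub_le θ θ' k).trans ?_
      have h2 : σ * kabs k ≤ Real.exp (σ * kabs k) := by
        linarith [Real.add_one_le_exp (σ * kabs k)]
      rw [mul_assoc]
      gcongr
      rw [inv_mul_eq_div, le_div_iff₀ hσ, mul_comm]
      exact h2
  have e : T θ = T θ' + S := mat_ext fun i j => by
    rw [mat_add, hTs, hTs, h]
    have h3 := ((hasSum_sym a θ i j).sub (hasSum_sym a θ' i j)).tsum_eq
    simp only [← mul_sub] at h3
    rw [h3]; ring
  rw [dist_eq_norm, dist_eq_norm, e, add_sub_cancel_left]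
  refine hS.trans (le_of_eq ?_)
  change _ = c * σ⁻¹ * K * ‖θ - θ'‖
  ring

theorem summable_row {a : Op (Idx ν)} (ha : ∀ κ, Inv (shift κ) a)
    (haK : schur (fun x y => ‖entry a x y‖ₑ) ≠ ∞) (i : Mode) :
    (Summable fun y : Idx ν => ‖entry a (y.1, i) (0, y.2)‖) ∧
      ∑' y : Idx ν, ‖entry a (y.1, i) (0, y.2)‖ ≤ (schur fun x y => ‖entry a x y‖ₑ).toReal := by
  have h := tsum_row_le (fun x y => ‖entry a x y‖ₑ) (fun κ x y => by rw [ha κ x y]) i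
  have hn := (h.trans_lt haK.lt_top).ne
  have e : ∀ y : Idx ν, ‖entry a (y.1, i) (0, y.2)‖ = ‖entry a (y.1, i) (0, y.2)‖ₑ.toReal :=
    fun y => (toReal_enorm _).symm
  simp only [e]
  refine ⟨ENNReal.summable_toReal hn, ?_⟩
  rw [← ENNReal.tsum_toReal_eq (ENNReal.ne_top_of_tsum_ne_top hn)]
  exact ENNReal.toReal_mono haK h

theorem hasSum_isSym (hr : 0 ≤ r) {a : Op (Idx ν)} (ha : ∀ κ, Inv (shift κ) a)
    (haK : schur (fun x y => ‖entry a x y‖ₑ) ≠ ∞) {T : Phase r →L[ℂ] Phase r} (hT : IsSym a θ T)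
    (φ : Phase r) (i : Mode) :
    HasSum (fun y : Idx ν => entry a (y.1, i) (0, y.2) * ex θ y.1 * coord φ y.2)
      (coord (T φ) i) := by
  have hs := (summable_row ha haK i).1
  have hs2 : Summable fun y : Idx ν => entry a (y.1, i) (0, y.2) * ex θ y.1 * coord φ y.2 := by
    refine Summable.of_norm_bounded (hs.mul_right ‖φ‖) fun y => ?_
    rw [norm_mul, norm_mul, norm_ex, mul_one]
    gcongr
    exact norm_coord_le hr φ _
  have h := hs2.hasSum
  have h2 := h
  rw [← (Equiv.prodComm _ _).hasSum_iff] at h2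
  have h3 := h2.prod_fiberwise fun l => (hasSum_sym a θ i l).mul_right (coord φ l)
  simp only [← hT i] at h3
  rwa [h3.unique (hasSum_mat T φ i)] at h

/-- The finite row sums make T bounded in the sup norm of the coordinates, where uniqueness is
proved: there the diagonal part can be removed one coordinate at a time. -/
theorem norm_coord_isSym_le (hr : 0 ≤ r) {a : Op (Idx ν)} (ha : ∀ κ, Inv (shift κ) a)
    (haK : schur (fun x y => ‖entry a x y‖ₑ) ≠ ∞) {T : Phase r →L[ℂ] Phase r} (hT : IsSym a θ T)
    {φ : Phase r} {b : ℝ} (hb : 0 ≤ b) (hφ : ∀ j, ‖coord φ j‖ ≤ b) (i : Mode) :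
    ‖coord (T φ) i‖ ≤ (schur fun x y => ‖entry a x y‖ₑ).toReal * b := by
  obtain ⟨hs, h1⟩ := summable_row ha haK i
  rw [← (hasSum_isSym hr ha haK hT φ i).tsum_eq]
  refine (tsum_of_norm_bounded (hs.mul_right b).hasSum fun y => ?_).trans ?_
  · rw [norm_mul, norm_mul, norm_ex, mul_one]
    gcongr
    exact hφ _
  · rw [tsum_mul_right]
    gcongr

end Symbols


/-! ### The propagator -/

section Propagator

variable {ν : ℕ} {r : ℝ}

theorem exists_diag (r : ℝ) (E : Mode → ℝ) : ∃ D : ℝ → Phase r →L[ℂ] Phase r, (∀ s, ‖D s‖ ≤ 1) ∧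
    (∀ s φ i, coord (D s φ) i = Complex.exp (-Complex.I * (s * E i)) * coord φ i) ∧
    ∀ φ, Continuous fun s => D s φ := by
  have hn : ∀ (s : ℝ) i, ‖Complex.exp (-Complex.I * (s * E i))‖ = 1 := fun s i => by
    have h := Complex.norm_exp_ofReal_mul_I (-(s * E i))
    rw [← h]; congr 2; push_cast; ring
  have h1 : ∀ s : ℝ, ∃ T : Phase r →L[ℂ] Phase r, ‖T‖ ≤ 1 ∧
      ∀ i j, mat T i j = if i = j then Complex.exp (-Complex.I * (s * E i)) else 0 := fun s => by
    refine exists_mat_eq zero_le_one ?_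
    have e : ∀ i j : Mode, ENNReal.ofReal (jw r i / jw r j) *
        ‖(if i = j then Complex.exp (-Complex.I * (s * E i)) else 0 : ℂ)‖ₑ = if i = j then 1 else 0 := by
      intro i j
      split_ifs with h
      · subst h
        rw [div_self (jw_pos r i).ne', ← ofReal_norm, hn]; simp
      · simp
    simp only [e, ENNReal.ofReal_one]
    refine schur_le_iff.2 ⟨fun j => ?_, fun i => ?_⟩
    · rw [tsum_ite_eq]
    · simp only [eq_comm (a := i)]
      rw [tsum_ite_eq]
  choose D hD hDm using h1
  have hc : ∀ s φ i, coord (D s φ) i = Complex.exp (-Complex.I * (s * E i)) * coord φ i := by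
    intro s φ i
    refine (hasSum_mat (D s) φ i).unique ?_
    simp only [hDm, ite_mul, zero_mul]
    have h := hasSum_ite_eq i (Complex.exp (-Complex.I * (s * E i)) * coord φ i)
    refine h.congr_fun fun j => ?_
    by_cases hij : i = j
    · subst hij; simp
    · simp [hij, Ne.symm hij]
  refine ⟨D, hD, hc, fun φ => ?_⟩
  have hb : ∀ s j, D s (bas r j) = Complex.exp (-Complex.I * (s * E j)) • bas r j := fun s j =>
    phase_ext fun i => by
      rw [hc, coord_smul, coord_bas]
      split_ifs with h
      · rw [h]
      · simp
  refine continuous_of_uniform_approx_of_continuous fun u hu => ?_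
  obtain ⟨ε, hε, hεu⟩ := Metric.mem_uniformity_dist.1 hu
  have h := Metric.tendsto_nhds.1 (hasSum_bas φ) ε hε
  obtain ⟨F, hF⟩ := h.exists
  refine ⟨fun s => D s (∑ j ∈ F, coord φ j • bas r j), ?_, fun s => hεu ?_⟩
  · simp only [map_sum, map_smul, hb]
    fun_prop
  · rw [dist_comm] at hF
    rw [dist_eq_norm] at hF ⊢
    rw [← map_sub]
    refine ((D s).le_opNorm _).trans_lt (lt_of_le_of_lt ?_ hF)
    exact mul_le_of_le_one_left (norm_nonneg _) (hD s)

/-- The unperturbed frequencies. -/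
def modeFreq (mass : ℝ) (i : Mode) : ℝ := sg i.1 * eigB mass i.2

/-- The equation `i ∂_t u = (diag(B, -B) + T(ω t)) u`, coordinatewise. -/
def IsFlow (mass : ℝ) (T : EuclideanSpace ℝ (Fin ν) → Phase r →L[ℂ] Phase r)
    (ω : EuclideanSpace ℝ (Fin ν)) (u : ℝ → Phase r) : Prop :=
  ∀ t i, HasDerivAt (fun s => coord (u s) i)
    (-Complex.I * (modeFreq mass i * coord (u t) i + coord (T (t • ω) (u t)) i)) t

theorem coord_sub (φ ψ : Phase r) (i : Mode) : coord (φ - ψ) i = coord φ i - coord ψ i :=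
  map_sub (coordCLM r i) φ ψ

theorem IsFlow.sub {mass : ℝ} {T : EuclideanSpace ℝ (Fin ν) → Phase r →L[ℂ] Phase r}
    {ω : EuclideanSpace ℝ (Fin ν)} {u v : ℝ → Phase r} (hu : IsFlow mass T ω u)
    (hv : IsFlow mass T ω v) : IsFlow mass T ω fun t => u t - v t := fun t i => by
  have h := (hu t i).sub (hv t i)
  simp only [map_sub, coord_sub]
  refine (h.congr_deriv ?_)
  ring

/-- Multiplying a coordinate by the phase e^{idt} removes its frequency d, which is not bounded
uniformly in i. The derivative that remains is at most K times the sup of the coordinates, so each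
integration improves (cs)^n/n! to the next such term, as in Picard iteration. The parameter s runs
along the segment from τ to τ + δ, so both directions of time are covered. -/
theorem norm_coord_le_of_isFlow (hr : 0 ≤ r) {mass : ℝ}
    {T : EuclideanSpace ℝ (Fin ν) → Phase r →L[ℂ] Phase r} {ω : EuclideanSpace ℝ (Fin ν)}
    {P : Op (Idx ν)} (hP : ∀ κ, Inv (shift κ) P) (hPK : schur (fun x y => ‖entry P x y‖ₑ) ≠ ∞)
    (hT : ∀ θ, IsSym P θ (T θ)) {u : ℝ → Phase r} (hu : IsFlow mass T ω u) {τ δ B : ℝ}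
    (h0 : u τ = 0) (hB0 : 0 ≤ B) (hB : ∀ s ∈ Set.Icc (0 : ℝ) 1, ‖u (τ + s * δ)‖ ≤ B) (n : ℕ) :
    ∀ s ∈ Set.Icc (0 : ℝ) 1, ∀ i, ‖coord (u (τ + s * δ)) i‖ ≤
      B * ((|δ| * (schur fun x y => ‖entry P x y‖ₑ).toReal * s) ^ n / n.factorial) := by
  set K := (schur fun x y => ‖entry P x y‖ₑ).toReal with hK
  have hK0 : 0 ≤ K := ENNReal.toReal_nonneg
  induction n with
  | zero => intro s hs i; simpa using (norm_coord_le hr _ i).trans (hB s hs)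
  | succ n ih =>
    intro s hs i
    set d := modeFreq mass i with hd
    have hne : ∀ x : ℝ, ‖Complex.exp (Complex.I * (d * (τ + x * δ)))‖ = 1 := fun x => by
      have h := Complex.norm_exp_ofReal_mul_I (d * (τ + x * δ))
      rw [← h]; congr 2; push_cast; ring
    set G : ℝ → ℂ := fun x => Complex.exp (Complex.I * (d * (τ + x * δ)))
      * coord (u (τ + x * δ)) i with hG
    have hGn : ∀ x, ‖G x‖ = ‖coord (u (τ + x * δ)) i‖ := fun x => by
      rw [hG]; simp only [norm_mul, hne, one_mul]
    have hGd : ∀ x : ℝ, HasDerivAt G (δ * (Complex.exp (Complex.I * (d * (τ + x * δ)))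
        * (-Complex.I * coord (T ((τ + x * δ) • ω) (u (τ + x * δ))) i))) x := fun x => by
      have hl : HasDerivAt (fun x : ℝ => τ + x * δ) δ x := by
        simpa using ((hasDerivAt_id x).mul_const δ).const_add τ
      have h1 := (hu (τ + x * δ) i).scomp x hl
      have hlc : HasDerivAt (fun x : ℝ => Complex.I * (d * (τ + x * δ)) : ℝ → ℂ)
          (Complex.I * (d * δ)) x := by
        have h := (hl.ofReal_comp.const_mul (d : ℂ)).const_mul Complex.I
        simpa using h
      have h2 := hlc.cexp.mul h1
      refine h2.congr_deriv ?_
      simp only [Function.comp_apply, Complex.real_smul]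
      ring
    rw [← hGn]
    refine image_norm_le_of_norm_deriv_right_le_deriv_boundary (a := 0) (b := 1)
      (B := fun s => B * ((|δ| * K * s) ^ (n + 1) / (n + 1).factorial))
      (B' := fun s => B * (|δ| * K * ((|δ| * K * s) ^ n / n.factorial)))
      (fun x _ => (hGd x).continuousAt.continuousWithinAt)
      (fun x _ => (hGd x).hasDerivWithinAt) ?_ (fun x => ?_) (fun x hx => ?_) hs
    · rw [hGn]
      have h : coord (u (τ + 0 * δ)) i = 0 := by
        rw [zero_mul, add_zero, h0]; exact map_zero (coordCLM r i)
      rw [h]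
      simp
    · have h1 : HasDerivAt (fun s : ℝ => |δ| * K * s) (|δ| * K) x := by
        simpa using (hasDerivAt_id x).const_mul (|δ| * K)
      have h := ((h1.pow (n + 1)).div_const ((n + 1).factorial : ℝ)).const_mul B
      refine h.congr_deriv ?_
      rw [Nat.factorial_succ]
      push_cast
      have : ((n.factorial : ℕ) : ℝ) ≠ 0 := by positivity
      have : (n + 1 : ℝ) ≠ 0 := by positivity
      field_simp
    · have hx' : x ∈ Set.Icc (0 : ℝ) 1 := ⟨hx.1, hx.2.le⟩
      have h3 := norm_coord_isSym_le hr hP hPK (hT ((τ + x * δ) • ω))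
        (b := B * ((|δ| * K * x) ^ n / n.factorial)) (by have := hx.1; positivity) (ih x hx') i
      rw [norm_mul, norm_mul, hne, norm_mul, norm_neg, Complex.norm_I, one_mul, one_mul,
        Complex.norm_real, Real.norm_eq_abs]
      calc _ ≤ |δ| * (K * (B * ((|δ| * K * x) ^ n / n.factorial))) := by gcongr
        _ = _ := by ring

theorem eq_zero_of_isFlow (hr : 0 ≤ r) {mass : ℝ}
    {T : EuclideanSpace ℝ (Fin ν) → Phase r →L[ℂ] Phase r} {ω : EuclideanSpace ℝ (Fin ν)}
    {P : Op (Idx ν)} (hP : ∀ κ, Inv (shift κ) P) (hPK : schur (fun x y => ‖entry P x y‖ₑ) ≠ ∞)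
    (hT : ∀ θ, IsSym P θ (T θ)) {u : ℝ → Phase r} (hu : IsFlow mass T ω u) (huc : Continuous u)
    {τ : ℝ} (h0 : u τ = 0) (t : ℝ) : u t = 0 := by
  obtain ⟨B, hB⟩ := (isCompact_Icc (a := (0 : ℝ)) (b := 1)).exists_bound_of_continuousOn
    (f := fun s => u (τ + s * (t - τ))) (by fun_prop)
  have hB0 : 0 ≤ B := (norm_nonneg _).trans (hB 0 (by simp))
  refine phase_ext fun i => ?_
  have h := fun n => norm_coord_le_of_isFlow hr hP hPK hT hu h0 hB0 hB n 1 (by simp) i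
  have h2 := (FloorSemiring.tendsto_pow_div_factorial_atTop
    (|t - τ| * (schur fun x y => ‖entry P x y‖ₑ).toReal * 1)).const_mul B
  rw [mul_zero] at h2
  have h3 := ge_of_tendsto' h2 h
  rw [one_mul, add_sub_cancel] at h3
  rw [norm_le_zero_iff.1 h3]
  exact (map_zero (coordCLM r i)).symm

/-- The term with indices k and j oscillates with frequency ω·k - E_j, and the conjugation identity
says that this satisfies the equation term by term. It also replaces the unbounded factor ω·k - E_j
by the fixed λ_i and an entry of P W. The derivatives are thus dominated by absolutely summable rows
and the series may be differentiated. -/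
theorem hasDerivAt_coord {mass : ℝ} {ω : EuclideanSpace ℝ (Fin ν)} {P W : Op (Idx ν)}
    {z : Idx ν → ℂ} (hr : 0 ≤ r) (hP : ∀ κ, Inv (shift κ) P) (hW : ∀ κ, Inv (shift κ) W)
    (hWK : schur (fun x y => ‖entry W x y‖ₑ) ≠ ∞)
    (hPWK : schur (fun x y => ‖entry (P * W) x y‖ₑ) ≠ ∞)
    (hC : Conj (freq mass ω) P W z 0)
    {T S : EuclideanSpace ℝ (Fin ν) → Phase r →L[ℂ] Phase r} (hT : ∀ θ, IsSym P θ (T θ))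
    (hS : ∀ θ, IsSym W θ (S θ)) {E : Mode → ℝ} (hE : ∀ j, (E j : ℂ) = modeFreq mass j + z (0, j))
    {D : ℝ → Phase r →L[ℂ] Phase r}
    (hD : ∀ s φ i, coord (D s φ) i = Complex.exp (-Complex.I * (s * E i)) * coord φ i)
    (τ : ℝ) (v : Phase r) : IsFlow mass T ω fun t => S (t • ω) (D (t - τ) v) := by
  intro t i
  set g : Idx ν → ℝ → ℂ := fun y s => entry W (y.1, i) (0, y.2) * ex (s • ω) y.1
    * coord (D (s - τ) v) y.2 with hg
  set g' : Idx ν → ℝ → ℂ := fun y s => -Complex.I * (modeFreq mass i * g y s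
    + entry (P * W) (y.1, i) (0, y.2) * ex (s • ω) y.1 * coord (D (s - τ) v) y.2) with hg'
  have hsum : ∀ s, HasSum (fun y => g y s) (coord (S (s • ω) (D (s - τ) v)) i) := fun s =>
    hasSum_isSym hr hW hWK (hS _) _ i
  have hsum2 : ∀ s, HasSum (fun y => g' y s) (-Complex.I * (modeFreq mass i
      * coord (S (s • ω) (D (s - τ) v)) i + coord (T (s • ω) (S (s • ω) (D (s - τ) v))) i)) :=
    fun s => (((hsum s).mul_left _).add (hasSum_isSym hr (fun κ => (hP κ).mul (hW κ)) hPWK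
      ((hT (s • ω)).mul hP (hS (s • ω))) (D (s - τ) v) i)).mul_left _
  have hDn : ∀ s j, ‖coord (D s v) j‖ ≤ ‖v‖ := fun s j => by
    have h := Complex.norm_exp_ofReal_mul_I (-(s * E j))
    have e : Complex.exp (-Complex.I * (s * E j)) = Complex.exp ((-(s * E j) : ℝ) * Complex.I) := by
      congr 1; push_cast; ring
    rw [hD, norm_mul, e, h, one_mul]
    exact norm_coord_le hr _ _
  have hder : ∀ y s, HasDerivAt (g y) (g' y s) s := fun y s => by
    obtain ⟨k, j⟩ := y
    have e : g (k, j) = fun s : ℝ => Complex.exp (Complex.I * (s * dotk ω k - (s - τ) * E j))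
        * (entry W (k, i) (0, j) * coord v j) := by
      funext s
      simp only [hg, hD, ex]
      have h : (dotk (s • ω) k : ℝ) = s * dotk ω k := by
        simp only [dotk, PiLp.smul_apply, smul_eq_mul, mul_assoc, Finset.mul_sum]
      rw [h, show Complex.I * ((s : ℂ) * dotk ω k - (s - τ) * E j)
        = Complex.I * ((s * dotk ω k : ℝ) : ℂ) + -Complex.I * (((s - τ : ℝ) : ℂ) * E j) by
          push_cast; ring, Complex.exp_add]
      ring
    have hc := hC (k, i) (0, j)
    have hf : ((freq mass ω (k, i) : ℂ) - freq mass ω (0, j))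
        = dotk ω k + modeFreq mass i - modeFreq mass j := by
      simp only [freq, modeFreq]
      rw [show dotk ω 0 = 0 by simp [dotk]]
      push_cast; ring
    have hmul0 : W * (0 : Op (Idx ν)) = 0 := mul_zero W
    rw [hf, hmul0, entry_zero, add_zero] at hc
    have hd : HasDerivAt (fun s : ℝ => Complex.I * (s * dotk ω k - (s - τ) * E j) : ℝ → ℂ)
        (Complex.I * (dotk ω k - E j)) s := by
      have h1 : HasDerivAt (fun s : ℝ => (s : ℂ)) 1 s := Complex.ofRealCLM.hasDerivAt
      simpa using ((h1.mul_const (dotk ω k : ℂ)).sub ((h1.sub_const (τ : ℂ)).mul_const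
        (E j : ℂ))).const_mul Complex.I
    have h2 := hd.cexp.mul_const (entry W (k, i) (0, j) * coord v j)
    rw [← e] at h2
    refine h2.congr_deriv ?_
    have e2 : entry (P * W) (k, i) (0, j)
        = -(dotk ω k + modeFreq mass i - E j) * entry W (k, i) (0, j) := by
      rw [hE]; linear_combination hc
    have e3 := congrFun e s
    simp only [hg'] at *
    rw [e2]
    have e4 : -(dotk ω k + modeFreq mass i - E j : ℂ) * entry W (k, i) (0, j) * ex (s • ω) k
        * coord (D (s - τ) v) j = -(dotk ω k + modeFreq mass i - E j) * g (k, j) s := by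
      simp only [hg]; ring
    rw [e4, e3]
    ring
  have hbd : ∀ y s, ‖g' y s‖ ≤ (|modeFreq mass i| * ‖entry W (y.1, i) (0, y.2)‖
      + ‖entry (P * W) (y.1, i) (0, y.2)‖) * ‖v‖ := fun y s => by
    simp only [hg', hg]
    rw [norm_mul, norm_neg, Complex.norm_I, one_mul]
    refine (norm_add_le _ _).trans ?_
    simp only [norm_mul, norm_ex, mul_one, Complex.norm_real, Real.norm_eq_abs]
    rw [add_mul, mul_assoc]
    gcongr <;> exact hDn _ _
  have hu : Summable fun y : Idx ν => (|modeFreq mass i| * ‖entry W (y.1, i) (0, y.2)‖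
      + ‖entry (P * W) (y.1, i) (0, y.2)‖) * ‖v‖ :=
    (((summable_row hW hWK i).1.mul_left _).add
      (summable_row (fun κ => (hP κ).mul (hW κ)) hPWK i).1).mul_right _
  have h := hasDerivAt_tsum hu hder hbd (hsum t).summable t
  simp only [(hsum _).tsum_eq, (hsum2 _).tsum_eq] at h
  exact h

end Propagator


/-! ### The propagator of a reducible system and the conclusion -/

section Main

variable {ν : ℕ} {r : ℝ}

theorem coord_eq_driving {mass : ℝ} {V : EuclideanSpace ℝ (Fin ν) → ℝ → ℝ}
    {θ : EuclideanSpace ℝ (Fin ν)} {T : Phase r →L[ℂ] Phase r}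
    (hT : ∀ i j, mat T i j = pertMat mass V θ i j) (φ : Phase r) (s : Bool) (m : ℕ+) :
    coord (T φ) (s, m) = sg s * driving mass (V θ) (φ.fst.coeff + φ.snd.coeff) m := by
  have h := hasSum_mat T φ (s, m)
  rw [← (Equiv.prodComm _ _).hasSum_iff] at h
  have h2 := h.prod_fiberwise fun n => hasSum_fintype _
  rw [← h2.tsum_eq]
  simp only [driving, powB, mulOp, Pi.smul_apply, smul_eq_mul, Pi.add_apply]
  rw [← tsum_mul_left, ← tsum_mul_left, ← tsum_mul_left]
  refine tsum_congr fun n => ?_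
  rw [Fintype.sum_bool]
  simp only [Function.comp_apply, Equiv.prodComm_apply, Prod.swap_prod_mk, hT, pertMat, coord]
  simp
  ring

theorem hamiltonian_eq {mass : ℝ} {V : EuclideanSpace ℝ (Fin ν) → ℝ → ℝ}
    {θ : EuclideanSpace ℝ (Fin ν)} {T : Phase r →L[ℂ] Phase r}
    (hT : ∀ i j, mat T i j = pertMat mass V θ i j) (φ : Phase r) (m : ℕ+) :
    (hamiltonian mass (V θ) φ.fst.coeff φ.snd.coeff).1 m
      = modeFreq mass (false, m) * coord φ (false, m) + coord (T φ) (false, m) ∧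
    (hamiltonian mass (V θ) φ.fst.coeff φ.snd.coeff).2 m
      = modeFreq mass (true, m) * coord φ (true, m) + coord (T φ) (true, m) := by
  rw [coord_eq_driving hT, coord_eq_driving hT]
  simp only [hamiltonian, powB, Real.rpow_one, modeFreq, sg, coord, Pi.add_apply, Pi.sub_apply,
    Pi.neg_apply]
  constructor
  · simp
  · simp; ring

theorem isPropagator_iff {mass : ℝ} {V : EuclideanSpace ℝ (Fin ν) → ℝ → ℝ}
    {T : EuclideanSpace ℝ (Fin ν) → Phase r →L[ℂ] Phase r}
    (hT : ∀ θ i j, mat (T θ) i j = pertMat mass V θ i j) (ω : EuclideanSpace ℝ (Fin ν))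
    (U : ℝ → ℝ → Phase r →L[ℂ] Phase r) :
    IsPropagator V mass ω r U ↔ (∀ τ, U τ τ = 1) ∧
      ∀ τ φ, (Continuous fun t => U t τ φ) ∧ IsFlow mass T ω fun t => U t τ φ := by
  have h := fun t τ φ m => hamiltonian_eq (hT (t • ω)) (U t τ φ) m
  refine and_congr Iff.rfl (forall_congr' fun τ => forall_congr' fun φ => and_congr Iff.rfl ?_)
  refine forall_congr' fun t => ⟨fun hd i => ?_, fun hd m => ?_⟩
  · obtain ⟨b, m⟩ := i
    have h1 := hd m
    rw [(h t τ φ m).1, (h t τ φ m).2] at h1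
    cases b
    · exact h1.1
    · exact h1.2
  · rw [(h t τ φ m).1, (h t τ φ m).2]
    exact ⟨hd (false, m), hd (true, m)⟩

theorem schur_enorm_one_add_ne_top {a : Op (Idx ν)} (ha : schur (fun x y => ‖entry a x y‖ₑ) ≠ ∞) :
    schur (fun x y => ‖entry (1 + a) x y‖ₑ) ≠ ∞ := by
  have h1 : schur (fun x y : Idx ν => ‖entry 1 x y‖ₑ) ≤ 1 := by
    have e : ∀ x y : Idx ν, ‖entry 1 x y‖ₑ = if x = y then 1 else 0 := fun x y => by
      rw [entry_one]; split_ifs <;> simp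
    simp only [e]
    refine schur_le_iff.2 ⟨fun y => ?_, fun x => ?_⟩
    · rw [tsum_ite_eq]
    · simp only [eq_comm (a := x)]
      rw [tsum_ite_eq]
  have h2 : schur (fun x y => ‖entry (1 + a) x y‖ₑ) ≤ 1 + schur fun x y => ‖entry a x y‖ₑ :=
    (schur_mono fun x y => by rw [entry_add]; exact enorm_add_le _ _).trans
      ((schur_add_le _ _).trans (add_le_add_left h1 _))
  exact (h2.trans_lt (ENNReal.add_lt_top.2 ⟨ENNReal.one_lt_top, ha.lt_top⟩)).ne

theorem schur_enorm_le_wnorm {W : Idx ν → Idx ν → ℝ≥0∞} (hW : ∀ x y, 1 ≤ W x y)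
    (a : Op (Idx ν)) : schur (fun x y => ‖entry a x y‖ₑ) ≤ wnorm W a :=
  schur_mono fun x y => le_mul_of_one_le_left' (hW x y)

/-- A reducible system has a unique propagator, which is close to a unitary one. -/
theorem exists_propagator {w : ℕ → ℝ≥0∞} (hw : IsNatWeight w) {r c σ mass p ε : ℝ} (hr : 0 ≤ r)
    (hc : 0 ≤ c) (hσ : 0 < σ)
    (hwc : ∀ l : ℕ, ENNReal.ofReal ((1 + l : ℝ) ^ ⌈r⌉₊) ≤ ENNReal.ofReal c * w l)
    {V : EuclideanSpace ℝ (Fin ν) → ℝ → ℝ} {P Y : Op (Idx ν)} (hp : 0 ≤ p)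
    (hP : wnorm (wt w σ) P ≤ ENNReal.ofReal p) (hPi : ∀ κ, Inv (shift κ) P)
    (hPJ : ∀ x y : Idx ν, (sg x.2.1 : ℂ) * entry P x y = sg y.2.1 * starRingEnd ℂ (entry P y x))
    (hPV : ∀ θ i j, HasSum (fun k : Fin ν → ℤ => entry P (k, i) (0, j) * ex θ k)
      (pertMat mass V θ i j))
    (hε : 0 ≤ ε) (hε2 : ε < 1 / 2) (hY : wnorm (wt w σ) Y ≤ ENNReal.ofReal ε)
    (hYi : ∀ κ, Inv (shift κ) Y) {ω : EuclideanSpace ℝ (Fin ν)} {z : Idx ν → ℂ}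
    (hC : Conj (freq mass ω) P (1 + Y) z 0) :
    ∃ U : ℝ → ℝ → Phase r →L[ℂ] Phase r, IsPropagator V mass ω r U ∧
      (∀ U', IsPropagator V mass ω r U' → U' = U) ∧
      ∀ t φ, ‖U t 0 φ‖ ≤ (1 + c * ε) * (1 + c * (2 * ε)) * ‖φ‖ ∧
        ‖φ‖ ≤ (1 + c * ε) * (1 + c * (2 * ε)) * ‖U t 0 φ‖ := by
  have hW := isWeight_wt (ν := ν) hw hσ.le
  have hYh : wnorm (wt w σ) Y ≤ 1 / 2 := by
    refine hY.trans ((ENNReal.ofReal_le_ofReal hε2.le).trans_eq ?_)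
    rw [ENNReal.ofReal_div_of_pos two_pos]; simp
  have hYn : ‖Y‖ < 1 / 2 := by
    have h := (enorm_le_wnorm hW.one_le Y).trans hY
    rw [← ofReal_norm] at h
    exact ((ENNReal.ofReal_le_ofReal_iff hε).1 h).trans_lt hε2
  have hz := im_eq_zero_of_conj (J := fun x : Idx ν => sg x.2.1) (fun x => abs_sg _) hPJ hC hYn
  -- This is (1 + Y)⁻¹ - 1, in a form where the inverse is followed by a factor of finite weighted
  -- norm.
  set Y' : Op (Idx ν) := -(Ring.inverse (1 + Y) * Y) with hY'
  have hu := isUnit_one_add hW hYh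
  have hinv : Ring.inverse (1 + Y) = 1 + Y' := by
    have h : Ring.inverse (1 + Y) * (1 + Y) = 1 := Ring.inverse_mul_cancel _ hu
    rw [mul_add, mul_one] at h
    rw [hY', ← sub_eq_add_neg]
    exact eq_sub_of_add_eq h
  have e1 : (1 + Y) * (1 + Y') = 1 := by rw [← hinv]; exact Ring.mul_inverse_cancel _ hu
  have e2 : (1 + Y') * (1 + Y) = 1 := by rw [← hinv]; exact Ring.inverse_mul_cancel _ hu
  have hY'n : wnorm (wt w σ) Y' ≤ ENNReal.ofReal (2 * ε) := by
    rw [hY', wnorm_neg]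
    refine (inverse_mul_bound hW hYh Y).trans ?_
    rw [ENNReal.ofReal_mul two_pos.le]
    simp only [ENNReal.ofReal_ofNat]
    gcongr
  have hY'i : ∀ κ, Inv (shift κ) Y' := fun κ =>
    (Inv.inverse_mul hW hYh (hYi κ) (hYi κ)).neg
  obtain ⟨TP, -, hTP⟩ := exists_isSym hr hc hσ hwc hPi hp hP
  obtain ⟨TY, hTYc, hTY⟩ := exists_isSym hr hc hσ hwc hYi hε hY
  obtain ⟨TY', -, hTY'⟩ := exists_isSym hr hc hσ hwc hY'i (by positivity) hY'n
  have hs1 : ∀ θ, IsSym (1 + Y) θ (1 + TY θ) := fun θ => IsSym.one.add (hTY θ).2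
  have hs2 : ∀ θ, IsSym (1 + Y') θ (1 + TY' θ) := fun θ => IsSym.one.add (hTY' θ).2
  have hi1 : ∀ κ, Inv (shift κ) (1 + Y) := fun κ => Inv.one.add (hYi κ)
  have hi2 : ∀ κ, Inv (shift κ) (1 + Y') := fun κ => Inv.one.add (hY'i κ)
  have m1 : ∀ θ, (1 + TY θ) * (1 + TY' θ) = 1 := fun θ => by
    have h := (hs1 θ).mul hi1 (hs2 θ)
    rw [e1] at h
    exact h.unique IsSym.one
  have m2 : ∀ θ, (1 + TY' θ) * (1 + TY θ) = 1 := fun θ => by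
    have h := (hs2 θ).mul hi2 (hs1 θ)
    rw [e2] at h
    exact h.unique IsSym.one
  have hPt : schur (fun x y => ‖entry P x y‖ₑ) ≠ ∞ :=
    ((schur_enorm_le_wnorm hW.one_le P).trans_lt (hP.trans_lt ENNReal.ofReal_lt_top)).ne
  have hYt : schur (fun x y => ‖entry Y x y‖ₑ) ≠ ∞ :=
    ((schur_enorm_le_wnorm hW.one_le Y).trans_lt (hY.trans_lt ENNReal.ofReal_lt_top)).ne
  have hPYt : schur (fun x y => ‖entry (P * (1 + Y)) x y‖ₑ) ≠ ∞ := by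
    refine ((schur_enorm_le_wnorm hW.one_le _).trans_lt ?_).ne
    rw [mul_add, mul_one]
    refine (wnorm_add_le _ _).trans_lt (ENNReal.add_lt_top.2 ⟨hP.trans_lt ENNReal.ofReal_lt_top, ?_⟩)
    exact (wnorm_mul_le hW _ _).trans_lt (ENNReal.mul_lt_top (hP.trans_lt ENNReal.ofReal_lt_top)
      (hY.trans_lt ENNReal.ofReal_lt_top))
  have hTPs : ∀ θ, IsSym P θ (TP θ) := fun θ => (hTP θ).2
  have hTPV : ∀ θ i j, mat (TP θ) i j = pertMat mass V θ i j := fun θ i j => by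
    rw [hTPs θ i j]; exact (hasSum_sym P θ i j).unique (hPV θ i j)
  obtain ⟨D, hD, hDc, hDs⟩ := exists_diag r fun j => modeFreq mass j + (z (0, j)).re
  have hE : ∀ j, ((modeFreq mass j + (z (0, j)).re : ℝ) : ℂ) = modeFreq mass j + z (0, j) :=
    fun j => by
      push_cast
      congr 1
      exact Complex.ext rfl (by simp [hz])
  have hflow := hasDerivAt_coord hr hPi hi1 (schur_enorm_one_add_ne_top hYt) hPYt hC hTPs hs1 hE hDc
  have hD0 : ∀ v, D 0 v = v := fun v => phase_ext fun i => by rw [hDc]; simp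
  have hDD : ∀ s v, D (-s) (D s v) = v := fun s v => phase_ext fun i => by
    rw [hDc, hDc, ← mul_assoc, ← Complex.exp_add]
    push_cast
    rw [show -Complex.I * (-(s : ℂ) * (modeFreq mass i + (z (0, i)).re)) + -Complex.I * (s
      * (modeFreq mass i + (z (0, i)).re)) = 0 by ring, Complex.exp_zero, one_mul]
  have hA : ∀ θ (v : Phase r), ‖(1 + TY θ) v‖ ≤ (1 + c * ε) * ‖v‖ := fun θ v => by
    rw [add_mul, one_mul]
    exact (norm_add_le _ _).trans (add_le_add_right ((TY θ).le_of_opNorm_le (hTY θ).1 v) _)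
  have hB : ∀ θ (v : Phase r), ‖(1 + TY' θ) v‖ ≤ (1 + c * (2 * ε)) * ‖v‖ := fun θ v => by
    rw [add_mul, one_mul]
    exact (norm_add_le _ _).trans (add_le_add_right ((TY' θ).le_of_opNorm_le (hTY' θ).1 v) _)
  have hDn : ∀ s (v : Phase r), ‖D s v‖ ≤ ‖v‖ := fun s v => by
    simpa using (D s).le_of_opNorm_le (hD s) v
  have hbound : ∀ θ θ' s (v : Phase r), ‖(1 + TY θ) (D s ((1 + TY' θ') v))‖
      ≤ (1 + c * ε) * (1 + c * (2 * ε)) * ‖v‖ := fun θ θ' s v => by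
    refine (hA _ _).trans ?_
    rw [mul_assoc]
    gcongr
    exact (hDn _ _).trans (hB _ _)
  have a1 : ∀ θ v, (1 + TY θ) ((1 + TY' θ) v) = v := fun θ v => DFunLike.congr_fun (m1 θ) v
  have a2 : ∀ θ v, (1 + TY' θ) ((1 + TY θ) v) = v := fun θ v => DFunLike.congr_fun (m2 θ) v
  -- Floquet form: pass to the reduced coordinates at time τ, evolve by phases, and return at time
  -- t.
  let U : ℝ → ℝ → Phase r →L[ℂ] Phase r := fun t τ =>
    (1 + TY (t • ω)) * (D (t - τ) * (1 + TY' (τ • ω)))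
  have hU : ∀ t τ φ, U t τ φ = (1 + TY (t • ω)) (D (t - τ) ((1 + TY' (τ • ω)) φ)) :=
    fun t τ φ => rfl
  have hUp : (∀ τ, U τ τ = 1) ∧ ∀ τ φ, (Continuous fun t => U t τ φ) ∧
      IsFlow mass TP ω fun t => U t τ φ := by
    refine ⟨fun τ => ?_, fun τ φ => ⟨?_, ?_⟩⟩
    · ext1 φ
      rw [hU, sub_self, hD0, a1]
      rfl
    · simp only [hU]
      refine Continuous.clm_apply (by fun_prop) ((hDs _).comp (by fun_prop))
    · simp only [hU]
      exact hflow τ _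
  refine ⟨U, (isPropagator_iff hTPV ω U).2 hUp, fun U' hU' => ?_, fun t φ => ⟨?_, ?_⟩⟩
  · obtain ⟨h1, h2⟩ := (isPropagator_iff hTPV ω U').1 hU'
    funext t τ
    ext1 φ
    have h := eq_zero_of_isFlow hr hPi hPt hTPs ((h2 τ φ).2.sub (hUp.2 τ φ).2)
      ((h2 τ φ).1.sub (hUp.2 τ φ).1) (τ := τ) (by rw [h1, hUp.1, sub_self]) t
    exact sub_eq_zero.1 h
  · exact hbound _ _ _ _
  -- The lower bound is the upper bound for the inverse U(0, t), which has the same Floquet form.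
  · have h := hbound ((0 : ℝ) • ω) (t • ω) (-(t - 0)) (U t 0 φ)
    rwa [hU, a2, hDD, a1] at h

end Main

end KleinGordon
end

theorem corollary1p2 (ν : ℕ) (hν : 1 ≤ ν)
    (V : EuclideanSpace ℝ (Fin ν) → ℝ → ℝ) (ρ : ℝ) (hρ : 0 < ρ)
    (hV1 : KleinGordon.CondV1 ρ V) (hV2 : KleinGordon.CondV2 V)
    (mass : ℝ) (hmass : 0 ≤ mass) (α : ℝ) (hα0 : 0 < α) (hα1 : α < 1) :
    ∃ γ₀ > 0, ∃ C > 0, ∀ γ : ℝ, 0 < γ → γ < γ₀ →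
      ∃ Mstar > 1, ∃ Ω : ℝ → Set (EuclideanSpace ℝ (Fin ν)),
        (∀ M ≥ Mstar, MeasurableSet (Ω M) ∧ Ω M ⊆ KleinGordon.annulus ν M ∧
          MeasureTheory.volume.real (KleinGordon.annulus ν M \ Ω M) /
            MeasureTheory.volume.real (KleinGordon.annulus ν M) ≤ C * γ) ∧
        ∀ r : ℝ, 0 ≤ r → ∃ c₁ > 0, ∃ c₂ > 0, ∃ c' > 0, ∀ M ≥ Mstar, ∀ ω ∈ Ω M,
          ∃ U : ℝ → ℝ → (KleinGordon.Phase r →L[ℂ] KleinGordon.Phase r),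
            KleinGordon.IsPropagator V mass ω r U ∧
            (∀ U', KleinGordon.IsPropagator V mass ω r U' → U' = U) ∧
            ∀ (t : ℝ) (φ₀ : KleinGordon.Phase r),
              (c₁ * ‖φ₀‖ ≤ ‖U t 0 φ₀‖ ∧ ‖U t 0 φ₀‖ ≤ c₂ * ‖φ₀‖) ∧
              (1 - c' / M ^ ((1 - α) / 2)) * ‖φ₀‖ ≤ ‖U t 0 φ₀‖ ∧
              ‖U t 0 φ₀‖ ≤ (1 + c' / M ^ ((1 - α) / 2)) * ‖φ₀‖ := by
  obtain ⟨w, hw, hwq, σ, hσ, p, hp, P, hP, hP0, hPi, hPJ, hPV⟩ :=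
    KleinGordon.exists_floquet_operator hν hρ hV1 hV2 mass
  -- The nonresonance thresholds are chosen in terms of γ so that the excluded fraction is at most γ
  -- itself; hence both constants can be 1.
  refine ⟨1, one_pos, 1, one_pos, fun γ hγ _ => ?_⟩
  obtain ⟨M₁, hM₁, C, hC, hred⟩ :=
    KleinGordon.exists_reducible_frequencies hν hw hmass hσ hp hγ
  have hΩ : ∀ M : ℝ, ∃ Ω ⊆ KleinGordon.annulus ν M, MeasurableSet Ω ∧ (M ≥ M₁ →
      MeasureTheory.volume (KleinGordon.annulus ν M \ Ω)
        ≤ ENNReal.ofReal γ * MeasureTheory.volume (KleinGordon.annulus ν M) ∧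
      ∀ ω ∈ Ω, ∃ (Y : KleinGordon.Op (KleinGordon.Idx ν)) (z : KleinGordon.Idx ν → ℂ),
        KleinGordon.wnorm (KleinGordon.wt w (σ / 2)) Y ≤ ENNReal.ofReal (C / Real.sqrt M) ∧
        KleinGordon.Conj (KleinGordon.freq mass ω) P (1 + Y) z 0 ∧
        ∀ κ, KleinGordon.Inv (KleinGordon.shift κ) Y) := fun M => by
    by_cases hM : M ≥ M₁
    · obtain ⟨Ω, h1, h2, h3, h4⟩ := hred M hM P hP hP0 hPi
      refine ⟨Ω, h1, h2, fun _ => ⟨h3, fun ω hω => ?_⟩⟩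
      obtain ⟨Y, z, b1, -, b3, b4⟩ := h4 ω hω
      exact ⟨Y, z, b1, b3, fun κ => (b4 κ).1⟩
    · exact ⟨∅, Set.empty_subset _, MeasurableSet.empty, fun h => absurd h hM⟩
  choose Ω hsub hmeas hΩ using hΩ
  -- The summand (4C)² gives C/√M ≤ 1/4, below the threshold 1/2 of `exists_propagator`.
  refine ⟨M₁ + (4 * C) ^ 2, by nlinarith, Ω, fun M hM => ⟨hmeas M, hsub M, ?_⟩, fun r hr => ?_⟩
  · have hM' : M ≥ M₁ := by nlinarith
    have hfin : MeasureTheory.volume (KleinGordon.annulus ν M) ≠ ⊤ :=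
      (MeasureTheory.measure_mono Set.sdiff_subset |>.trans_lt
        MeasureTheory.measure_closedBall_lt_top).ne
    refine div_le_of_le_mul₀ MeasureTheory.measureReal_nonneg (by linarith) ?_
    have h := ENNReal.toReal_mono (ENNReal.mul_ne_top ENNReal.ofReal_ne_top hfin) (hΩ M hM').1
    rw [ENNReal.toReal_mul, ENNReal.toReal_ofReal hγ.le] at h
    rw [one_mul]
    exact h
  -- The exponent r enters the constants only through c, after Ω has been fixed.
  obtain ⟨c, hc, hwc⟩ := hwq ⌈r⌉₊
  have hc'0 : 0 < (3 * c + 2 * c ^ 2) * C := by positivity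
  refine ⟨1 / (1 + (3 * c + 2 * c ^ 2) * C), by positivity, 1 + (3 * c + 2 * c ^ 2) * C,
    by positivity, (3 * c + 2 * c ^ 2) * C, hc'0, fun M hM ω hω => ?_⟩
  set c' := (3 * c + 2 * c ^ 2) * C with hc'
  have hM' : M ≥ M₁ := by nlinarith
  have hM1 : 1 ≤ M := by linarith
  obtain ⟨Y, z, hY, hconj, hYi⟩ := (hΩ M hM').2 ω hω
  have hsq : 4 * C ≤ Real.sqrt M := Real.le_sqrt_of_sq_le (by linarith)
  have hs0 : 0 < Real.sqrt M := by linarith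
  set ε := C / Real.sqrt M with hε
  have hε0 : 0 ≤ ε := by positivity
  have hε4 : ε ≤ 1 / 4 := by rw [hε, div_le_iff₀ hs0]; linarith
  have hPw : KleinGordon.wnorm (KleinGordon.wt w (σ / 2)) P ≤ ENNReal.ofReal p :=
    (KleinGordon.wnorm_mono (fun x y => (KleinGordon.wt_mono w (by linarith) x y).trans
      (KleinGordon.wt_le_wtBig w hσ.le x y)) P).trans hP
  obtain ⟨U, hU, huniq, hb⟩ := KleinGordon.exists_propagator hw hr hc.le (half_pos hσ) hwc hp.le
    hPw hPi hPJ hPV hε0 (by linarith) hY hYi hconj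
  refine ⟨U, hU, huniq, fun t φ => ?_⟩
  obtain ⟨h1, h2⟩ := hb t φ
  have hpow1 : 1 ≤ M ^ ((1 - α) / 2) := Real.one_le_rpow hM1 (by linarith)
  have hpow2 : M ^ ((1 - α) / 2) ≤ Real.sqrt M := by
    rw [Real.sqrt_eq_rpow]
    exact Real.rpow_le_rpow_of_exponent_le hM1 (by linarith)
  set η := c' / M ^ ((1 - α) / 2) with hη
  have hη0 : 0 ≤ η := by positivity
  have hη1 : η ≤ c' := div_le_self hc'0.le hpow1
  have hfac : (1 + c * ε) * (1 + c * (2 * ε)) ≤ 1 + η := by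
    have h3 : (3 * c + 2 * c ^ 2) * ε ≤ η := by
      rw [hη, hε, hc', ← mul_div_assoc]
      gcongr
    nlinarith [mul_nonneg (sq_nonneg c) hε0]
  have hn1 := norm_nonneg φ
  have hn2 := norm_nonneg (U t 0 φ)
  have u1 : ‖U t 0 φ‖ ≤ (1 + η) * ‖φ‖ := h1.trans (mul_le_mul_of_nonneg_right hfac hn1)
  have u2 : ‖φ‖ ≤ (1 + η) * ‖U t 0 φ‖ := h2.trans (mul_le_mul_of_nonneg_right hfac hn2)
  refine ⟨⟨?_, u1.trans (by gcongr)⟩, ?_, u1⟩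
  · rw [div_mul_eq_mul_div, one_mul, div_le_iff₀ (by positivity), mul_comm]
    exact u2.trans (by gcongr)
  -- For η ≤ 1, multiply ‖φ‖ ≤ (1 + η)‖Uφ‖ by 1 - η and use (1 - η)(1 + η) ≤ 1; for η ≥ 1 the
  -- left-hand side is not positive.
  · rcases le_total η 1 with h | h
    · have h4 := mul_le_mul_of_nonneg_left u2 (sub_nonneg.2 h)
      nlinarith [mul_nonneg (sq_nonneg η) hn2]
    · nlinarith
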